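/- Let $M$ be a connected, paracompact, Hausdorff smooth $n$-dimensional manifold, and let $F\colon TM\to[0,\infty)$ be a Finsler metric on $M$: $F$ is continuous, smooth and positive off the zero section, $F(\lambda v)=\lambda F(v)$ for $\lambda>0$, and $\frac12$ times the fiberwise Hessian of $F^2$ is positive definite at every $v\neq0$. Let $\Lambda\colon M\to(0,\infty)$ be smooth, and let $\tilde M=\mathbb R\times M$ be the standard static Finsler spacetime with Finsler function $L(\tau,v)=-\Lambda(x)\tau^2+F^2(v)$, for $(\tau,v)\in\mathbb R\times T_xM=T_{(t,x)}\tilde M$. Let $\tilde g_w$ be $\frac12$ times the fiberwise Hessian of $L$ at $w=(\tau,v)$, $v\ne0$. A vector $w=(\tau,v)$ is timelike if either $v=0$ and $\tau\neq0$, or $v\ne 0$ and $\tilde g_w(w,w)<0$; it is lightlike if $v\neq0$ and $\tilde g_w(w,w)=0$; it is spacelike if either $w=0$, or $v\neq0$ and $\tilde g_w(w,w)>0$. A curve is timelike (lightlike, spacelike) if all its left and right velocities are. Fix $a<b$. Curves $\gamma=(\theta,\sigma)\colon[a,b]\to\tilde M$ are continuous and piecewise smooth. Such a curve is a geodesic if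 it is a critical point of $E(\gamma)=\frac12\int_a^b\big(-\Lambda(\sigma)\dot\theta^2+F^2(\dot\sigma)\big)\,ds$, i.e. if $\frac{d}{dr}E(\psi(r,\cdot))|_{r=0}$ exists and equals $0$ for every proper variation $\psi$ of $\gamma$. Here a proper variation is a continuous map $\psi\colon(-\varepsilon,\varepsilon)\times[a,b]\to\tilde M$ with $\psi(0,\cdot)=\gamma$ and with fixed end points, which is smooth on each $(-\varepsilon,\varepsilon)\times[s_{j-1},s_j]$ for some subdivision $a=s_0<\dots<s_k=b$. **Theorem.** (1) A continuous piecewise smooth curve $\gamma=(\theta,\sigma)$ is a geodesic if and only if it is differentiable at every point of $[a,b]$ and satisfies on $[a,b]$, in all local natural coordinates $(x^i,v^i)$ of $TM$ (in particular, the $s$-derivative below exists), $$-\frac{\partial\Lambda}{\partial x^i}(\sigma)\,\dot\theta^2+\frac{\partial F^2}{\partial x^i}(\dot\sigma)-\frac{d}{ds}\Big(\frac{\partial F^2}{\partial v^i}(\dot\sigma)\Big)=0,\quad i=1,\dots,n,\qquad\text{and}\qquad \Lambda(\sigma)\,\dot\theta=\mathrm{const.}$$ (2) If $\gamma=(\theta,\sigma)$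 is a geodesic, then $\sigma$ is $C^1$ and $\theta$ is $C^2$ on $[a,b]$, and there is a constant $C\in\mathbb R$ such that $L(\dot\gamma(s))=C$ for all $s\in[a,b]$. (3) Let $\gamma=(\theta,\sigma)$ be a nonconstant geodesic, with $L(\dot\gamma)\equiv C$. Then $\gamma$ is spacelike or lightlike if and only if $C\geq0$. (a) If $C\ge0$, then $\dot\sigma$ never vanishes and $\gamma$ is smooth on $[a,b]$. (b) If $\sigma$ is constant equal to $x_0\in M$ on $[a,b]$, then $C<0$, $d\Lambda(x_0)=0$, and $\dot\theta$ is a nonzero constant. (4) Conversely, if $d\Lambda(x_0)=0$, then for all $\theta_0\in\mathbb R$ and $m\neq0$ the curve $s\in[a,b]\mapsto(\theta_0+m(s-a),x_0)$ is a timelike geodesic. -/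

import Mathlib

open scoped Manifold ContDiff
open Set

namespace StaticFinsler

/-- The fundamental tensor `g_w(u, u')` of `f`: half of the second derivative of `f` at `w` in the
directions `u, u'`, i.e. `(1/2) ∂²/∂r∂q f(w + r u + q u')` at `r = q = 0`. -/
noncomputable def verticalHessian {V : Type*} [AddCommGroup V] [Module ℝ V]
    (f : V → ℝ) (w u u' : V) : ℝ :=
  (1 / 2) * deriv (fun r : ℝ => deriv (fun q : ℝ => f (w + r • u + q • u')) 0) 0

section Curves

variable {E : Type*} [NormedAddCommGroup E] [NormedSpace ℝ E] {H : Type*} [TopologicalSpace H]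
  (I : ModelWithCorners ℝ E H) {N : Type*} [TopologicalSpace N] [ChartedSpace H N]

/-- `t 0 < t 1 < ⋯ < t k` is a subdivision of the interval `[a, b]`. -/
def IsSubdivision (a b : ℝ) {k : ℕ} (t : Fin (k + 1) → ℝ) : Prop :=
  StrictMono t ∧ t 0 = a ∧ t (Fin.last k) = b

/-- Continuous piecewise smooth curves `[a, b] → N`. A curve is represented by a function on `ℝ`
of which only the restriction to `[a, b]` matters. -/
def IsPiecewiseSmooth (a b : ℝ) (γ : ℝ → N) : Prop :=
  ContinuousOn γ (Icc a b) ∧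
    ∃ (k : ℕ) (t : Fin (k + 1) → ℝ), IsSubdivision a b t ∧
      ∀ j : Fin k, ContMDiffOn 𝓘(ℝ, ℝ) I ∞ γ (Icc (t j.castSucc) (t j.succ))

/-- `ψ : (-ε, ε) × [a, b] → N` is a proper variation of `γ`: it is continuous, agrees with `γ` for
`w = 0`, has fixed end points, and is smooth on each strip `(-ε, ε) × [t j, t (j+1)]` of some
subdivision of `[a, b]` (so that each `ψ w` is a continuous piecewise smooth curve). -/
structure IsProperVariation (a b : ℝ) (γ : ℝ → N) (ε : ℝ) (ψ : ℝ → ℝ → N) : Prop where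
  pos : 0 < ε
  continuousOn : ContinuousOn (fun z : ℝ × ℝ => ψ z.1 z.2) (Ioo (-ε) ε ×ˢ Icc a b)
  zero : ∀ s ∈ Icc a b, ψ 0 s = γ s
  left : ∀ w ∈ Ioo (-ε) ε, ψ w a = γ a
  right : ∀ w ∈ Ioo (-ε) ε, ψ w b = γ b
  piecewise : ∃ (k : ℕ) (t : Fin (k + 1) → ℝ), IsSubdivision a b t ∧
    ∀ j : Fin k, ContMDiffOn 𝓘(ℝ, ℝ × ℝ) I ∞ (fun z : ℝ × ℝ => ψ z.1 z.2)
      (Ioo (-ε) ε ×ˢ Icc (t j.castSucc) (t j.succ))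

end Curves

section Spacetime

variable {n : ℕ} {M : Type*} [TopologicalSpace M] [ChartedSpace (EuclideanSpace ℝ (Fin n)) M]
  [IsManifold (𝓡 n) ∞ M]

/-- Finsler metrics on `M`: continuous on `TM`, smooth and positive off the zero section,
fiberwise positively homogeneous of degree one, with positive definite fundamental tensor at every
nonzero vector. (Not assumed reversible; `F = 0` on the zero section follows by homogeneity.) -/
structure IsFinslerMetric (F : TangentBundle (𝓡 n) M → ℝ) : Prop where
  continuous : Continuous F
  smooth : ContMDiffOn (𝓡 n).tangent 𝓘(ℝ, ℝ) ∞ F {w | w.2 ≠ 0}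
  pos : ∀ (x : M) (v : TangentSpace (𝓡 n) x), v ≠ 0 → 0 < F ⟨x, v⟩
  homogeneous : ∀ (x : M) (v : TangentSpace (𝓡 n) x) (c : ℝ), 0 < c → F ⟨x, c • v⟩ = c * F ⟨x, v⟩
  posDef : ∀ (x : M) (v w : TangentSpace (𝓡 n) x), v ≠ 0 → w ≠ 0 →
    0 < verticalHessian (fun u : TangentSpace (𝓡 n) x => F ⟨x, u⟩ ^ 2) v w w

variable (F : TangentBundle (𝓡 n) M → ℝ) (Λ : M → ℝ)

/-- The Finsler function `L(τ, v) = -Λ τ² + F²(v)` of the standard static Finsler spacetime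
`ℝ × M`, on the tangent space `ℝ × T_x M` at any point `(t, x)`. -/
noncomputable def finslerFunction (x : M) (w : ℝ × TangentSpace (𝓡 n) x) : ℝ :=
  -Λ x * w.1 ^ 2 + F ⟨x, w.2⟩ ^ 2

/-- The velocity `(θ', σ')` at time `s` of `γ = (θ, σ)`, derivatives being taken within `S`. -/
noncomputable def velocity (γ : ℝ → ℝ × M) (S : Set ℝ) (s : ℝ) :
    ℝ × TangentSpace (𝓡 n) (γ s).2 :=
  (derivWithin (fun u => (γ u).1) S s,
    mfderivWithin 𝓘(ℝ, ℝ) (𝓡 n) (fun u => (γ u).2) S s (1 : ℝ))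

/-- The energy functional `E(γ) = (1/2) ∫_a^b L(γ') ds`. -/
noncomputable def energy (a b : ℝ) (γ : ℝ → ℝ × M) : ℝ :=
  (1 / 2) * ∫ s in a..b, finslerFunction F Λ (γ s).2 (velocity γ (Icc a b) s)

/-- Geodesics: continuous piecewise smooth critical points of the energy with respect to all proper
variations. -/
def IsGeodesic (a b : ℝ) (γ : ℝ → ℝ × M) : Prop :=
  IsPiecewiseSmooth (𝓘(ℝ, ℝ).prod (𝓡 n)) a b γ ∧
    ∀ (ε : ℝ) (ψ : ℝ → ℝ → ℝ × M),
      IsProperVariation (𝓘(ℝ, ℝ).prod (𝓡 n)) a b γ ε ψ →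
        HasDerivAt (fun r => energy F Λ a b (ψ r)) 0 0

/-- The function `F²` in the natural coordinates `(x, v)` of `TM` induced by the chart `e`. -/
noncomputable def coordSq (e : OpenPartialHomeomorph M (EuclideanSpace ℝ (Fin n)))
    (x v : EuclideanSpace ℝ (Fin n)) : ℝ :=
  F ⟨e.symm x, mfderiv (𝓡 n) (𝓡 n) e.symm x v⟩ ^ 2

/-- The partial derivative `∂f/∂xⁱ` at `x`. -/
noncomputable def partialDeriv (i : Fin n) (f : EuclideanSpace ℝ (Fin n) → ℝ)
    (x : EuclideanSpace ℝ (Fin n)) : ℝ :=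
  fderiv ℝ f x (EuclideanSpace.single i 1)

/-- The equation
`-∂Λ/∂xⁱ(σ) θ'² + ∂F²/∂xⁱ(σ') - d/ds (∂F²/∂vⁱ(σ')) = 0`, `i = 1, …, n`, at time `s`, in the
natural coordinates of the chart `e` (whose domain should contain `σ s`): the last derivative exists
and has the required value. -/
def EulerLagrangeAt (e : OpenPartialHomeomorph M (EuclideanSpace ℝ (Fin n)))
    (a b : ℝ) (γ : ℝ → ℝ × M) (s : ℝ) : Prop :=
  let x : ℝ → EuclideanSpace ℝ (Fin n) := fun u => e (γ u).2
  let v : ℝ → EuclideanSpace ℝ (Fin n) := derivWithin x (Icc a b)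
  ∀ i : Fin n,
    HasDerivWithinAt (fun u => partialDeriv i (fun q => coordSq F e (x u) q) (v u))
      (-partialDeriv i (fun y => Λ (e.symm y)) (x s)
          * derivWithin (fun u => (γ u).1) (Icc a b) s ^ 2
        + partialDeriv i (fun y => coordSq F e y (v s)) (x s))
      (Icc a b) s

/-- `γ = (θ, σ)` has a velocity at every point of `[a, b]` and satisfies the geodesic equations on
`[a, b]`, in all charts, together with `Λ(σ) θ' = const`. -/
structure SolvesGeodesicEquations (a b : ℝ) (γ : ℝ → ℝ × M) : Prop where
  differentiable_fst : DifferentiableOn ℝ (fun s => (γ s).1) (Icc a b)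
  differentiable_snd : MDifferentiableOn 𝓘(ℝ, ℝ) (𝓡 n) (fun s => (γ s).2) (Icc a b)
  space : ∀ e ∈ IsManifold.maximalAtlas (𝓡 n) ∞ M, ∀ s ∈ Icc a b, (γ s).2 ∈ e.source →
    EulerLagrangeAt F Λ e a b γ s
  time : ∃ c : ℝ, ∀ s ∈ Icc a b, Λ (γ s).2 * derivWithin (fun u => (γ u).1) (Icc a b) s = c

/-- `w` is timelike: a nonzero multiple of `∂_t`, or `g_w(w, w) < 0`. -/
def IsTimelikeVector (x : M) (w : ℝ × TangentSpace (𝓡 n) x) : Prop :=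
  (w.2 = 0 ∧ w.1 ≠ 0) ∨ (w.2 ≠ 0 ∧ verticalHessian (finslerFunction F Λ x) w w w < 0)

/-- `w` is lightlike: not a multiple of `∂_t`, and `g_w(w, w) = 0`. -/
def IsLightlikeVector (x : M) (w : ℝ × TangentSpace (𝓡 n) x) : Prop :=
  w.2 ≠ 0 ∧ verticalHessian (finslerFunction F Λ x) w w w = 0

/-- `w` is spacelike: zero, or not a multiple of `∂_t` and `g_w(w, w) > 0`. -/
def IsSpacelikeVector (x : M) (w : ℝ × TangentSpace (𝓡 n) x) : Prop :=
  w = 0 ∨ (w.2 ≠ 0 ∧ 0 < verticalHessian (finslerFunction F Λ x) w w w)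

/-- All right and left velocities of `γ` on `[a, b]` have the property `P`. -/
def AllVelocities (P : (x : M) → ℝ × TangentSpace (𝓡 n) x → Prop) (a b : ℝ) (γ : ℝ → ℝ × M) :
    Prop :=
  (∀ s ∈ Ico a b, P (γ s).2 (velocity γ (Icc s b) s)) ∧
    ∀ s ∈ Ioc a b, P (γ s).2 (velocity γ (Icc a s) s)

def IsTimelike (a b : ℝ) (γ : ℝ → ℝ × M) : Prop :=
  AllVelocities (IsTimelikeVector F Λ) a b γ

def IsLightlike (a b : ℝ) (γ : ℝ → ℝ × M) : Prop :=
  AllVelocities (IsLightlikeVector F Λ) a b γ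

def IsSpacelike (a b : ℝ) (γ : ℝ → ℝ × M) : Prop :=
  AllVelocities (IsSpacelikeVector F Λ) a b γ

end Spacetime

end StaticFinsler

namespace StaticFinsler

open Filter Topology MeasureTheory

/-! ### Local-to-global induction on an interval, and the first variation of a C¹ Lagrangian -/

section Calculus

/-! In a chart, `L` is a Lagrangian on a vector space. It is smooth where `v ≠ 0`, but at `v = 0`
only C¹ regularity is available: homogeneity of degree two bounds `F²` by a multiple of `‖v‖²` and
forces its differential to vanish there (`IsCoordFinslerSq.contDiffOn_one`). The argument is the
classical calculus of variations carried out with C¹ regularity, so the Euler–Lagrange equation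
always has the form "the momentum `∂L/∂v` is differentiable, with derivative `∂L/∂x`", and the
momentum is never expanded by the chain rule at zero velocity.

Geodesics solve the equations: bump variations in a chart give the weak Euler–Lagrange equation, and
`du_bois_reymond` says that the momentum is a constant plus a primitive of `∂L/∂x`. In particular it
does not jump at a corner. The Legendre map is injective, by positive definiteness of the Hessian
and, for segments through the origin, Euler's identity (`IsCoordFinslerSq.legendre_injective`).
Hence the velocity does not jump either, and the equation holds at every point
(`IsGeodesic.exists_isLocalSolution`).

Solutions are geodesics: the momentum paired with the variation field is a function on `[a, b]`
independent of the charts, and its derivative is the integrand of the first variation. The first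
variation is thus a difference of boundary terms, which vanish because the end points are fixed
(`SolvesEulerLagrange.isGeodesic`).

The rest follows from two conserved quantities. As `t` is cyclic, `Λ θ'` is a constant `c`. By
Euler's identity `L` equals the momentum paired with the velocity, minus `L`, and differentiating
this shows that `L` is constant. If `C ≥ 0` and `σ' = 0` at one instant, then `-Λ θ'² = C` forces
`θ' = 0` and `C = 0`, so `c = 0`, `θ' = 0` everywhere, `F(σ') = 0`, and the curve is constant. If
`σ'` never vanishes, the Hessian can be inverted and the equation becomes a smooth first order
system for `(x, v)`, whose solutions are smooth (`IsCoordFinslerSq.contDiffOn_of_eulerLagrange`).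
For constant `σ` the `F²` terms vanish and the equation reduces to `dΛ θ'² = 0`. -/

theorem interval_induction {P : ℝ → ℝ → Prop} {a b : ℝ} (hab : a ≤ b) (hrefl : P a a)
    (htrans : ∀ c d e, a ≤ c → c ≤ d → d ≤ e → e ≤ b → P c d → P d e → P c e)
    (hloc : ∀ s ∈ Icc a b, ∃ α β, Icc α β ∈ 𝓝[Icc a b] s ∧
      (∀ c ∈ Icc α s, a ≤ c → P c s) ∧ ∀ d ∈ Icc s β, d ≤ b → P s d) : P a b := by
  -- The supremum of the reachable points is itself reachable, by the left half of the local
  -- hypothesis. If it were less than `b`, the right half would reach beyond it.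
  set S : Set ℝ := {x | x ∈ Icc a b ∧ P a x} with hS
  have haS : a ∈ S := ⟨⟨le_rfl, hab⟩, hrefl⟩
  have hbdd : BddAbove S := ⟨b, fun x hx => hx.1.2⟩
  set s := sSup S with hs
  have has : a ≤ s := le_csSup hbdd haS
  have hsb : s ≤ b := csSup_le ⟨a, haS⟩ fun x hx => hx.1.2
  obtain ⟨α, β, hαβ, hl, hr⟩ := hloc s ⟨has, hsb⟩
  obtain ⟨δ, hδ, hsub⟩ := Metric.mem_nhdsWithin_iff.1 hαβ
  obtain ⟨c, hcS, hc⟩ := exists_lt_of_lt_csSup ⟨a, haS⟩ (show s - δ < sSup S by linarith)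
  have hcs : c ≤ s := le_csSup hbdd hcS
  have hcm : c ∈ Icc α β := hsub ⟨by
    rw [Metric.mem_ball, Real.dist_eq, abs_lt]; constructor <;> linarith, hcS.1⟩
  have hPs : P a s := htrans a c s le_rfl hcS.1.1 hcs hsb hcS.2
    (hl c ⟨hcm.1, hcs⟩ hcS.1.1)
  rcases hsb.eq_or_lt with h | h
  · rwa [h] at hPs
  · exfalso
    set d := min b (s + δ / 2) with hd
    have hsd : s < d := lt_min h (by linarith)
    have hdb : d ≤ b := min_le_left _ _
    have hd2 : d ≤ s + δ / 2 := min_le_right _ _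
    have hdm : d ∈ Icc α β := hsub ⟨by
      rw [Metric.mem_ball, Real.dist_eq, abs_lt]; constructor <;> linarith,
        ⟨has.trans hsd.le, hdb⟩⟩
    have hdS : d ∈ S := ⟨⟨has.trans hsd.le, hdb⟩,
      htrans a s d le_rfl has hsd.le hdb hPs (hr d ⟨hsd.le, hdm.2⟩ hdb)⟩
    exact absurd (le_csSup hbdd hdS) (not_le.2 hsd)

theorem uniqueDiffOn_strip {δ c d : ℝ} (hcd : c < d) :
    UniqueDiffOn ℝ (Ioo (-δ) δ ×ˢ Icc c d) :=
  (isOpen_Ioo.uniqueDiffOn).prod (uniqueDiffOn_Icc hcd)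

/-- The parameter interval is open, so this partial derivative is two-sided even over the end points
of `[c, d]`. In the other direction only a derivative within `[c, d]` is available. -/
theorem hasDerivAt_fst_of_strip {X : Type*} [NormedAddCommGroup X] [NormedSpace ℝ X]
    {δ c d : ℝ} {G : ℝ × ℝ → X}
    (hG : DifferentiableOn ℝ G (Ioo (-δ) δ ×ˢ Icc c d)) {r s : ℝ} (hr : r ∈ Ioo (-δ) δ)
    (hs : s ∈ Icc c d) :
    HasDerivAt (fun r => G (r, s)) (fderivWithin ℝ G (Ioo (-δ) δ ×ˢ Icc c d) (r, s) (1, 0)) r := by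
  have h1 := (hG (r, s) ⟨hr, hs⟩).hasFDerivWithinAt
  have h2 : HasDerivWithinAt (fun r : ℝ => (r, s)) ((1 : ℝ), (0 : ℝ)) (Ioo (-δ) δ) r :=
    ((hasDerivAt_id r).prodMk (hasDerivAt_const r s)).hasDerivWithinAt
  exact (h1.comp_hasDerivWithinAt (f := fun r : ℝ => (r, s)) r h2 fun x hx => ⟨hx, hs⟩).hasDerivAt
    (Ioo_mem_nhds hr.1 hr.2)

theorem hasDerivWithinAt_snd_of_strip {X : Type*} [NormedAddCommGroup X] [NormedSpace ℝ X]
    {δ c d : ℝ} {G : ℝ × ℝ → X}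
    (hG : DifferentiableOn ℝ G (Ioo (-δ) δ ×ˢ Icc c d)) {r s : ℝ} (hr : r ∈ Ioo (-δ) δ)
    (hs : s ∈ Icc c d) :
    HasDerivWithinAt (fun s => G (r, s))
      (fderivWithin ℝ G (Ioo (-δ) δ ×ˢ Icc c d) (r, s) (0, 1)) (Icc c d) s := by
  have h1 := (hG (r, s) ⟨hr, hs⟩).hasFDerivWithinAt
  have h2 : HasDerivWithinAt (fun s : ℝ => (r, s)) ((0 : ℝ), (1 : ℝ)) (Icc c d) s :=
    ((hasDerivAt_const s r).prodMk (hasDerivAt_id s)).hasDerivWithinAt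
  exact h1.comp_hasDerivWithinAt (f := fun s : ℝ => (r, s)) s h2 fun x hx => ⟨hr, hx⟩

/-- Differentiation under the integral sign for a `C¹` function on a strip. -/
theorem hasDerivAt_integral_of_contDiffOn {δ c d : ℝ} (hδ : 0 < δ) (hcd : c < d) {G : ℝ × ℝ → ℝ}
    (hG : ContDiffOn ℝ 1 G (Ioo (-δ) δ ×ˢ Icc c d)) :
    HasDerivAt (fun r => ∫ s in c..d, G (r, s))
      (∫ s in c..d, fderivWithin ℝ G (Ioo (-δ) δ ×ˢ Icc c d) (0, s) (1, 0)) 0 := by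
  set S := Ioo (-δ) δ ×ˢ Icc c d with hS
  have hcont : ContinuousOn (fun z => fderivWithin ℝ G S z (1, 0)) S :=
    (hG.continuousOn_fderivWithin (uniqueDiffOn_strip hcd) le_rfl).clm_apply continuousOn_const
  have hGs : ∀ r ∈ Ioo (-δ) δ, IntervalIntegrable (fun s => G (r, s)) volume c d := by
    intro r hr
    apply ContinuousOn.intervalIntegrable_of_Icc hcd.le
    exact hG.continuousOn.comp (by fun_prop) fun s hs => ⟨hr, hs⟩
  have h0 : (0 : ℝ) ∈ Ioo (-δ) δ := ⟨by linarith, hδ⟩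
  -- Halving the parameter interval makes the strip compact, which provides the constant dominating
  -- function.
  have hKc : IsCompact (Icc (-(δ / 2)) (δ / 2) ×ˢ Icc c d) := isCompact_Icc.prod isCompact_Icc
  have hKS : Icc (-(δ / 2)) (δ / 2) ×ˢ Icc c d ⊆ S :=
    prod_mono (fun x hx => ⟨by linarith [hx.1], by linarith [hx.2]⟩) subset_rfl
  obtain ⟨B, hB⟩ := hKc.exists_bound_of_continuousOn (hcont.mono hKS)
  have hF' : IntervalIntegrable (fun s => fderivWithin ℝ G S (0, s) (1, 0)) volume c d := by
    apply ContinuousOn.intervalIntegrable_of_Icc hcd.le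
    exact hcont.comp (f := fun s : ℝ => ((0 : ℝ), s)) (by fun_prop) fun s hs => ⟨h0, hs⟩
  refine (intervalIntegral.hasDerivAt_integral_of_dominated_loc_of_deriv_le
    (F := fun r s => G (r, s)) (F' := fun r s => fderivWithin ℝ G S (r, s) (1, 0))
    (bound := fun _ => B) (s := Icc (-(δ / 2)) (δ / 2))
    (Icc_mem_nhds (by linarith) (by linarith)) ?_ (hGs 0 h0) ?_ ?_ ?_ ?_).2
  · filter_upwards [Ioo_mem_nhds h0.1 h0.2] with r hr
    exact (intervalIntegrable_iff.1 (hGs r hr)).aestronglyMeasurable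
  · exact (intervalIntegrable_iff.1 hF').aestronglyMeasurable
  · refine Eventually.of_forall fun t ht x hx => hB (x, t) ⟨hx, ?_⟩
    rw [uIoc_of_le hcd.le] at ht
    exact ⟨ht.1.le, ht.2⟩
  · exact intervalIntegrable_const
  · refine Eventually.of_forall fun t ht x hx => ?_
    rw [uIoc_of_le hcd.le] at ht
    exact hasDerivAt_fst_of_strip (hG.differentiableOn one_ne_zero)
      ⟨by linarith [hx.1], by linarith [hx.2]⟩ ⟨ht.1.le, ht.2⟩

/-- First variation of `∫ ℒ(Y, ∂Y/∂s) ds` for a family `Y(r, s)` of curves and a `C¹`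
Lagrangian. -/
theorem lagrangian_variation {X : Type*} [NormedAddCommGroup X] [NormedSpace ℝ X]
    {δ c d : ℝ} (hδ : 0 < δ) (hcd : c < d) {O : Set X} (hO : IsOpen O) {ℒ : X × X → ℝ}
    (hℒ : ContDiffOn ℝ 1 ℒ (O ×ˢ univ)) {Y : ℝ × ℝ → X}
    (hY : ContDiffOn ℝ 2 Y (Ioo (-δ) δ ×ˢ Icc c d)) (hYO : MapsTo Y (Ioo (-δ) δ ×ˢ Icc c d) O)
    {G : ℝ × ℝ → ℝ}
    (hGdef : ∀ z, G z = ℒ (Y z, fderivWithin ℝ Y (Ioo (-δ) δ ×ˢ Icc c d) z (0, 1)))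
    {W : ℝ → X} (hW : ∀ s, W s = fderivWithin ℝ Y (Ioo (-δ) δ ×ˢ Icc c d) (0, s) (1, 0)) :
    ∃ D : ℝ → ℝ, ContinuousOn D (Icc c d) ∧
      (∀ r ∈ Ioo (-δ) δ, ContinuousOn (fun s => G (r, s)) (Icc c d)) ∧
      HasDerivAt (fun r => ∫ s in c..d, G (r, s)) (∫ s in c..d, D s) 0 ∧
      ∀ s ∈ Ioo c d, HasDerivAt (fun r => G (r, s)) (D s) 0 ∧
        D s = fderiv ℝ ℒ (Y (0, s), deriv (fun u => Y (0, u)) s) (W s, deriv W s) := by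
  set S := Ioo (-δ) δ ×ˢ Icc c d with hS
  have hU : UniqueDiffOn ℝ S := uniqueDiffOn_strip hcd
  have h0 : (0 : ℝ) ∈ Ioo (-δ) δ := ⟨by linarith, hδ⟩
  have hYs : ContDiffOn ℝ 1 (fun z => fderivWithin ℝ Y S z (0, 1)) S :=
    (hY.fderivWithin hU (m := 1) (by norm_num)).clm_apply contDiffOn_const
  -- `Y` is C², so its `s`-derivative is C¹, and C¹ regularity of `ℒ` is enough.
  have hG : ContDiffOn ℝ 1 G S := by
    have : ContDiffOn ℝ 1 (fun z => ℒ (Y z, fderivWithin ℝ Y S z (0, 1))) S :=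
      hℒ.comp ((hY.of_le (by norm_num)).prodMk hYs) fun z hz => ⟨hYO hz, mem_univ _⟩
    exact this.congr fun z _ => hGdef z
  refine ⟨fun s => fderivWithin ℝ G S (0, s) (1, 0), ?_, ?_,
    hasDerivAt_integral_of_contDiffOn hδ hcd hG, ?_⟩
  · have hcont : ContinuousOn (fun z => fderivWithin ℝ G S z (1, 0)) S :=
      (hG.continuousOn_fderivWithin hU le_rfl).clm_apply continuousOn_const
    exact hcont.comp (f := fun s : ℝ => ((0 : ℝ), s)) (by fun_prop) fun s hs => ⟨h0, hs⟩
  · intro r hr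
    exact hG.continuousOn.comp (by fun_prop) fun s hs => ⟨hr, hs⟩
  · intro s hs
    have hs' : s ∈ Icc c d := ⟨hs.1.le, hs.2.le⟩
    refine ⟨hasDerivAt_fst_of_strip (hG.differentiableOn one_ne_zero) h0 hs', ?_⟩
    have hSn : ∀ u ∈ Ioo c d, S ∈ 𝓝 ((0 : ℝ), u) := fun u hu =>
      prod_mem_nhds (Ioo_mem_nhds h0.1 h0.2) (Icc_mem_nhds hu.1 hu.2)
    have hSo : interior S = Ioo (-δ) δ ×ˢ Ioo c d := by
      rw [hS, interior_prod_eq, interior_Icc, isOpen_Ioo.interior_eq]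
    have hz : ((0 : ℝ), s) ∈ interior S := by rw [hSo]; exact ⟨h0, hs⟩
    have hY2 : ContDiffAt ℝ 2 Y (0, s) := hY.contDiffAt (hSn s hs)
    have hfY : DifferentiableAt ℝ (fderiv ℝ Y) (0, s) :=
      (hY2.fderiv_right (m := 1) (by norm_num)).differentiableAt one_ne_zero
    -- Symmetry of the second derivative identifies the `r`-derivative of the velocity with the
    -- `s`-derivative of the variation field.
    have hsymm : IsSymmSndFDerivAt ℝ Y ((0 : ℝ), s) :=
      hY2.isSymmSndFDerivAt (by simp)
    have hev : ∀ᶠ z in 𝓝 ((0 : ℝ), s), fderivWithin ℝ Y S z = fderiv ℝ Y z := by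
      filter_upwards [isOpen_interior.mem_nhds hz] with z hz
      exact fderivWithin_of_mem_nhds (mem_interior_iff_mem_nhds.1 hz)
    have hV : deriv (fun u => Y (0, u)) s = fderivWithin ℝ Y S (0, s) (0, 1) :=
      ((hasDerivWithinAt_snd_of_strip (hY.differentiableOn two_ne_zero) h0 hs').hasDerivAt
        (Icc_mem_nhds hs.1 hs.2)).deriv
    have hW' : deriv W s = fderiv ℝ (fderiv ℝ Y) (0, s) (0, 1) (1, 0) := by
      have h1 : HasDerivAt (fun u : ℝ => ((0 : ℝ), u)) ((0 : ℝ), (1 : ℝ)) s :=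
        (hasDerivAt_const s 0).prodMk (hasDerivAt_id s)
      have h2 : HasDerivAt (fun u : ℝ => fderiv ℝ Y (0, u))
          (fderiv ℝ (fderiv ℝ Y) (0, s) (0, 1)) s :=
        hfY.hasFDerivAt.comp_hasDerivAt (f := fun u : ℝ => ((0 : ℝ), u)) s h1
      have h3 := h2.clm_apply (hasDerivAt_const s ((1 : ℝ), (0 : ℝ)))
      have h4 : W =ᶠ[𝓝 s] fun u => fderiv ℝ Y (0, u) (1, 0) := by
        filter_upwards [Ioo_mem_nhds hs.1 hs.2] with u hu
        rw [hW, fderivWithin_of_mem_nhds (hSn u hu)]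
      rw [h4.deriv_eq, h3.deriv]
      simp
    have hGe : G =ᶠ[𝓝 ((0 : ℝ), s)] fun z => ℒ (Y z, fderiv ℝ Y z (0, 1)) := by
      filter_upwards [hev] with z hz
      rw [hGdef, hz]
    have hℒd : HasFDerivAt ℒ (fderiv ℝ ℒ (Y (0, s), fderiv ℝ Y (0, s) (0, 1)))
        (Y (0, s), fderiv ℝ Y (0, s) (0, 1)) :=
      ((hℒ.contDiffAt ((hO.prod isOpen_univ).mem_nhds
        ⟨hYO ⟨h0, hs'⟩, mem_univ _⟩)).differentiableAt one_ne_zero).hasFDerivAt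
    have hin : HasFDerivAt (fun z => (Y z, fderiv ℝ Y z (0, 1))) _ ((0 : ℝ), s) :=
      (hY2.differentiableAt two_ne_zero).hasFDerivAt.prodMk
        (hfY.hasFDerivAt.clm_apply (hasFDerivAt_const ((0 : ℝ), (1 : ℝ)) ((0 : ℝ), s)))
    have hcomp := hℒd.comp ((0 : ℝ), s) hin
    show fderivWithin ℝ G S (0, s) (1, 0) = _
    rw [fderivWithin_of_mem_nhds (hSn s hs), hGe.fderiv_eq]
    erw [hcomp.fderiv]
    rw [hV, hev.self_of_nhds, hW, hW', hev.self_of_nhds, ← hsymm.eq]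
    simp

end Calculus

end StaticFinsler

namespace StaticFinsler

open Filter Topology MeasureTheory

/-! ### The lemma of du Bois-Reymond -/

section DuBoisReymond

/-- A smooth function with integral zero and compact support in `(α, β)` is the derivative of a
smooth function with compact support in `(α, β)`. -/
theorem exists_primitive_of_integral_eq_zero {α β : ℝ} {η : ℝ → ℝ} (hη : ContDiff ℝ ∞ η)
    (hc : HasCompactSupport η) (hsupp : tsupport η ⊆ Ioo α β) (hint : ∫ s in α..β, η s = 0) :
    ∃ φ : ℝ → ℝ, ContDiff ℝ ∞ φ ∧ HasCompactSupport φ ∧ tsupport φ ⊆ Ioo α β ∧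
      deriv φ = η := by
  have hd : ∀ s, HasDerivAt (fun s => ∫ u in α..s, η u) (η s) s := fun s =>
    (hη.continuous).integral_hasStrictDerivAt α s |>.hasDerivAt
  have hder : deriv (fun s => ∫ u in α..s, η u) = η := funext fun s => (hd s).deriv
  rcases (tsupport η).eq_empty_or_nonempty with h0 | hne
  · have : η = 0 := by rwa [tsupport_eq_empty_iff] at h0
    subst this
    exact ⟨0, contDiff_const, HasCompactSupport.zero, by simp [tsupport], by ext; simp⟩
  have hK : IsCompact (tsupport η) := hc
  obtain ⟨p, hp, hpm⟩ := hK.exists_isLeast hne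
  obtain ⟨q, hq, hqm⟩ := hK.exists_isGreatest hne
  have hpa := hsupp hp
  have hqa := hsupp hq
  have hzl : ∀ u, u < p → η u = 0 := fun u hu => by
    by_contra h
    exact absurd (hpm (subset_tsupport η h)) (not_le.2 hu)
  have hzr : ∀ u, q < u → η u = 0 := fun u hu => by
    by_contra h
    exact absurd (hqm (subset_tsupport η h)) (not_le.2 hu)
  have hi : ∀ x y, IntervalIntegrable η volume x y := fun x y =>
    hη.continuous.intervalIntegrable x y
  have hz : ∀ x y, (∀ u ∈ uIoo x y, η u = 0) → ∫ u in x..y, η u = 0 := fun x y h => by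
    rw [intervalIntegral.integral_congr_uIoo (g := fun _ => 0) (fun u hu => h u hu)]; simp
  -- To the left of the support the primitive has nothing to integrate. To the right of it the
  -- primitive equals the total integral, which is zero.
  have hsub : Function.support (fun s => ∫ u in α..s, η u) ⊆ Icc p q := by
    intro s hs
    rw [Function.mem_support] at hs
    by_contra hn
    apply hs
    rw [mem_Icc, not_and_or, not_le, not_le] at hn
    rcases hn with hn | hn
    · refine hz _ _ fun u hu => hzl u ?_
      have := hu.2
      exact this.trans (max_lt hpa.1 hn)
    · have : ∫ u in s..β, η u = 0 := by
        refine hz _ _ fun u hu => hzr u ?_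
        exact (lt_min hn hqa.2).trans hu.1
      have h2 := intervalIntegral.integral_add_adjacent_intervals (hi α s) (hi s β)
      linarith
  refine ⟨fun s => ∫ u in α..s, η u, ?_, ?_, ?_, hder⟩
  · rw [contDiff_infty_iff_deriv, hder]
    exact ⟨fun s => (hd s).differentiableAt, hη⟩
  · exact HasCompactSupport.of_support_subset_isCompact isCompact_Icc hsub
  · exact (closure_minimal hsub isClosed_Icc).trans fun x hx =>
      ⟨hpa.1.trans_le hx.1, hx.2.trans_lt hqa.2⟩

/-- The lemma of du Bois-Reymond. -/
theorem du_bois_reymond {α β : ℝ} (hαβ : α < β) {f P : ℝ → ℝ} {N : Set ℝ} (hN : N.Countable)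
    (hNc : IsClosed N)
    (hf : IntervalIntegrable f volume α β) (hP : IntervalIntegrable P volume α β)
    (hfc : ContinuousOn f (Ioo α β \ N))
    (h : ∀ φ : ℝ → ℝ, ContDiff ℝ ∞ φ → HasCompactSupport φ → tsupport φ ⊆ Ioo α β →
      ∫ s in α..β, (f s * φ s + P s * deriv φ s) = 0) :
    ∃ k, ∀ᵐ s, s ∈ Ioo α β → P s = k + ∫ u in α..s, f u := by
  set A : ℝ → ℝ := fun s => ∫ u in α..s, f u with hA
  have hAc : ContinuousOn A (Icc α β) := by
    have := intervalIntegral.continuousOn_primitive_interval' hf left_mem_uIcc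
    rwa [uIcc_of_le hαβ.le] at this
  have hAd : ∀ s ∈ Ioo α β \ N, HasDerivAt A (f s) s := by
    intro s hs
    have hopen : IsOpen (Ioo α β \ N) := isOpen_Ioo.sdiff hNc
    have hca : ContinuousAt f s := hfc.continuousAt (hopen.mem_nhds hs)
    refine intervalIntegral.integral_hasDerivAt_right ?_ ?_ hca
    · refine hf.mono_set ?_
      rw [uIcc_of_le hs.1.1.le, uIcc_of_le hαβ.le]
      exact Icc_subset_Icc le_rfl hs.1.2.le
    · exact hfc.stronglyMeasurableAtFilter hopen s hs
  have hAi : IntervalIntegrable A volume α β := hAc.intervalIntegrable_of_Icc hαβ.le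
  have hG : ∀ φ : ℝ → ℝ, ContDiff ℝ ∞ φ → HasCompactSupport φ → tsupport φ ⊆ Ioo α β →
      ∫ s in α..β, (P s - A s) * deriv φ s = 0 := by
    intro φ hφ hφc hφs
    have hdc : Continuous (deriv φ) := hφ.continuous_deriv (by simp)
    have hα0 : φ α = 0 := image_eq_zero_of_notMem_tsupport fun hx => (hφs hx).1.false
    have hβ0 : φ β = 0 := image_eq_zero_of_notMem_tsupport fun hx => (hφs hx).2.false
    have i1 : IntervalIntegrable (fun s => f s * φ s) volume α β :=
      hf.mul_continuousOn hφ.continuous.continuousOn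
    have i2 : IntervalIntegrable (fun s => A s * deriv φ s) volume α β :=
      hAi.mul_continuousOn hdc.continuousOn
    have i3 : IntervalIntegrable (fun s => P s * deriv φ s) volume α β :=
      hP.mul_continuousOn hdc.continuousOn
    -- Integration by parts: `A φ` vanishes at both ends. Differentiability of `A` off the countable
    -- set `N`, together with continuity, suffices.
    have key : ∫ s in α..β, (f s * φ s + A s * deriv φ s) = 0 := by
      rw [integral_eq_of_hasDerivAt_off_countable_of_le (fun s => A s * φ s) _ hαβ.le hN
        (hAc.mul hφ.continuous.continuousOn) (fun s hs => ?_) (i1.add i2)]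
      · simp [hα0, hβ0]
      · exact (hAd s hs).mul ((hφ.differentiable (by simp)) s).hasDerivAt
    have h1 := h φ hφ hφc hφs
    rw [intervalIntegral.integral_add i1 i2] at key
    rw [intervalIntegral.integral_add i1 i3] at h1
    simp_rw [sub_mul]
    rw [intervalIntegral.integral_sub i3 i2]
    linarith
  set c := (α + β) / 2 with hc
  set r := (β - α) / 4 with hr
  have hrpos : 0 < r := by rw [hr]; linarith
  let B : ContDiffBump c := ⟨r / 2, r, by linarith, by linarith⟩
  have hBs : tsupport B ⊆ Ioo α β := by
    rw [B.tsupport_eq, Real.closedBall_eq_Icc]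
    intro x hx
    have h1 : c - r ≤ x := hx.1
    have h2 : x ≤ c + r := hx.2
    constructor <;> linarith
  have hIoc : ∀ {η : ℝ → ℝ}, tsupport η ⊆ Ioo α β → Function.support η ⊆ Ioc α β := fun hη =>
    (subset_tsupport _).trans (hη.trans Ioo_subset_Ioc_self)
  set I := ∫ s in α..β, B s with hI
  have hIpos : 0 < I := by
    rw [hI, intervalIntegral.integral_eq_integral_of_support_subset (hIoc hBs)]
    exact B.integral_pos
  have hPA : IntervalIntegrable (fun s => P s - A s) volume α β := hP.sub hAi
  -- If `P - A` is a constant, then that constant is the mean of `P - A` with weight `B`.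
  set k := (∫ s in α..β, (P s - A s) * B s) / I with hk
  have hBi : IntervalIntegrable (fun s => B s) volume α β :=
    (B.contDiff (n := 0)).continuous.intervalIntegrable _ _
  have hmain : ∀ η : ℝ → ℝ, ContDiff ℝ ∞ η → HasCompactSupport η → tsupport η ⊆ Ioo α β →
      ∫ s, η s • (P s - A s - k) = 0 := by
    intro η hη hηc hηs
    have hηi : IntervalIntegrable η volume α β := hη.continuous.intervalIntegrable _ _
    set J := ∫ s in α..β, η s with hJ
    -- Subtracting a multiple of the fixed bump gives integral zero, so the difference is the
    -- derivative of an admissible test function.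
    set ζ : ℝ → ℝ := fun s => η s - (J / I) * B s with hζ
    have hζd : ContDiff ℝ ∞ ζ := hη.sub (contDiff_const.mul B.contDiff)
    have hBm : tsupport (fun s => (J / I) * B s) ⊆ tsupport B :=
      closure_mono fun s hs => right_ne_zero_of_mul (Function.mem_support.1 hs)
    have hζt : tsupport ζ ⊆ tsupport η ∪ tsupport B :=
      (tsupport_sub η _).trans (union_subset_union_right _ hBm)
    have hζs : tsupport ζ ⊆ Ioo α β := hζt.trans (union_subset hηs hBs)
    have hζc : HasCompactSupport ζ :=
      (IsCompact.union hηc B.hasCompactSupport).of_isClosed_subset (isClosed_tsupport _) hζt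
    have hζ0 : ∫ s in α..β, ζ s = 0 := by
      rw [hζ, intervalIntegral.integral_sub hηi (hBi.const_mul _),
        intervalIntegral.integral_const_mul, ← hI, ← hJ]
      field_simp
      ring
    obtain ⟨φ, hφ, hφc, hφs, hφd⟩ := exists_primitive_of_integral_eq_zero hζd hζc hζs hζ0
    have h1 := hG φ hφ hφc hφs
    rw [hφd] at h1
    have e1 : IntervalIntegrable (fun s => (P s - A s) * η s) volume α β :=
      hPA.mul_continuousOn hη.continuous.continuousOn
    have e2 : IntervalIntegrable (fun s => (P s - A s) * B s) volume α β :=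
      hPA.mul_continuousOn (B.contDiff (n := 0)).continuous.continuousOn
    have h2 : ∫ s in α..β, (P s - A s) * ζ s
        = (∫ s in α..β, (P s - A s) * η s) - (J / I) * ∫ s in α..β, (P s - A s) * B s := by
      rw [← intervalIntegral.integral_const_mul, ← intervalIntegral.integral_sub e1
        (e2.const_mul _)]
      congr 1; ext s; simp only [hζ]; ring
    have h3 : Function.support (fun s => η s • (P s - A s - k)) ⊆ Ioc α β :=
      (Function.support_smul_subset_left _ _).trans (hIoc hηs)
    rw [← intervalIntegral.integral_eq_integral_of_support_subset h3]
    have h4 : (fun s => η s • (P s - A s - k)) = fun s => (P s - A s) * η s - k * η s := by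
      ext s; simp only [smul_eq_mul]; ring
    rw [h4, intervalIntegral.integral_sub e1 (hηi.const_mul _),
      intervalIntegral.integral_const_mul, ← hJ]
    rw [h2] at h1
    have : k * J = J / I * ∫ s in α..β, (P s - A s) * B s := by rw [hk]; ring
    linarith
  have hloc : LocallyIntegrableOn (fun s => P s - A s - k) (Ioo α β) volume := by
    apply IntegrableOn.locallyIntegrableOn
    have := (hPA.sub (intervalIntegrable_const (c := k))).1
    exact this.mono_set Ioo_subset_Ioc_self
  refine ⟨k, ?_⟩
  filter_upwards [isOpen_Ioo.ae_eq_zero_of_integral_contDiff_smul_eq_zero hloc hmain] with s hs hm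
  linarith [hs hm]

end DuBoisReymond

end StaticFinsler

namespace StaticFinsler

open Filter Topology MeasureTheory

/-! ### Squared Finsler metrics in coordinates: regularity, Legendre map, smooth solutions -/

section CoordinateFinsler

/-- The square of a Finsler metric in natural coordinates: `Φ(x, v) = F²` for `x` in the open
set `U`. -/
structure IsCoordFinslerSq {E : Type*} [NormedAddCommGroup E] [NormedSpace ℝ E] (U : Set E)
    (Φ : E × E → ℝ) : Prop where
  isOpen : IsOpen U
  smooth : ContDiffOn ℝ ∞ Φ (U ×ˢ {v | v ≠ 0})
  homogeneous : ∀ x ∈ U, ∀ (v : E) (c : ℝ), 0 < c → Φ (x, c • v) = c ^ 2 * Φ (x, v)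
  pos : ∀ x ∈ U, ∀ v : E, v ≠ 0 → 0 < Φ (x, v)
  posDef : ∀ x ∈ U, ∀ v u : E, v ≠ 0 → u ≠ 0 → 0 < fderiv ℝ (fderiv ℝ Φ) (x, v) (0, u) (0, u)

namespace IsCoordFinslerSq

variable {E : Type*} [NormedAddCommGroup E] [NormedSpace ℝ E] {U : Set E} {Φ : E × E → ℝ}

theorem zero (h : IsCoordFinslerSq U Φ) {x : E} (hx : x ∈ U) : Φ (x, 0) = 0 := by
  have := h.homogeneous x hx 0 2 two_pos
  rw [smul_zero] at this
  linarith

theorem isOpen_slit (h : IsCoordFinslerSq U Φ) : IsOpen (U ×ˢ {v : E | v ≠ 0}) :=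
  h.isOpen.prod isOpen_ne

theorem contDiffAt (h : IsCoordFinslerSq U Φ) {x v : E} (hx : x ∈ U) (hv : v ≠ 0) :
    ContDiffAt ℝ ∞ Φ (x, v) :=
  h.smooth.contDiffAt (h.isOpen_slit.mem_nhds ⟨hx, hv⟩)

theorem differentiableAt_of_ne_zero (h : IsCoordFinslerSq U Φ) {x v : E} (hx : x ∈ U)
    (hv : v ≠ 0) : DifferentiableAt ℝ Φ (x, v) :=
  (h.contDiffAt hx hv).differentiableAt (by simp)

theorem contDiffAt_fderiv (h : IsCoordFinslerSq U Φ) {x v : E} (hx : x ∈ U) (hv : v ≠ 0) :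
    ContDiffAt ℝ ∞ (fderiv ℝ Φ) (x, v) :=
  (h.contDiffAt hx hv).fderiv_right (by simp)

theorem differentiableAt_fderiv (h : IsCoordFinslerSq U Φ) {x v : E} (hx : x ∈ U)
    (hv : v ≠ 0) : DifferentiableAt ℝ (fderiv ℝ Φ) (x, v) :=
  (h.contDiffAt_fderiv hx hv).differentiableAt (by simp)

/-- Obtained by differentiating `Φ(x, v) = c² Φ(x, v / c)`. With `c = ‖v‖` it reduces estimates of
the differential to the unit sphere. -/
theorem fderiv_scale (h : IsCoordFinslerSq U Φ) {x v : E} (hx : x ∈ U) (hv : v ≠ 0) {c : ℝ}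
    (hc : 0 < c) (a b : E) :
    fderiv ℝ Φ (x, v) (a, b) = c ^ 2 * fderiv ℝ Φ (x, c⁻¹ • v) (a, c⁻¹ • b) := by
  have hv' : c⁻¹ • v ≠ 0 := smul_ne_zero (inv_ne_zero hc.ne') hv
  have hev : Φ =ᶠ[𝓝 (x, v)] fun z => c ^ 2 * Φ (z.1, c⁻¹ • z.2) := by
    filter_upwards [(h.isOpen.prod isOpen_univ).mem_nhds (show (x, v) ∈ U ×ˢ univ from
      ⟨hx, mem_univ _⟩)] with z hz
    rw [← h.homogeneous z.1 hz.1 _ c hc, smul_inv_smul₀ hc.ne']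
  have h1 : HasFDerivAt (fun z : E × E => (z.1, c⁻¹ • z.2))
      ((ContinuousLinearMap.fst ℝ E E).prod (c⁻¹ • ContinuousLinearMap.snd ℝ E E)) (x, v) :=
    ((ContinuousLinearMap.fst ℝ E E).prod (c⁻¹ • ContinuousLinearMap.snd ℝ E E)).hasFDerivAt
  have h2 := ((h.differentiableAt_of_ne_zero hx hv').hasFDerivAt.comp (x, v) h1).const_mul (c ^ 2)
  have h3 := h2.congr_of_eventuallyEq hev
  rw [h3.fderiv]
  simp

variable [FiniteDimensional ℝ E]

/-- Compactness bounds `Φ` and its differential over unit vectors, and homogeneity extends the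
bounds to all vectors. The maximum arises because `∂Φ/∂x` scales like `‖v‖²` and `∂Φ/∂v` like `‖v‖`.
-/
theorem exists_bound (h : IsCoordFinslerSq U Φ) {x : E} (hx : x ∈ U) :
    ∃ V ∈ 𝓝 x, V ⊆ U ∧ ∃ B, 0 ≤ B ∧ ∀ y ∈ V, ∀ v : E, |Φ (y, v)| ≤ B * ‖v‖ ^ 2 ∧
      (v ≠ 0 → ‖fderiv ℝ Φ (y, v)‖ ≤ B * max (‖v‖ ^ 2) ‖v‖) := by
  obtain ⟨K, hK, hxK, hKU⟩ := exists_compact_subset h.isOpen hx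
  have hc : IsCompact (K ×ˢ Metric.sphere (0 : E) 1) := hK.prod (isCompact_sphere 0 1)
  have hsub : K ×ˢ Metric.sphere (0 : E) 1 ⊆ U ×ˢ {v : E | v ≠ 0} :=
    prod_mono hKU fun v hv h0 => by simp [h0] at hv
  obtain ⟨B₁, hB₁⟩ := hc.exists_bound_of_continuousOn (h.smooth.continuousOn.mono hsub)
  obtain ⟨B₂, hB₂⟩ := hc.exists_bound_of_continuousOn
    ((h.smooth.continuousOn_fderiv_of_isOpen h.isOpen_slit (by simp)).mono hsub)
  refine ⟨K, mem_interior_iff_mem_nhds.1 hxK, hKU, max 0 (max B₁ B₂), le_max_left _ _,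
    fun y hy v => ?_⟩
  set B := max 0 (max B₁ B₂)
  have hB0 : 0 ≤ B := le_max_left _ _
  by_cases hv : v = 0
  · subst hv
    simp [h.zero (hKU hy)]
  have hvn : 0 < ‖v‖ := norm_pos_iff.2 hv
  have hm : (y, ‖v‖⁻¹ • v) ∈ K ×ˢ Metric.sphere (0 : E) 1 :=
    ⟨hy, by simp [norm_smul, hvn.ne']⟩
  constructor
  · have h1 : Φ (y, v) = ‖v‖ ^ 2 * Φ (y, ‖v‖⁻¹ • v) := by
      rw [← h.homogeneous y (hKU hy) _ _ hvn, smul_inv_smul₀ hvn.ne']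
    have h2 : |Φ (y, ‖v‖⁻¹ • v)| ≤ B :=
      (hB₁ _ hm).trans ((le_max_left _ _).trans (le_max_right _ _))
    rw [h1, abs_mul, abs_of_nonneg (sq_nonneg _), mul_comm]
    gcongr
  · intro _
    refine ContinuousLinearMap.opNorm_le_bound _ (by positivity) fun ab => ?_
    obtain ⟨a, b⟩ := ab
    rw [h.fderiv_scale (hKU hy) hv hvn, Real.norm_eq_abs, abs_mul, abs_of_nonneg (sq_nonneg _)]
    have h2 : ‖fderiv ℝ Φ (y, ‖v‖⁻¹ • v)‖ ≤ B :=
      (hB₂ _ hm).trans ((le_max_right _ _).trans (le_max_right _ _))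
    have h3 : |fderiv ℝ Φ (y, ‖v‖⁻¹ • v) (a, ‖v‖⁻¹ • b)| ≤ B * ‖(a, ‖v‖⁻¹ • b)‖ :=
      (ContinuousLinearMap.le_opNorm (fderiv ℝ Φ (y, ‖v‖⁻¹ • v)) _).trans (by gcongr)
    have h4 : ‖v‖ ^ 2 * ‖(a, ‖v‖⁻¹ • b)‖ ≤ max (‖v‖ ^ 2) ‖v‖ * ‖(a, b)‖ := by
      rw [Prod.norm_def, mul_max_of_nonneg _ _ (sq_nonneg _)]
      refine max_le ?_ ?_
      · exact mul_le_mul (le_max_left _ _) (norm_fst_le (a, b)) (norm_nonneg _) (by positivity)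
      · have : ‖v‖ ^ 2 * ‖(a, ‖v‖⁻¹ • b).2‖ = ‖v‖ * ‖b‖ := by
          simp only [norm_smul, norm_inv, norm_norm]
          field_simp
        rw [this]
        exact mul_le_mul (le_max_right _ _) (norm_snd_le (a, b)) (norm_nonneg _) (by positivity)
    calc ‖v‖ ^ 2 * |fderiv ℝ Φ (y, ‖v‖⁻¹ • v) (a, ‖v‖⁻¹ • b)|
        ≤ ‖v‖ ^ 2 * (B * ‖(a, ‖v‖⁻¹ • b)‖) := by gcongr
      _ = B * (‖v‖ ^ 2 * ‖(a, ‖v‖⁻¹ • b)‖) := by ring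
      _ ≤ B * (max (‖v‖ ^ 2) ‖v‖ * ‖(a, b)‖) := by gcongr
      _ = _ := by ring

/-- `Φ` vanishes on the zero section and is quadratically small near it, so it is differentiable
there in all directions of `E × E`, not only along the fibre. -/
theorem hasFDerivAt_zero (h : IsCoordFinslerSq U Φ) {x : E} (hx : x ∈ U) :
    HasFDerivAt Φ (0 : E × E →L[ℝ] ℝ) (x, 0) := by
  obtain ⟨V, hV, -, B, hB0, hB⟩ := h.exists_bound hx
  refine Asymptotics.IsBigO.hasFDerivAt (n := 2) ?_ one_lt_two
  refine Asymptotics.IsBigO.of_bound B ?_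
  filter_upwards [prod_mem_nhds hV univ_mem] with z hz
  have h1 := (hB z.1 hz.1 z.2).1
  have h2 : ‖z.2‖ ≤ ‖z - (x, 0)‖ := by
    have := norm_snd_le (z - (x, 0))
    rwa [Prod.snd_sub, sub_zero] at this
  rw [Real.norm_eq_abs, norm_pow, norm_norm]
  refine h1.trans ?_
  gcongr

theorem fderiv_zero (h : IsCoordFinslerSq U Φ) {x : E} (hx : x ∈ U) : fderiv ℝ Φ (x, 0) = 0 :=
  (h.hasFDerivAt_zero hx).fderiv

theorem differentiableAt (h : IsCoordFinslerSq U Φ) {x : E} (hx : x ∈ U) (v : E) :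
    DifferentiableAt ℝ Φ (x, v) := by
  by_cases hv : v = 0
  · rw [hv]; exact (h.hasFDerivAt_zero hx).differentiableAt
  · exact h.differentiableAt_of_ne_zero hx hv

/-- At the zero section the bound on the differential tends to zero with `v`, so the differential is
continuous there. This is the only regularity at zero velocity used in the variational arguments. -/
theorem contDiffOn_one (h : IsCoordFinslerSq U Φ) : ContDiffOn ℝ 1 Φ (U ×ˢ univ) := by
  rw [show (1 : WithTop ℕ∞) = 0 + 1 by simp,
    contDiffOn_succ_iff_fderiv_of_isOpen (h.isOpen.prod isOpen_univ)]
  refine ⟨fun z hz => (h.differentiableAt hz.1 z.2).differentiableWithinAt, by simp, ?_⟩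
  rw [contDiffOn_zero]
  rintro ⟨x, v⟩ hz
  apply ContinuousAt.continuousWithinAt
  have hx : x ∈ U := hz.1
  by_cases hv : v = 0
  · subst hv
    obtain ⟨V, hV, hVU, B, hB0, hB⟩ := h.exists_bound hx
    rw [ContinuousAt, h.fderiv_zero hx]
    refine squeeze_zero_norm' (a := fun z : E × E => B * max (‖z.2‖ ^ 2) ‖z.2‖) ?_ ?_
    · filter_upwards [prod_mem_nhds hV univ_mem] with z hz
      by_cases hz2 : z.2 = 0
      · rw [show z = (z.1, 0) from Prod.ext rfl hz2, h.fderiv_zero (hVU hz.1)]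
        simp
      · exact (hB z.1 hz.1 z.2).2 hz2
    · have : Continuous fun z : E × E => B * max (‖z.2‖ ^ 2) ‖z.2‖ := by fun_prop
      convert this.tendsto (x, 0) using 2
      simp
  · exact (h.smooth.continuousOn_fderiv_of_isOpen h.isOpen_slit (by simp)).continuousAt
      (h.isOpen_slit.mem_nhds ⟨hx, hv⟩)

/-- Euler's identity. -/
theorem fderiv_euler (h : IsCoordFinslerSq U Φ) {x : E} (hx : x ∈ U) (v : E) :
    fderiv ℝ Φ (x, v) (0, v) = 2 * Φ (x, v) := by
  have h1 : HasDerivAt (fun c : ℝ => (x, c • v)) ((0 : E), (1 : ℝ) • v) 1 :=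
    (hasDerivAt_const 1 x).prodMk ((hasDerivAt_id (1 : ℝ)).smul_const v)
  have h2 : HasDerivAt (fun c : ℝ => Φ (x, c • v)) (fderiv ℝ Φ (x, v) (0, v)) 1 := by
    have := (h.differentiableAt hx ((1 : ℝ) • v)).hasFDerivAt.comp_hasDerivAt
      (f := fun c : ℝ => (x, c • v)) 1 h1
    rw [one_smul] at this
    exact this
  have h3 : HasDerivAt (fun c : ℝ => c ^ 2 * Φ (x, v)) (2 * Φ (x, v)) 1 := by
    simpa using (hasDerivAt_pow 2 (1 : ℝ)).mul_const (Φ (x, v))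
  have h4 : (fun c : ℝ => Φ (x, c • v)) =ᶠ[𝓝 1] fun c => c ^ 2 * Φ (x, v) := by
    filter_upwards [Ioi_mem_nhds one_pos] with c hc
    exact h.homogeneous x hx v c hc
  exact h2.unique (h3.congr_of_eventuallyEq h4)

/-- Injectivity of the Legendre transformation. -/
theorem legendre_injective (h : IsCoordFinslerSq U Φ) {x v w : E} (hx : x ∈ U)
    (he : ∀ u, fderiv ℝ Φ (x, v) (0, u) = fderiv ℝ Φ (x, w) (0, u)) : v = w := by
  by_cases hv : v = 0
  · by_contra hvw
    have hw : w ≠ 0 := fun hw => hvw (hv.trans hw.symm)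
    have h1 := h.fderiv_euler hx w
    rw [← he w, hv, h.fderiv_zero hx] at h1
    have := h.pos x hx w hw
    simp at h1
    linarith
  by_cases hw : w = 0
  · have h1 := h.fderiv_euler hx v
    rw [he v, hw, h.fderiv_zero hx] at h1
    have := h.pos x hx v hv
    simp at h1
    linarith
  by_contra hvw
  set γ : ℝ → E := fun t => w + t • (v - w) with hγ
  -- A segment through the origin leaves the region where `Φ` is C², so monotonicity along it is not
  -- at hand. But then `(1 - t) w + t v = 0`, and pairing the common covector with this relation
  -- gives, by Euler's identity, `(1 - t) Φ(w) + t Φ(v) = 0` with `t > 0`, contradicting positivity.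
  by_cases hz : ∃ t ∈ Icc (0 : ℝ) 1, γ t = 0
  · obtain ⟨t, ht, ht0⟩ := hz
    have h1 : (1 - t) • w + t • v = 0 := by rw [← ht0, hγ]; module
    have ht1 : t ≠ 0 := fun h0 => hw (by simpa [h0] using h1)
    have htpos : 0 < t := lt_of_le_of_ne ht.1 (Ne.symm ht1)
    have h2 : (1 - t) * fderiv ℝ Φ (x, v) (0, w) + t * fderiv ℝ Φ (x, v) (0, v) = 0 := by
      have := congrArg (fun u => fderiv ℝ Φ (x, v) (0, u)) h1
      have h3 : ((0 : E), (1 - t) • w + t • v)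
        = (1 - t) • ((0 : E), w) + t • ((0 : E), v) := by simp
      simp only [h3, map_add, map_smul, smul_eq_mul] at this
      rw [this]
      exact map_zero (fderiv ℝ Φ (x, v))
    rw [he w, h.fderiv_euler hx, h.fderiv_euler hx] at h2
    have p1 := h.pos x hx v hv
    have p2 := h.pos x hx w hw
    have p3 : 0 ≤ 1 - t := by linarith [ht.2]
    nlinarith [mul_pos htpos p1, mul_nonneg p3 p2.le]
  · push Not at hz
    have hd : ∀ t ∈ Icc (0 : ℝ) 1, HasDerivAt (fun t => fderiv ℝ Φ (x, γ t) (0, v - w))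
        (fderiv ℝ (fderiv ℝ Φ) (x, γ t) (0, v - w) (0, v - w)) t := by
      intro t ht
      have h1 : HasDerivAt (fun t => (x, γ t)) ((0 : E), v - w) t := by
        have := ((hasDerivAt_id t).smul_const (v - w)).const_add w
        simp only [one_smul] at this
        exact (hasDerivAt_const t x).prodMk this
      have h2 : DifferentiableAt ℝ (fderiv ℝ Φ) (x, γ t) :=
        h.differentiableAt_fderiv hx (hz t ht)
      have h3 := (h2.hasFDerivAt.comp_hasDerivAt (f := fun t => (x, γ t)) t h1).clm_apply
        (hasDerivAt_const t ((0 : E), v - w))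
      simpa using h3
    -- Away from the origin the Hessian is positive definite, so the momentum paired with `v - w`
    -- increases strictly from `w` to `v` and cannot take the same value at both.
    have hmono : StrictMonoOn (fun t => fderiv ℝ Φ (x, γ t) (0, v - w)) (Icc 0 1) := by
      refine strictMonoOn_of_deriv_pos (convex_Icc 0 1)
        (fun t ht => (hd t ht).continuousAt.continuousWithinAt) fun t ht => ?_
      have ht' := interior_subset ht
      rw [(hd t ht').deriv]
      exact h.posDef x hx _ _ (hz t ht') (sub_ne_zero.2 hvw)
    have := hmono (left_mem_Icc.2 zero_le_one) (right_mem_Icc.2 zero_le_one) zero_lt_one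
    simp only [hγ, zero_smul, add_zero, one_smul, add_sub_cancel] at this
    rw [he] at this
    exact this.false

/-- Positive definiteness gives injectivity, and `E` and its dual have the same finite dimension. -/
theorem hessian_injective {T : E →L[ℝ] E →L[ℝ] ℝ} (hT : ∀ u, u ≠ 0 → 0 < T u u) :
    ∃ A : E ≃L[ℝ] (E →L[ℝ] ℝ), (A : E →L[ℝ] E →L[ℝ] ℝ) = T := by
  have hinj : Function.Injective T := by
    rw [injective_iff_map_eq_zero]
    intro u hu
    by_contra h0
    have := hT u h0
    simp [hu] at this
  have hfr : Module.finrank ℝ E = Module.finrank ℝ (E →L[ℝ] ℝ) := by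
    rw [← (LinearMap.toContinuousLinearMap (𝕜 := ℝ) (E := E) (F' := ℝ)).finrank_eq]
    exact (Subspace.dual_finrank_eq (K := ℝ) (V := E)).symm
  refine ⟨(LinearEquiv.ofInjectiveOfFinrankEq (T : E →ₗ[ℝ] (E →L[ℝ] ℝ)) hinj
    hfr).toContinuousLinearEquiv, ?_⟩
  ext u w
  rfl

/-- Solutions of the Euler–Lagrange equations with nowhere vanishing velocity are smooth. -/
theorem contDiffOn_of_eulerLagrange (h : IsCoordFinslerSq U Φ) {g : E → E →L[ℝ] ℝ}
    (hg : ContDiffOn ℝ ∞ g U) {α s₀ β : ℝ} {x v : ℝ → E} (h₁ : α ≤ s₀) (h₂ : s₀ ≤ β)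
    (hx : ∀ s ∈ Icc α β, x s ∈ U) (hv : ∀ s ∈ Icc α β, v s ≠ 0)
    (hxv : ∀ s ∈ Icc α β, HasDerivWithinAt x (v s) (Icc α β) s)
    (hv₁ : DifferentiableOn ℝ v (Icc α s₀)) (hv₂ : DifferentiableOn ℝ v (Icc s₀ β))
    (hEL : ∀ s ∈ Icc α β, ∀ u, HasDerivWithinAt (fun s => fderiv ℝ Φ (x s, v s) (0, u))
      (fderiv ℝ Φ (x s, v s) (u, 0) + g (x s) u) (Icc α β) s) :
    ContDiffOn ℝ ∞ x (Icc α β) := by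
  -- `ρ` restricts a covector to the fibre directions. Then `T` is the block `Φ_vv` of the Hessian
  -- and `R` is `Φ_x + g - Φ_vx v`, so that the equation reads `T v' = R`, and `V` is the associated
  -- vector field in the variables `(x, v)`.
  set ρ : (E × E →L[ℝ] ℝ) →L[ℝ] (E →L[ℝ] ℝ) :=
    (ContinuousLinearMap.compL ℝ E (E × E) ℝ).flip (ContinuousLinearMap.inr ℝ E E) with hρ
  set T : E × E → E →L[ℝ] E →L[ℝ] ℝ := fun z =>
    ρ.comp ((fderiv ℝ (fderiv ℝ Φ) z).comp (ContinuousLinearMap.inr ℝ E E)) with hTdef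
  set R : E × E → E →L[ℝ] ℝ := fun z =>
    (fderiv ℝ Φ z).comp (ContinuousLinearMap.inl ℝ E E) + g z.1
      - ρ (fderiv ℝ (fderiv ℝ Φ) z (z.2, 0)) with hRdef
  set V : E × E → E × E := fun z => (z.2, (T z).inverse (R z)) with hVdef
  have hT : ∀ z ∈ U ×ˢ {v : E | v ≠ 0}, ∃ A : E ≃L[ℝ] (E →L[ℝ] ℝ),
      (A : E →L[ℝ] E →L[ℝ] ℝ) = T z := fun z hz =>
    hessian_injective fun u hu => by simpa [hTdef, hρ] using h.posDef z.1 hz.1 z.2 u hz.2 hu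
  have hVs : ContDiffOn ℝ ∞ V (U ×ˢ {v : E | v ≠ 0}) := by
    intro z hz
    apply ContDiffAt.contDiffWithinAt
    obtain ⟨A, hA⟩ := hT z hz
    have d1 : ContDiffAt ℝ ∞ (fderiv ℝ Φ) z := h.contDiffAt_fderiv hz.1 hz.2
    have d2 : ContDiffAt ℝ ∞ (fderiv ℝ (fderiv ℝ Φ)) z := d1.fderiv_right (by simp)
    have dT : ContDiffAt ℝ ∞ T z :=
      contDiffAt_const.clm_comp (d2.clm_comp contDiffAt_const)
    have dg : ContDiffAt ℝ ∞ (fun z : E × E => g z.1) z :=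
      (hg.contDiffAt (h.isOpen.mem_nhds hz.1)).comp z contDiffAt_fst
    have dR : ContDiffAt ℝ ∞ R z :=
      ((d1.clm_comp contDiffAt_const).add dg).sub
        (contDiffAt_const.clm_apply (d2.clm_apply (contDiffAt_snd.prodMk contDiffAt_const)))
    have dI : ContDiffAt ℝ ∞ (fun z => (T z).inverse) z := by
      have := contDiffAt_map_inverse (n := ∞) A
      rw [hA] at this
      exact this.comp z dT
    exact contDiffAt_snd.prodMk (dI.clm_apply dR)
  -- `v` is only assumed differentiable on either side of `s₀`. Both one-sided derivatives solve `T
  -- v' = R`, hence agree, and the two halves can be glued. Off `[p, q]`, or when it is degenerate,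
  -- the claim is vacuous.
  have hpiece : ∀ p q, Icc p q ⊆ Icc α β → DifferentiableOn ℝ v (Icc p q) → ∀ s ∈ Icc α β,
      HasDerivWithinAt v ((T (x s, v s)).inverse (R (x s, v s))) (Icc p q) s := by
    intro p q hpq hvd s hs
    by_cases hsm : s ∈ Icc p q
    swap
    · exact HasFDerivWithinAt.of_notMem_closure (by rwa [isClosed_Icc.closure_eq])
    rcases lt_or_ge p q with hlt | hle
    swap
    · exact HasFDerivWithinAt.of_subsingleton (subsingleton_Icc_of_ge hle)
    have hvs := (hvd s hsm).hasDerivWithinAt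
    set v' := derivWithin v (Icc p q) s
    have hz : (x s, v s) ∈ U ×ˢ {v : E | v ≠ 0} := ⟨hx s hs, hv s hs⟩
    obtain ⟨A, hA⟩ := hT _ hz
    have hTv : T (x s, v s) v' = R (x s, v s) := by
      ext u
      have e1 := ((h.differentiableAt_fderiv (hx s hs) (hv s hs)).hasFDerivAt.comp_hasDerivWithinAt
        s (f := fun s => (x s, v s)) (((hxv s hs).mono hpq).prodMk hvs)).clm_apply
          (hasDerivWithinAt_const s (Icc p q) ((0 : E), u))
      have e2 := (uniqueDiffOn_Icc hlt s hsm).eq_deriv _ e1 ((hEL s hs u).mono hpq)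
      have e3 : ((v s, v') : E × E) = (v s, 0) + (0, v') := by simp
      rw [e3, map_add] at e2
      simp only [map_zero, add_zero, _root_.add_apply] at e2
      simp [hTdef, hRdef, hρ]
      linarith
    rw [← hTv, ← hA]
    simpa using hvs
  have hsub₁ : Icc α s₀ ⊆ Icc α β := Icc_subset_Icc le_rfl h₂
  have hsub₂ : Icc s₀ β ⊆ Icc α β := Icc_subset_Icc h₁ le_rfl
  have hvV : ∀ s ∈ Icc α β, HasDerivWithinAt v ((T (x s, v s)).inverse (R (x s, v s)))
      (Icc α β) s := by
    intro s hs
    have := (hpiece _ _ hsub₁ hv₁ s hs).union (hpiece _ _ hsub₂ hv₂ s hs)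
    rwa [Icc_union_Icc_eq_Icc h₁ h₂] at this
  -- Bootstrapping: an integral curve of a smooth vector field is smooth.
  have hode := ODE.contDiffOn_enat_Icc_of_hasDerivWithinAt (n := ⊤) (f := fun _ => V)
    (α := fun s => (x s, v s)) (u := U ×ˢ {v : E | v ≠ 0}) (tmin := α) (tmax := β)
    (hVs.comp contDiff_snd.contDiffOn fun z hz => hz.2)
    (fun s hs => (hxv s hs).prodMk (hvV s hs)) fun s hs => ⟨hx s hs, hv s hs⟩
  exact contDiff_fst.comp_contDiffOn hode

end IsCoordFinslerSq

end CoordinateFinsler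

end StaticFinsler

namespace StaticFinsler

open Filter Topology MeasureTheory

/-! ### Natural coordinates on the tangent bundle -/

section Charts

set_option linter.unusedSectionVars false

variable {n : ℕ} {M : Type*} [TopologicalSpace M] [ChartedSpace (EuclideanSpace ℝ (Fin n)) M]
  [IsManifold (𝓡 n) ∞ M]

theorem chart_mdifferentiable {e : OpenPartialHomeomorph M (EuclideanSpace ℝ (Fin n))}
    (he : e ∈ IsManifold.maximalAtlas (𝓡 n) ∞ M) : e.MDifferentiable (𝓡 n) (𝓡 n) :=
  ⟨(contMDiffOn_of_mem_maximalAtlas he).mdifferentiableOn (by simp),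
    (contMDiffOn_symm_of_mem_maximalAtlas he).mdifferentiableOn (by simp)⟩

/-- Natural coordinates on the tangent bundle, as a map from the coordinates to the bundle. -/
noncomputable def naturalParam (e : OpenPartialHomeomorph M (EuclideanSpace ℝ (Fin n)))
    (z : EuclideanSpace ℝ (Fin n) × EuclideanSpace ℝ (Fin n)) : TangentBundle (𝓡 n) M :=
  ⟨e.symm z.1, mfderiv (𝓡 n) (𝓡 n) e.symm z.1 z.2⟩

/-- The natural parametrization is the tangent map of the inverse chart, after identifying the
tangent bundle of the model space with a product. -/
theorem contMDiffOn_naturalParam {e : OpenPartialHomeomorph M (EuclideanSpace ℝ (Fin n))}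
    (he : e ∈ IsManifold.maximalAtlas (𝓡 n) ∞ M) :
    ContMDiffOn 𝓘(ℝ, EuclideanSpace ℝ (Fin n) × EuclideanSpace ℝ (Fin n)) (𝓡 n).tangent ∞
      (naturalParam e) (e.target ×ˢ univ) := by
  have : IsManifold (𝓡 n) 1 M := IsManifold.of_le (n := ∞) (by simp)
  have h1 := (contMDiffOn_symm_of_mem_maximalAtlas he).contMDiffOn_tangentMapWithin
    (m := ∞) (by simp) e.open_target.uniqueMDiffOn
  have h2 := contMDiff_tangentBundleModelSpaceHomeomorph_symm (I := 𝓡 n) (n := ∞)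
  have h3 : ContMDiffOn (𝓡 n).tangent (𝓡 n).tangent ∞ (fun z : ModelProd
      (EuclideanSpace ℝ (Fin n)) (EuclideanSpace ℝ (Fin n)) => tangentMapWithin (𝓡 n) (𝓡 n) e.symm e.target
      ((tangentBundleModelSpaceHomeomorph (𝓡 n)).symm z)) (e.target ×ˢ univ) :=
    h1.comp h2.contMDiffOn fun z hz => hz.1
  have h4 : ContMDiffOn 𝓘(ℝ, EuclideanSpace ℝ (Fin n) × EuclideanSpace ℝ (Fin n)) (𝓡 n).tangent ∞
      (fun z : EuclideanSpace ℝ (Fin n) × EuclideanSpace ℝ (Fin n) =>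
        tangentMapWithin (𝓡 n) (𝓡 n) e.symm e.target
      ((tangentBundleModelSpaceHomeomorph (𝓡 n)).symm z)) (e.target ×ˢ univ) := by
    rw [modelWithCornersSelf_prod]
    exact h3
  refine h4.congr fun z hz => ?_
  have : mfderivWithin (𝓡 n) (𝓡 n) e.symm e.target z.1 = mfderiv (𝓡 n) (𝓡 n) e.symm z.1 :=
    mfderivWithin_of_isOpen e.open_target hz.1
  show naturalParam e z = ⟨e.symm z.1, mfderivWithin (𝓡 n) (𝓡 n) e.symm e.target z.1 z.2⟩
  rw [this]
  rfl

/-- Every tangent space is definitionally the model space, so one vector `w` can be placed over both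
base points. This avoids transport along `h`. -/
theorem tangentBundle_mk_congr {p q : M} (h : q = p) (w : EuclideanSpace ℝ (Fin n)) :
    (⟨q, w⟩ : TangentBundle (𝓡 n) M) = ⟨p, w⟩ := by
  subst h; rfl

theorem mfderiv_symm_mfderiv {e : OpenPartialHomeomorph M (EuclideanSpace ℝ (Fin n))}
    (he : e ∈ IsManifold.maximalAtlas (𝓡 n) ∞ M) {p : M} (hp : p ∈ e.source)
    (w : TangentSpace (𝓡 n) p) :
    mfderiv (𝓡 n) (𝓡 n) e.symm (e p) (mfderiv (𝓡 n) (𝓡 n) e p w) = w := by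
  have := congrArg (fun A => A w) ((chart_mdifferentiable he).symm_comp_deriv hp)
  exact this

theorem mfderiv_mfderiv_symm {e : OpenPartialHomeomorph M (EuclideanSpace ℝ (Fin n))}
    (he : e ∈ IsManifold.maximalAtlas (𝓡 n) ∞ M) {p : M} (hp : p ∈ e.source)
    (w : EuclideanSpace ℝ (Fin n)) :
    mfderiv (𝓡 n) (𝓡 n) e p (mfderiv (𝓡 n) (𝓡 n) e.symm (e p) w : EuclideanSpace ℝ (Fin n)) = w := by
  have h := (chart_mdifferentiable he).comp_symm_deriv (e.map_source hp)
  have := congrArg (fun A => A w) h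
  rw [e.left_inv hp] at this
  exact this

theorem naturalParam_mfderiv {e : OpenPartialHomeomorph M (EuclideanSpace ℝ (Fin n))}
    (he : e ∈ IsManifold.maximalAtlas (𝓡 n) ∞ M) {p : M} (hp : p ∈ e.source)
    (w : TangentSpace (𝓡 n) p) :
    naturalParam e (e p, mfderiv (𝓡 n) (𝓡 n) e p w) = ⟨p, w⟩ := by
  unfold naturalParam
  have h := mfderiv_symm_mfderiv he hp w
  exact (congrArg (fun u : EuclideanSpace ℝ (Fin n) =>
    (⟨e.symm (e p), u⟩ : TangentBundle (𝓡 n) M)) h).trans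
    (tangentBundle_mk_congr (e.left_inv hp) w)

variable {F : TangentBundle (𝓡 n) M → ℝ} {Λ : M → ℝ}

theorem coordSq_eq {e : OpenPartialHomeomorph M (EuclideanSpace ℝ (Fin n))}
    (z : EuclideanSpace ℝ (Fin n) × EuclideanSpace ℝ (Fin n)) :
    coordSq F e z.1 z.2 = F (naturalParam e z) ^ 2 := rfl

theorem coordSq_mfderiv {e : OpenPartialHomeomorph M (EuclideanSpace ℝ (Fin n))}
    (he : e ∈ IsManifold.maximalAtlas (𝓡 n) ∞ M) {p : M} (hp : p ∈ e.source)
    (w : TangentSpace (𝓡 n) p) :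
    coordSq F e (e p) (mfderiv (𝓡 n) (𝓡 n) e p w) = F ⟨p, w⟩ ^ 2 :=
  (coordSq_eq (F := F) (e := e) (e p, mfderiv (𝓡 n) (𝓡 n) e p w)).trans
    (by rw [naturalParam_mfderiv he hp])

theorem mfderiv_symm_ne_zero {e : OpenPartialHomeomorph M (EuclideanSpace ℝ (Fin n))}
    (he : e ∈ IsManifold.maximalAtlas (𝓡 n) ∞ M) {x : EuclideanSpace ℝ (Fin n)}
    (hx : x ∈ e.target) {v : EuclideanSpace ℝ (Fin n)} (hv : v ≠ 0) :
    mfderiv (𝓡 n) (𝓡 n) e.symm x v ≠ 0 := by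
  intro h
  apply hv
  have h1 := mfderiv_mfderiv_symm he (e.map_target hx) v
  rw [e.right_inv hx, h] at h1
  exact h1.symm.trans (map_zero _)

/-- The iterated one-variable derivatives in the definition are Fréchet derivatives once `f` is
differentiable near `v`, which C² at `v` ensures. -/
theorem verticalHessian_self {E : Type*} [NormedAddCommGroup E] [NormedSpace ℝ E] {f : E → ℝ}
    {v : E} (hf : ContDiffAt ℝ 2 f v) (u : E) :
    verticalHessian f v u u = (1 / 2) * fderiv ℝ (fderiv ℝ f) v u u := by
  unfold verticalHessian
  congr 1
  have h1 : ∀ᶠ r in 𝓝 (0 : ℝ), deriv (fun q : ℝ => f (v + r • u + q • u)) 0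
      = fderiv ℝ f (v + r • u) u := by
    have hd : ∀ᶠ y in 𝓝 v, DifferentiableAt ℝ f y := by
      filter_upwards [hf.eventually (by simp)] with y hy
      exact hy.differentiableAt two_ne_zero
    have hc : Tendsto (fun r : ℝ => v + r • u) (𝓝 0) (𝓝 v) := by
      have : Continuous fun r : ℝ => v + r • u := by fun_prop
      simpa using this.tendsto 0
    filter_upwards [hc.eventually hd] with r hr
    have h2 : HasDerivAt (fun q : ℝ => v + r • u + q • u) u 0 := by
      simpa using ((hasDerivAt_id (0 : ℝ)).smul_const u).const_add (v + r • u)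
    have h3 : HasFDerivAt f (fderiv ℝ f (v + r • u)) (v + r • u + (0 : ℝ) • u) := by
      simpa using hr.hasFDerivAt
    exact (h3.comp_hasDerivAt (f := fun q : ℝ => v + r • u + q • u) (0 : ℝ) h2).deriv
  have h1' : (fun r : ℝ => deriv (fun q : ℝ => f (v + r • u + q • u)) 0)
    =ᶠ[𝓝 0] fun r => fderiv ℝ f (v + r • u) u := h1
  rw [h1'.deriv_eq]
  have h2 : HasDerivAt (fun r : ℝ => v + r • u) u 0 := by
    simpa using ((hasDerivAt_id (0 : ℝ)).smul_const u).const_add v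
  have h3 : HasFDerivAt (fderiv ℝ f) (fderiv ℝ (fderiv ℝ f) v) (v + (0 : ℝ) • u) := by
    simpa using ((hf.fderiv_right (m := 1) (by norm_num)).differentiableAt
      one_ne_zero).hasFDerivAt
  have h4 := (h3.comp_hasDerivAt (f := fun r : ℝ => v + r • u) (0 : ℝ) h2).clm_apply (hasDerivAt_const (0 : ℝ) u)
  exact (h4.deriv.trans (by simp))

theorem fderiv_fderiv_inr {E : Type*} [NormedAddCommGroup E] [NormedSpace ℝ E] {Φ : E × E → ℝ}
    {x v : E} (hΦ : ContDiffAt ℝ 2 Φ (x, v)) (u : E) :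
    fderiv ℝ (fderiv ℝ fun w => Φ (x, w)) v u u
      = fderiv ℝ (fderiv ℝ Φ) (x, v) (0, u) (0, u) := by
  have hi : ∀ w : E, HasFDerivAt (fun w : E => (x, w)) (ContinuousLinearMap.inr ℝ E E) w :=
    fun w => (hasFDerivAt_const x w).prodMk (hasFDerivAt_id w)
  have h1 : (fderiv ℝ fun w => Φ (x, w)) =ᶠ[𝓝 v]
      fun w => (fderiv ℝ Φ (x, w)).comp (ContinuousLinearMap.inr ℝ E E) := by
    have hd : ∀ᶠ y in 𝓝 (x, v), DifferentiableAt ℝ Φ y := by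
      filter_upwards [hΦ.eventually (by simp)] with y hy
      exact hy.differentiableAt two_ne_zero
    have hc : Tendsto (fun w : E => (x, w)) (𝓝 v) (𝓝 (x, v)) :=
      (by fun_prop : Continuous fun w : E => (x, w)).tendsto v
    filter_upwards [hc.eventually hd] with w hw
    exact (hw.hasFDerivAt.comp w (hi w)).fderiv
  rw [h1.fderiv_eq]
  have h2 : DifferentiableAt ℝ (fderiv ℝ Φ) (x, v) :=
    (hΦ.fderiv_right (m := 1) (by norm_num)).differentiableAt one_ne_zero
  have h3 := (h2.hasFDerivAt.comp v (hi v)).clm_comp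
    (hasFDerivAt_const (ContinuousLinearMap.inr ℝ E E) v)
  erw [h3.fderiv]
  simp

/-- On each fibre the natural parametrization is an injective linear map, so every fibrewise axiom
of a Finsler metric pulls back. This is the bridge to the vector space results on `Φ`. -/
theorem coordSq_isCoordFinslerSq (hF : IsFinslerMetric F)
    {e : OpenPartialHomeomorph M (EuclideanSpace ℝ (Fin n))}
    (he : e ∈ IsManifold.maximalAtlas (𝓡 n) ∞ M) :
    IsCoordFinslerSq e.target (fun z => coordSq F e z.1 z.2) := by
  have hsm : ContDiffOn ℝ ∞ (fun z : EuclideanSpace ℝ (Fin n) × EuclideanSpace ℝ (Fin n) =>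
      coordSq F e z.1 z.2) (e.target ×ˢ {v | v ≠ 0}) := by
    have h1 : ContMDiffOn 𝓘(ℝ, EuclideanSpace ℝ (Fin n) × EuclideanSpace ℝ (Fin n)) 𝓘(ℝ, ℝ) ∞
        (fun z => F (naturalParam e z)) (e.target ×ˢ {v | v ≠ 0}) :=
      hF.smooth.comp ((contMDiffOn_naturalParam he).mono (prod_mono subset_rfl (subset_univ _)))
        fun z hz => mfderiv_symm_ne_zero he hz.1 hz.2
    exact (contMDiffOn_iff_contDiffOn.1 h1).pow 2
  -- By linearity the two-parameter functions that define the vertical Hessians in the chart and on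
  -- the manifold coincide, so the Hessians do too.
  have hlin : ∀ (x v u : EuclideanSpace ℝ (Fin n)) (r q : ℝ),
      coordSq F e x (v + r • u + q • u) = F ⟨e.symm x, mfderiv (𝓡 n) (𝓡 n) e.symm x v
        + r • mfderiv (𝓡 n) (𝓡 n) e.symm x u + q • mfderiv (𝓡 n) (𝓡 n) e.symm x u⟩ ^ 2 := by
    intro x v u r q
    have : mfderiv (𝓡 n) (𝓡 n) e.symm x (v + r • u + q • u) = mfderiv (𝓡 n) (𝓡 n) e.symm x v
        + r • mfderiv (𝓡 n) (𝓡 n) e.symm x u + q • mfderiv (𝓡 n) (𝓡 n) e.symm x u := by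
      refine ((mfderiv (𝓡 n) (𝓡 n) e.symm x).map_add _ _).trans ?_
      refine congrArg₂ _ (((mfderiv (𝓡 n) (𝓡 n) e.symm x).map_add _ _).trans ?_) ?_
      · exact congrArg₂ _ rfl ((mfderiv (𝓡 n) (𝓡 n) e.symm x).map_smul _ _)
      · exact (mfderiv (𝓡 n) (𝓡 n) e.symm x).map_smul _ _
    exact congrArg (fun w => F ⟨e.symm x, w⟩ ^ 2) this
  refine ⟨e.open_target, hsm, ?_, ?_, ?_⟩
  · intro x hx v c hc
    have h1 : mfderiv (𝓡 n) (𝓡 n) e.symm x (c • v) = c • mfderiv (𝓡 n) (𝓡 n) e.symm x v :=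
      (mfderiv (𝓡 n) (𝓡 n) e.symm x).map_smul _ _
    have h2 : coordSq F e x (c • v) = F ⟨e.symm x, c • mfderiv (𝓡 n) (𝓡 n) e.symm x v⟩ ^ 2 :=
      congrArg (fun w => F ⟨e.symm x, w⟩ ^ 2) h1
    have h3 : coordSq F e x v = F ⟨e.symm x, mfderiv (𝓡 n) (𝓡 n) e.symm x v⟩ ^ 2 := rfl
    simp only [h2, h3, hF.homogeneous _ _ c hc]
    ring
  · intro x hx v hv
    exact pow_pos (hF.pos _ _ (mfderiv_symm_ne_zero he hx hv)) 2
  · intro x hx v u hv hu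
    have hd : ContDiffAt ℝ 2 (fun z : EuclideanSpace ℝ (Fin n) × EuclideanSpace ℝ (Fin n) =>
        coordSq F e z.1 z.2) (x, v) :=
      (hsm.contDiffAt (x := (x, v)) ((e.open_target.prod isOpen_ne).mem_nhds ⟨hx, hv⟩)).of_le
        (by norm_cast)
    have h1 := hF.posDef (e.symm x) _ _ (mfderiv_symm_ne_zero he hx hv)
      (mfderiv_symm_ne_zero he hx hu)
    have h2 : verticalHessian (fun w => coordSq F e x w) v u u
        = verticalHessian (fun u : TangentSpace (𝓡 n) (e.symm x) => F ⟨e.symm x, u⟩ ^ 2)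
          (mfderiv (𝓡 n) (𝓡 n) e.symm x v) (mfderiv (𝓡 n) (𝓡 n) e.symm x u)
          (mfderiv (𝓡 n) (𝓡 n) e.symm x u) := by
      unfold verticalHessian
      simp only [hlin]
    rw [← h2, verticalHessian_self (f := fun w => coordSq F e x w)
      (hd.comp v (contDiffAt_const.prodMk contDiffAt_id))] at h1
    have h3 := fderiv_fderiv_inr hd u
    rw [← h3]
    linarith

end Charts

end StaticFinsler

namespace StaticFinsler

open Filter Topology MeasureTheory

/-! ### Curves and the Lagrangian in a chart -/

section Local

set_option linter.unusedSectionVars false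

/-- Near `s` at most two pieces of the subdivision matter, one on each side. A side degenerates only
at an end point of `[a, b]`, and a degenerate side is not asked to lie in a piece. -/
theorem exists_pieces {a b : ℝ} (hab : a < b) {k : ℕ} {t : Fin (k + 1) → ℝ}
    (ht : IsSubdivision a b t) {s : ℝ} (hs : s ∈ Icc a b) {δ : ℝ} (hδ : 0 < δ) :
    ∃ α β, a ≤ α ∧ α ≤ s ∧ s ≤ β ∧ β ≤ b ∧ s - δ < α ∧ β < s + δ ∧ α < β ∧
      (a < s → α < s) ∧ (s < b → s < β) ∧
      (α < s → ∃ j : Fin k, Icc α s ⊆ Icc (t j.castSucc) (t j.succ)) ∧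
      (s < β → ∃ j : Fin k, Icc s β ⊆ Icc (t j.castSucc) (t j.succ)) := by
  obtain ⟨hmono, h0, hk⟩ := ht
  have hL : ∃ α, a ≤ α ∧ α ≤ s ∧ s - δ < α ∧ (a < s → α < s) ∧
      (α < s → ∃ j : Fin k, Icc α s ⊆ Icc (t j.castSucc) (t j.succ)) := by
    rcases hs.1.eq_or_lt with h | h
    · exact ⟨a, le_rfl, h.le, by linarith, fun h' => h', fun h' => absurd h h'.ne⟩
    -- Otherwise induction over the nodes would put all of them, including `b`, to the left of `s`.
    · have : ∃ j : Fin k, t j.castSucc < s ∧ s ≤ t j.succ := by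
        by_contra hcon
        push Not at hcon
        have : ∀ j : Fin (k + 1), t j < s := by
          intro j
          induction j using Fin.induction with
          | zero => rwa [h0]
          | succ i ih => exact hcon i ih
        have := this (Fin.last k)
        rw [hk] at this
        exact absurd hs.2 (not_le.2 this)
      obtain ⟨j, hj1, hj2⟩ := this
      have hja : a ≤ t j.castSucc := by rw [← h0]; exact hmono.monotone (Fin.zero_le _)
      refine ⟨max (t j.castSucc) (s - δ / 2), hja.trans (le_max_left _ _),
        max_le hj1.le (by linarith), lt_max_of_lt_right (by linarith),
        fun _ => max_lt hj1 (by linarith), fun _ => ⟨j, Icc_subset_Icc (le_max_left _ _) hj2⟩⟩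
  have hR : ∃ β, s ≤ β ∧ β ≤ b ∧ β < s + δ ∧ (s < b → s < β) ∧
      (s < β → ∃ j : Fin k, Icc s β ⊆ Icc (t j.castSucc) (t j.succ)) := by
    rcases hs.2.eq_or_lt with h | h
    · exact ⟨b, h.le, le_rfl, by linarith, fun h' => h', fun h' => absurd h h'.ne⟩
    · have : ∃ j : Fin k, t j.castSucc ≤ s ∧ s < t j.succ := by
        by_contra hcon
        push Not at hcon
        have : ∀ j : Fin (k + 1), t j ≤ s := by
          intro j
          induction j using Fin.induction with
          | zero => rw [h0]; exact hs.1
          | succ i ih => exact hcon i ih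
        have := this (Fin.last k)
        rw [hk] at this
        exact absurd h (not_lt.2 this)
      obtain ⟨j, hj1, hj2⟩ := this
      have hjb : t j.succ ≤ b := by rw [← hk]; exact hmono.monotone (Fin.le_last _)
      refine ⟨min (t j.succ) (s + δ / 2), le_min hj2.le (by linarith),
        (min_le_left _ _).trans hjb, min_lt_of_right_lt (by linarith),
        fun _ => lt_min hj2 (by linarith), fun _ => ⟨j, Icc_subset_Icc hj1 (min_le_left _ _)⟩⟩
  obtain ⟨α, h1, h2, h3, h4, h5⟩ := hL
  obtain ⟨β, h6, h7, h8, h9, h10⟩ := hR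
  refine ⟨α, β, h1, h2, h6, h7, h3, h8, ?_, h4, h9, h5, h10⟩
  rcases hs.1.eq_or_lt with h | h
  · exact h2.trans_lt (h9 (h ▸ hab))
  · exact (h4 h).trans_le h6

theorem Icc_mem_nhdsWithin_Icc {a b α β s : ℝ} (h1 : a ≤ α) (h2 : α ≤ s) (h3 : s ≤ β)
    (h4 : β ≤ b) (hα : a < s → α < s) (hβ : s < b → s < β) : Icc α β ∈ 𝓝[Icc a b] s := by
  have hl : ∀ᶠ u in 𝓝[Icc a b] s, α ≤ u := by
    rcases (h1.trans h2).eq_or_lt with h | h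
    · filter_upwards [self_mem_nhdsWithin] with u hu
      exact h2.trans (h ▸ hu.1)
    · exact mem_nhdsWithin_of_mem_nhds (Ici_mem_nhds (hα h))
  have hr : ∀ᶠ u in 𝓝[Icc a b] s, u ≤ β := by
    rcases (h3.trans h4).eq_or_lt with h | h
    · filter_upwards [self_mem_nhdsWithin] with u hu
      exact hu.2.trans (h ▸ h3)
    · exact mem_nhdsWithin_of_mem_nhds (Iic_mem_nhds (hβ h))
  filter_upwards [hl, hr] with u h h' using ⟨h, h'⟩

variable {n : ℕ} {M : Type*} [TopologicalSpace M] [ChartedSpace (EuclideanSpace ℝ (Fin n)) M]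
  [IsManifold (𝓡 n) ∞ M]

/-- The curve `γ = (θ, σ)` in the chart `e` of `M`. -/
noncomputable def chartCurve (e : OpenPartialHomeomorph M (EuclideanSpace ℝ (Fin n)))
    (γ : ℝ → ℝ × M) (s : ℝ) : ℝ × EuclideanSpace ℝ (Fin n) :=
  ((γ s).1, e (γ s).2)

/-- The Finsler function `L` in the chart `e`. -/
noncomputable def chartLagrangian (F : TangentBundle (𝓡 n) M → ℝ) (Λ : M → ℝ)
    (e : OpenPartialHomeomorph M (EuclideanSpace ℝ (Fin n)))
    (z : (ℝ × EuclideanSpace ℝ (Fin n)) × (ℝ × EuclideanSpace ℝ (Fin n))) : ℝ :=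
  -Λ (e.symm z.1.2) * z.2.1 ^ 2 + coordSq F e z.1.2 z.2.2

variable {F : TangentBundle (𝓡 n) M → ℝ} {Λ : M → ℝ}
  {e : OpenPartialHomeomorph M (EuclideanSpace ℝ (Fin n))}

theorem contDiffOn_chart_potential (hΛ : ContMDiff (𝓡 n) 𝓘(ℝ, ℝ) ∞ Λ)
    (he : e ∈ IsManifold.maximalAtlas (𝓡 n) ∞ M) :
    ContDiffOn ℝ ∞ (fun x => Λ (e.symm x)) e.target :=
  contMDiffOn_iff_contDiffOn.1
    (hΛ.comp_contMDiffOn (contMDiffOn_symm_of_mem_maximalAtlas he))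

theorem contDiffOn_chartLagrangian (hF : IsFinslerMetric F) (hΛ : ContMDiff (𝓡 n) 𝓘(ℝ, ℝ) ∞ Λ)
    (he : e ∈ IsManifold.maximalAtlas (𝓡 n) ∞ M) :
    ContDiffOn ℝ 1 (chartLagrangian F Λ e) ((univ ×ˢ e.target) ×ˢ univ) := by
  have h1 : ContDiffOn ℝ 1 (fun z : (ℝ × EuclideanSpace ℝ (Fin n)) ×
      (ℝ × EuclideanSpace ℝ (Fin n)) => Λ (e.symm z.1.2)) ((univ ×ˢ e.target) ×ˢ univ) :=
    ((contDiffOn_chart_potential hΛ he).of_le (by norm_cast)).comp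
      (by fun_prop) fun z hz => hz.1.2
  have h2 : ContDiffOn ℝ 1 (fun z : (ℝ × EuclideanSpace ℝ (Fin n)) ×
      (ℝ × EuclideanSpace ℝ (Fin n)) => coordSq F e z.1.2 z.2.2)
      ((univ ×ˢ e.target) ×ˢ univ) :=
    (coordSq_isCoordFinslerSq hF he).contDiffOn_one.comp
      (f := fun z : (ℝ × EuclideanSpace ℝ (Fin n)) ×
      (ℝ × EuclideanSpace ℝ (Fin n)) => (z.1.2, z.2.2)) (by fun_prop)
      fun z hz => ⟨hz.1.2, mem_univ _⟩
  exact (h1.neg.mul (by fun_prop)).add h2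

/-- All later computations with `L` use this formula: `ρ = 0, u = 0` gives the momentum and `ρ' = 0,
u' = 0` the force. That `ρ` is absent on the right expresses that `t` is cyclic. -/
theorem fderiv_chartLagrangian (hF : IsFinslerMetric F) (hΛ : ContMDiff (𝓡 n) 𝓘(ℝ, ℝ) ∞ Λ)
    (he : e ∈ IsManifold.maximalAtlas (𝓡 n) ∞ M) {t τ ρ ρ' : ℝ}
    {x v u u' : EuclideanSpace ℝ (Fin n)} (hx : x ∈ e.target) :
    fderiv ℝ (chartLagrangian F Λ e) ((t, x), (τ, v)) ((ρ, u), (ρ', u'))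
      = -(fderiv ℝ (fun y => Λ (e.symm y)) x u) * τ ^ 2 - 2 * Λ (e.symm x) * τ * ρ'
        + fderiv ℝ (fun z : EuclideanSpace ℝ (Fin n) × EuclideanSpace ℝ (Fin n) =>
            coordSq F e z.1 z.2) (x, v) (u, u') := by
  have h1 : HasFDerivAt (fun y => Λ (e.symm y)) (fderiv ℝ (fun y => Λ (e.symm y)) x) x :=
    (((contDiffOn_chart_potential hΛ he).contDiffAt
      (e.open_target.mem_nhds hx)).differentiableAt (by simp)).hasFDerivAt
  have h2 := ((coordSq_isCoordFinslerSq hF he).differentiableAt hx v).hasFDerivAt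
  set p : (ℝ × EuclideanSpace ℝ (Fin n)) × (ℝ × EuclideanSpace ℝ (Fin n)) := ((t, x), (τ, v))
  have hx1 := ((ContinuousLinearMap.snd ℝ ℝ (EuclideanSpace ℝ (Fin n))).comp
    (ContinuousLinearMap.fst ℝ (ℝ × EuclideanSpace ℝ (Fin n))
      (ℝ × EuclideanSpace ℝ (Fin n)))).hasFDerivAt (x := p)
  have hx2 := ((ContinuousLinearMap.snd ℝ ℝ (EuclideanSpace ℝ (Fin n))).comp
    (ContinuousLinearMap.snd ℝ (ℝ × EuclideanSpace ℝ (Fin n))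
      (ℝ × EuclideanSpace ℝ (Fin n)))).hasFDerivAt (x := p)
  have hx3 := ((ContinuousLinearMap.fst ℝ ℝ (EuclideanSpace ℝ (Fin n))).comp
    (ContinuousLinearMap.snd ℝ (ℝ × EuclideanSpace ℝ (Fin n))
      (ℝ × EuclideanSpace ℝ (Fin n)))).hasFDerivAt (x := p)
  have h3 := HasFDerivAt.comp p h1 hx1
  have h4 := HasFDerivAt.comp p h2 (hx1.prodMk hx2)
  have h5 := (h3.neg.mul (hx3.pow 2)).add h4
  have h6 : fderiv ℝ (chartLagrangian F Λ e) p = _ := HasFDerivAt.fderiv h5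
  rw [h6]
  simp [p]
  ring

theorem hasDerivWithinAt_chart (he : e ∈ IsManifold.maximalAtlas (𝓡 n) ∞ M) {c : ℝ → M} {S : Set ℝ}
    {s : ℝ} (hc : MDifferentiableWithinAt 𝓘(ℝ, ℝ) (𝓡 n) c S s) (hcs : c s ∈ e.source) :
    HasDerivWithinAt (fun u => e (c u))
      (mfderiv (𝓡 n) (𝓡 n) e (c s) (mfderivWithin 𝓘(ℝ, ℝ) (𝓡 n) c S s (1 : ℝ))) S s := by
  have h1 := ((chart_mdifferentiable he).mdifferentiableAt hcs).hasMFDerivAt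
  have h2 := h1.comp_hasMFDerivWithinAt s hc.hasMFDerivWithinAt
  -- Naming the composite with a type free of tangent spaces lets its manifold derivative be read as
  -- an ordinary one.
  obtain ⟨A, hA⟩ : ∃ A : ℝ →L[ℝ] EuclideanSpace ℝ (Fin n), A =
    (mfderiv (𝓡 n) (𝓡 n) e (c s)).comp (mfderivWithin 𝓘(ℝ, ℝ) (𝓡 n) c S s) := ⟨_, rfl⟩
  rw [← hA] at h2
  have h3 : HasFDerivWithinAt (fun u => e (c u)) A S s :=
    hasMFDerivWithinAt_iff_hasFDerivWithinAt.1 h2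
  have h4 : A 1 = mfderiv (𝓡 n) (𝓡 n) e (c s)
    (mfderivWithin 𝓘(ℝ, ℝ) (𝓡 n) c S s (1 : ℝ)) := by rw [hA]; rfl
  exact h4 ▸ h3.hasDerivWithinAt

theorem finslerFunction_velocity (he : e ∈ IsManifold.maximalAtlas (𝓡 n) ∞ M)
    {γ : ℝ → ℝ × M} {S : Set ℝ} {s : ℝ}
    (h1 : DifferentiableWithinAt ℝ (fun u => (γ u).1) S s)
    (h2 : MDifferentiableWithinAt 𝓘(ℝ, ℝ) (𝓡 n) (fun u => (γ u).2) S s)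
    (hs : (γ s).2 ∈ e.source) (hS : UniqueDiffWithinAt ℝ S s) :
    finslerFunction F Λ (γ s).2 (velocity γ S s)
      = chartLagrangian F Λ e (chartCurve e γ s, derivWithin (chartCurve e γ) S s) := by
  have h3 := hasDerivWithinAt_chart he h2 hs
  have h5 := coordSq_mfderiv (F := F) he hs
    (mfderivWithin 𝓘(ℝ, ℝ) (𝓡 n) (fun u => (γ u).2) S s (1 : ℝ))
  obtain ⟨w, hw⟩ : ∃ w : EuclideanSpace ℝ (Fin n), w = mfderiv (𝓡 n) (𝓡 n) e (γ s).2
    (mfderivWithin 𝓘(ℝ, ℝ) (𝓡 n) (fun u => (γ u).2) S s (1 : ℝ)) := ⟨_, rfl⟩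
  rw [← hw] at h3
  have h6 : coordSq F e (e (γ s).2) w = _ := hw ▸ h5
  have h4 : HasDerivWithinAt (chartCurve e γ) (derivWithin (fun u => (γ u).1) S s, w) S s :=
    h1.hasDerivWithinAt.prodMk h3
  rw [h4.derivWithin hS]
  simp only [chartLagrangian, chartCurve, finslerFunction, velocity, e.left_inv hs]
  rw [← h6]

theorem mdifferentiableWithinAt_of_chart (he : e ∈ IsManifold.maximalAtlas (𝓡 n) ∞ M) {c : ℝ → M}
    {S : Set ℝ} {s : ℝ} (hc : DifferentiableWithinAt ℝ (fun u => e (c u)) S s)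
    (hsrc : ∀ᶠ u in 𝓝[S] s, c u ∈ e.source) (hs : c s ∈ e.source) :
    MDifferentiableWithinAt 𝓘(ℝ, ℝ) (𝓡 n) c S s := by
  have h1 := ((chart_mdifferentiable he).mdifferentiableAt_symm (e.map_source hs))
  have h2 := h1.comp_mdifferentiableWithinAt s hc.mdifferentiableWithinAt
  refine h2.congr_of_eventuallyEq ?_ (by simp [e.left_inv hs])
  filter_upwards [hsrc] with u hu
  simp [e.left_inv hu]

/-- The value of `L` along `γ` at an interior point of an interval where `γ` is smooth. -/
theorem finslerFunction_velocity_interior (he : e ∈ IsManifold.maximalAtlas (𝓡 n) ∞ M)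
    {γ : ℝ → ℝ × M} {a b s : ℝ} (hs : s ∈ Ioo a b)
    (h : DifferentiableAt ℝ (chartCurve e γ) s) (hsrc : ∀ᶠ u in 𝓝 s, (γ u).2 ∈ e.source) :
    finslerFunction F Λ (γ s).2 (velocity γ (Icc a b) s)
      = chartLagrangian F Λ e (chartCurve e γ s, deriv (chartCurve e γ) s) := by
  have hn : Icc a b ∈ 𝓝 s := Icc_mem_nhds hs.1 hs.2
  have h1 : DifferentiableAt ℝ (fun u => (γ u).1) s :=
    h.fst
  have h2 : DifferentiableAt ℝ (fun u => e (γ u).2) s :=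
    h.snd
  rw [finslerFunction_velocity he h1.differentiableWithinAt
    (mdifferentiableWithinAt_of_chart he h2.differentiableWithinAt
      (mem_nhdsWithin_of_mem_nhds hsrc) hsrc.self_of_nhds) hsrc.self_of_nhds
    (uniqueDiffOn_Icc (hs.1.trans hs.2) s ⟨hs.1.le, hs.2.le⟩),
    derivWithin_of_mem_nhds hn]

theorem contDiffOn_chart {H : Type*} [NormedAddCommGroup H] [NormedSpace ℝ H] {ψ : H → ℝ × M}
    {S : Set H} {m : WithTop ℕ∞} (hm : m ≤ ∞) (he : e ∈ IsManifold.maximalAtlas (𝓡 n) ∞ M)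
    (hψ : ContMDiffOn 𝓘(ℝ, H) (𝓘(ℝ, ℝ).prod (𝓡 n)) m ψ S) (hsrc : ∀ z ∈ S, (ψ z).2 ∈ e.source) :
    ContDiffOn ℝ m (fun z => ((ψ z).1, e (ψ z).2)) S := by
  have h1 : ContMDiffOn 𝓘(ℝ, H) 𝓘(ℝ, ℝ) m (fun z => (ψ z).1) S :=
    contMDiff_fst.comp_contMDiffOn hψ
  have h2 : ContMDiffOn 𝓘(ℝ, H) (𝓡 n) m (fun z => (ψ z).2) S :=
    contMDiff_snd.comp_contMDiffOn hψ
  have h3 : ContMDiffOn 𝓘(ℝ, H) (𝓡 n) m (fun z => e (ψ z).2) S :=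
    ((contMDiffOn_of_mem_maximalAtlas he).of_le hm).comp h2 fun z hz => hsrc z hz
  exact (contMDiffOn_iff_contDiffOn.1 h1).prodMk (contMDiffOn_iff_contDiffOn.1 h3)

end Local

end StaticFinsler

namespace StaticFinsler

open Filter Topology MeasureTheory

/-! ### The first variation of the energy -/

section FirstVariation

set_option linter.unusedSectionVars false

variable {n : ℕ} {M : Type*} [TopologicalSpace M] [ChartedSpace (EuclideanSpace ℝ (Fin n)) M]
  [IsManifold (𝓡 n) ∞ M]

/-- The family of curves `ψ` is smooth on `(-δ, δ) × [p, q]`, with values in the domain of the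
chart `e`. -/
structure IsChartStrip (e : OpenPartialHomeomorph M (EuclideanSpace ℝ (Fin n)))
    (ψ : ℝ → ℝ → ℝ × M) (δ p q : ℝ) : Prop where
  pos : 0 < δ
  lt : p < q
  smooth : ContDiffOn ℝ ∞ (fun z : ℝ × ℝ => chartCurve e (ψ z.1) z.2) (Ioo (-δ) δ ×ˢ Icc p q)
  source : ∀ r ∈ Ioo (-δ) δ, ∀ s ∈ Icc p q, (ψ r s).2 ∈ e.source

variable {F : TangentBundle (𝓡 n) M → ℝ} {Λ : M → ℝ}
  {e : OpenPartialHomeomorph M (EuclideanSpace ℝ (Fin n))} {ψ : ℝ → ℝ → ℝ × M}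
  {a b δ p q : ℝ}

namespace IsChartStrip

theorem zero_mem (h : IsChartStrip e ψ δ p q) : (0 : ℝ) ∈ Ioo (-δ) δ :=
  ⟨by linarith [h.pos], h.pos⟩

theorem hasDerivAt_fst (h : IsChartStrip e ψ δ p q) {s : ℝ} (hs : s ∈ Icc p q) :
    HasDerivAt (fun r => chartCurve e (ψ r) s) (fderivWithin ℝ
      (fun z : ℝ × ℝ => chartCurve e (ψ z.1) z.2) (Ioo (-δ) δ ×ˢ Icc p q) (0, s) (1, 0)) 0 :=
  hasDerivAt_fst_of_strip (h.smooth.differentiableOn (by simp)) h.zero_mem hs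

theorem contDiffOn_field (h : IsChartStrip e ψ δ p q) :
    ContDiffOn ℝ 1 (fun s => deriv (fun r => chartCurve e (ψ r) s) 0) (Icc p q) := by
  have h1 : ContDiffOn ℝ 1 (fun z => fderivWithin ℝ
      (fun z : ℝ × ℝ => chartCurve e (ψ z.1) z.2) (Ioo (-δ) δ ×ˢ Icc p q) z (1, 0))
      (Ioo (-δ) δ ×ˢ Icc p q) :=
    (h.smooth.fderivWithin (uniqueDiffOn_strip h.lt) (m := 1) (by norm_cast)).clm_apply
      contDiffOn_const
  have h2 := h1.comp (g := fun z => fderivWithin ℝ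
      (fun z : ℝ × ℝ => chartCurve e (ψ z.1) z.2) (Ioo (-δ) δ ×ˢ Icc p q) z (1, 0))
      (f := fun s : ℝ => ((0 : ℝ), s)) (s := Icc p q) (by fun_prop) fun s hs => ⟨h.zero_mem, hs⟩
  exact h2.congr fun s hs => (h.hasDerivAt_fst hs).deriv

theorem contDiffOn_curve (h : IsChartStrip e ψ δ p q) {r : ℝ} (hr : r ∈ Ioo (-δ) δ) :
    ContDiffOn ℝ ∞ (chartCurve e (ψ r)) (Icc p q) :=
  h.smooth.comp (f := fun s : ℝ => (r, s)) (by fun_prop) fun s hs => ⟨hr, hs⟩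

theorem differentiableAt_curve (h : IsChartStrip e ψ δ p q) {r s : ℝ} (hr : r ∈ Ioo (-δ) δ)
    (hs : s ∈ Ioo p q) : DifferentiableAt ℝ (chartCurve e (ψ r)) s :=
  ((h.contDiffOn_curve hr).contDiffAt (Icc_mem_nhds hs.1 hs.2)).differentiableAt (by simp)

theorem variation (h : IsChartStrip e ψ δ p q) (hab : Icc p q ⊆ Icc a b)
    (hF : IsFinslerMetric F) (hΛ : ContMDiff (𝓡 n) 𝓘(ℝ, ℝ) ∞ Λ)
    (he : e ∈ IsManifold.maximalAtlas (𝓡 n) ∞ M) :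
    ∃ D : ℝ → ℝ, ContinuousOn D (Icc p q) ∧
      (∀ r ∈ Ioo (-δ) δ, IntervalIntegrable (fun s =>
        finslerFunction F Λ (ψ r s).2 (velocity (ψ r) (Icc a b) s)) volume p q) ∧
      HasDerivAt (fun r => ∫ s in p..q,
        finslerFunction F Λ (ψ r s).2 (velocity (ψ r) (Icc a b) s)) (∫ s in p..q, D s) 0 ∧
      ∀ s ∈ Ioo p q,
        deriv (fun r => finslerFunction F Λ (ψ r s).2 (velocity (ψ r) (Icc a b) s)) 0 = D s ∧
        D s = fderiv ℝ (chartLagrangian F Λ e)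
          (chartCurve e (ψ 0) s, deriv (chartCurve e (ψ 0)) s)
          (deriv (fun r => chartCurve e (ψ r) s) 0,
            deriv (fun s => deriv (fun r => chartCurve e (ψ r) s) 0) s) := by
  set Y : ℝ × ℝ → ℝ × EuclideanSpace ℝ (Fin n) := fun z => chartCurve e (ψ z.1) z.2 with hY
  set S := Ioo (-δ) δ ×ˢ Icc p q with hS
  obtain ⟨D, hD, hGc, hGd, hGs⟩ := lagrangian_variation (O := univ ×ˢ e.target)
    (ℒ := chartLagrangian F Λ e) (Y := Y)
    (G := fun z => chartLagrangian F Λ e (Y z, fderivWithin ℝ Y S z (0, 1)))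
    (W := fun s => fderivWithin ℝ Y S (0, s) (1, 0))
    h.pos h.lt (isOpen_univ.prod e.open_target) (contDiffOn_chartLagrangian hF hΛ he)
    (h.smooth.of_le (by norm_cast))
    (fun z hz => ⟨mem_univ _, e.map_source (h.source z.1 hz.1 z.2 hz.2)⟩) (fun _ => rfl)
    (fun _ => rfl)
  have hsub : Ioo p q ⊆ Ioo a b := by
    have := interior_mono hab
    rwa [interior_Icc, interior_Icc] at this
  -- The comparison is made at interior points only. At a corner the derivative within `[a, b]` need
  -- not exist and the velocity then contains a default value, but integrals do not see the end
  -- points of the strip.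
  have hI : ∀ r ∈ Ioo (-δ) δ, ∀ s ∈ Ioo p q,
      finslerFunction F Λ (ψ r s).2 (velocity (ψ r) (Icc a b) s)
        = chartLagrangian F Λ e (Y (r, s), fderivWithin ℝ Y S (r, s) (0, 1)) := by
    intro r hr s hs
    have hev : ∀ᶠ u in 𝓝 s, (ψ r u).2 ∈ e.source := by
      filter_upwards [Icc_mem_nhds hs.1 hs.2] with u hu using h.source r hr u hu
    rw [finslerFunction_velocity_interior he (hsub hs) (h.differentiableAt_curve hr hs) hev]
    have h1 := (hasDerivWithinAt_snd_of_strip (h.smooth.differentiableOn (by simp)) hr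
      ⟨hs.1.le, hs.2.le⟩).hasDerivAt (Icc_mem_nhds hs.1 hs.2)
    rw [← h1.deriv]
  refine ⟨D, hD, ?_, ?_, ?_⟩
  · intro r hr
    have h1 : IntervalIntegrable (fun s => chartLagrangian F Λ e
        (Y (r, s), fderivWithin ℝ Y S (r, s) (0, 1))) volume p q :=
      (hGc r hr).intervalIntegrable_of_Icc h.lt.le
    refine h1.congr_uIoo fun s hs => ?_
    rw [uIoo_of_le h.lt.le] at hs
    exact (hI r hr s hs).symm
  · refine hGd.congr_of_eventuallyEq ?_
    filter_upwards [Ioo_mem_nhds h.zero_mem.1 h.zero_mem.2] with r hr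
    refine intervalIntegral.integral_congr_uIoo fun s hs => ?_
    rw [uIoo_of_le h.lt.le] at hs
    exact hI r hr s hs
  · intro s hs
    obtain ⟨h1, h2⟩ := hGs s hs
    have h3 : (fun r => finslerFunction F Λ (ψ r s).2 (velocity (ψ r) (Icc a b) s))
        =ᶠ[𝓝 0] fun r => chartLagrangian F Λ e (Y (r, s), fderivWithin ℝ Y S (r, s) (0, 1)) := by
      filter_upwards [Ioo_mem_nhds h.zero_mem.1 h.zero_mem.2] with r hr using hI r hr s hs
    refine ⟨by rw [h3.deriv_eq, h1.deriv], ?_⟩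
    have h4 : (fun s => deriv (fun r => chartCurve e (ψ r) s) 0) =ᶠ[𝓝 s]
        fun s => fderivWithin ℝ Y S (0, s) (1, 0) := by
      filter_upwards [Icc_mem_nhds hs.1 hs.2] with u hu using (h.hasDerivAt_fst hu).deriv
    rw [h4.deriv_eq, (h.hasDerivAt_fst ⟨hs.1.le, hs.2.le⟩).deriv]
    exact h2

end IsChartStrip

/-- Near each point of `[a, b]`, a proper variation consists of one or two chart strips. -/
theorem IsProperVariation.exists_strips (hab : a < b) {γ : ℝ → ℝ × M} {ε : ℝ}
    (hψ : IsProperVariation (𝓘(ℝ, ℝ).prod (𝓡 n)) a b γ ε ψ)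
    (he : e ∈ IsManifold.maximalAtlas (𝓡 n) ∞ M) {s : ℝ} (hs : s ∈ Icc a b)
    (hse : (γ s).2 ∈ e.source) :
    ∃ δ α β, a ≤ α ∧ α ≤ s ∧ s ≤ β ∧ β ≤ b ∧ (a < s → α < s) ∧ (s < b → s < β) ∧
      (∀ c ∈ Ico α s, IsChartStrip e ψ δ c s) ∧ ∀ d ∈ Ioc s β, IsChartStrip e ψ δ s d := by
  obtain ⟨k, t, ht, htsm⟩ := hψ.piecewise
  have h0 : (0 : ℝ) ∈ Ioo (-ε) ε := ⟨by linarith [hψ.pos], hψ.pos⟩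
  -- Joint continuity at `(0, s)` keeps the whole variation inside the chart on a product
  -- neighbourhood, with the same `δ` for both sides.
  have hc : ContinuousWithinAt (fun z : ℝ × ℝ => (ψ z.1 z.2).2) (Ioo (-ε) ε ×ˢ Icc a b) (0, s) :=
    continuous_snd.continuousAt.comp_continuousWithinAt (hψ.continuousOn (0, s) ⟨h0, hs⟩)
  have hev := hc (e.open_source.mem_nhds (by
    show (ψ 0 s).2 ∈ e.source
    rwa [hψ.zero s hs]))
  obtain ⟨η, hη, hsub⟩ := Metric.mem_nhdsWithin_iff.1 (mem_map.1 hev)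
  have hδ : 0 < min ε η := lt_min hψ.pos hη
  set δ := min ε η with hδdef
  obtain ⟨α, β, h1, h2, h3, h4, h5, h6, -, h7, h8, h9, h10⟩ := exists_pieces hab ht hs hδ
  have hstrip : ∀ c d, c < d → Icc c d ⊆ Icc α β →
      (∃ j : Fin k, Icc c d ⊆ Icc (t j.castSucc) (t j.succ)) → IsChartStrip e ψ δ c d := by
    rintro c d hcd hsub' ⟨j, hj⟩
    have hδε : Ioo (-δ) δ ⊆ Ioo (-ε) ε :=
      Ioo_subset_Ioo (neg_le_neg (min_le_left _ _)) (min_le_left _ _)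
    have hsrc : ∀ r ∈ Ioo (-δ) δ, ∀ u ∈ Icc c d, (ψ r u).2 ∈ e.source := by
      intro r hr u hu
      have hu' := hsub' hu
      have hrη : |r| < η := (abs_lt.2 hr).trans_le (min_le_right _ _)
      have huη : |u - s| < η := by
        have : δ ≤ η := min_le_right _ _
        rw [abs_lt]; constructor <;> linarith [hu'.1, hu'.2]
      refine hsub (show (r, u) ∈ _ from ⟨?_, hδε hr, h1.trans hu'.1, hu'.2.trans h4⟩)
      rw [Metric.mem_ball, Prod.dist_eq, Real.dist_eq, Real.dist_eq]
      simpa using ⟨hrη, huη⟩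
    exact ⟨hδ, hcd, contDiffOn_chart le_rfl he ((htsm j).mono (prod_mono hδε hj))
      fun z hz => hsrc z.1 hz.1 z.2 hz.2, hsrc⟩
  refine ⟨δ, α, β, h1, h2, h3, h4, h7, h8, fun c hc => ?_, fun d hd => ?_⟩
  · obtain ⟨j, hj⟩ := h9 (hc.1.trans_lt hc.2)
    exact hstrip c s hc.2 (Icc_subset_Icc hc.1 h3) ⟨j, (Icc_subset_Icc hc.1 le_rfl).trans hj⟩
  · obtain ⟨j, hj⟩ := h10 (hd.1.trans_le hd.2)
    exact hstrip s d hd.1 (Icc_subset_Icc h2 hd.2) ⟨j, (Icc_subset_Icc le_rfl hd.2).trans hj⟩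

/-- Local-to-global principle for additive properties of proper variations. -/
theorem IsProperVariation.induction (hab : a < b) {γ : ℝ → ℝ × M} {ε : ℝ}
    (hψ : IsProperVariation (𝓘(ℝ, ℝ).prod (𝓡 n)) a b γ ε ψ) {P : ℝ → ℝ → Prop}
    (hrefl : ∀ c, P c c) (htrans : ∀ c d e, P c d → P d e → P c e)
    (hstrip : ∀ e ∈ IsManifold.maximalAtlas (𝓡 n) ∞ M, ∀ δ p q, IsChartStrip e ψ δ p q →
      Icc p q ⊆ Icc a b → P p q) : P a b := by
  refine interval_induction hab.le (hrefl a) (fun c d e _ _ _ _ => htrans c d e) fun s hs => ?_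
  have he : chartAt (EuclideanSpace ℝ (Fin n)) (γ s).2 ∈ IsManifold.maximalAtlas (𝓡 n) ∞ M :=
    IsManifold.chart_mem_maximalAtlas _
  obtain ⟨δ, α, β, h1, h2, h3, h4, h5, h6, h7, h8⟩ :=
    hψ.exists_strips hab he hs (mem_chart_source _ _)
  refine ⟨α, β, Icc_mem_nhdsWithin_Icc h1 h2 h3 h4 h5 h6, fun c hc hac => ?_, fun d hd hdb => ?_⟩
  · rcases hc.2.eq_or_lt with h | h
    · rw [h]; exact hrefl s
    · exact hstrip _ he δ c s (h7 c ⟨hc.1, h⟩) (Icc_subset_Icc hac hs.2)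
  · rcases hd.1.eq_or_lt with h | h
    · rw [← h]; exact hrefl s
    · exact hstrip _ he δ s d (h8 d ⟨h, hd.2⟩) (Icc_subset_Icc hs.1 hdb)

/-- The first variation of the energy. -/
theorem IsProperVariation.hasDerivAt_energy (hab : a < b) (hF : IsFinslerMetric F)
    (hΛ : ContMDiff (𝓡 n) 𝓘(ℝ, ℝ) ∞ Λ) {γ : ℝ → ℝ × M} {ε : ℝ}
    (hψ : IsProperVariation (𝓘(ℝ, ℝ).prod (𝓡 n)) a b γ ε ψ) {D : ℝ → ℝ}
    (hD : ∀ s, D s = deriv (fun r =>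
      finslerFunction F Λ (ψ r s).2 (velocity (ψ r) (Icc a b) s)) 0) :
    IntervalIntegrable D volume a b ∧
      HasDerivAt (fun r => energy F Λ a b (ψ r)) ((1 / 2) * ∫ s in a..b, D s) 0 := by
  -- Integrability is part of the induction because the additivity of interval integrals requires
  -- it.
  have key : (∀ᶠ r in 𝓝 (0 : ℝ), IntervalIntegrable (fun s =>
        finslerFunction F Λ (ψ r s).2 (velocity (ψ r) (Icc a b) s)) volume a b) ∧
      IntervalIntegrable D volume a b ∧
      HasDerivAt (fun r => ∫ s in a..b,
        finslerFunction F Λ (ψ r s).2 (velocity (ψ r) (Icc a b) s)) (∫ s in a..b, D s) 0 := by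
    refine hψ.induction hab (P := fun c d => (∀ᶠ r in 𝓝 (0 : ℝ), IntervalIntegrable (fun s =>
        finslerFunction F Λ (ψ r s).2 (velocity (ψ r) (Icc a b) s)) volume c d) ∧
      IntervalIntegrable D volume c d ∧
      HasDerivAt (fun r => ∫ s in c..d,
        finslerFunction F Λ (ψ r s).2 (velocity (ψ r) (Icc a b) s)) (∫ s in c..d, D s) 0) ?_ ?_ ?_
    · intro c
      exact ⟨Eventually.of_forall fun r => IntervalIntegrable.refl, IntervalIntegrable.refl,
        by simpa using hasDerivAt_const (0 : ℝ) (0 : ℝ)⟩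
    · rintro c d f ⟨h1, h2, h3⟩ ⟨h4, h5, h6⟩
      refine ⟨?_, h2.trans h5, ?_⟩
      · filter_upwards [h1, h4] with r h h' using h.trans h'
      · rw [← intervalIntegral.integral_add_adjacent_intervals h2 h5]
        refine (h3.add h6).congr_of_eventuallyEq ?_
        filter_upwards [h1, h4] with r h h'
        exact (intervalIntegral.integral_add_adjacent_intervals h h').symm
    · intro e he δ p q hst hsub
      obtain ⟨D₀, hD₀, hint, hder, hval⟩ := hst.variation hsub hF hΛ he
      have hDD : ∀ s ∈ uIoo p q, D₀ s = D s := fun s hs => by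
        rw [uIoo_of_le hst.lt.le] at hs
        rw [hD, (hval s hs).1]
      refine ⟨?_, ?_, ?_⟩
      · filter_upwards [Ioo_mem_nhds hst.zero_mem.1 hst.zero_mem.2] with r hr using hint r hr
      · exact (hD₀.intervalIntegrable_of_Icc hst.lt.le).congr_uIoo hDD
      · rwa [intervalIntegral.integral_congr_uIoo hDD] at hder
  exact ⟨key.2.1, key.2.2.const_mul _⟩

end FirstVariation

end StaticFinsler

namespace StaticFinsler

open Filter Topology MeasureTheory

/-! ### Bump variations and the weak Euler–Lagrange equation -/

section BumpVariation

set_option linter.unusedSectionVars false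

variable {n : ℕ} {M : Type*} [TopologicalSpace M] [ChartedSpace (EuclideanSpace ℝ (Fin n)) M]
  [IsManifold (𝓡 n) ∞ M]
  {F : TangentBundle (𝓡 n) M → ℝ} {Λ : M → ℝ}
  {e : OpenPartialHomeomorph M (EuclideanSpace ℝ (Fin n))} {γ : ℝ → ℝ × M}
  {a b : ℝ}

/-- Lets the statements on chart strips be applied to a single curve. -/
theorem IsPiecewiseSmooth.isProperVariation_const
    (hγ : IsPiecewiseSmooth (𝓘(ℝ, ℝ).prod (𝓡 n)) a b γ) :
    IsProperVariation (𝓘(ℝ, ℝ).prod (𝓡 n)) a b γ 1 (fun _ => γ) := by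
  obtain ⟨hc, k, t, ht, hsm⟩ := hγ
  refine ⟨one_pos, ?_, fun _ _ => rfl, fun _ _ => rfl, fun _ _ => rfl, k, t, ht, fun j => ?_⟩
  · exact hc.comp continuousOn_snd fun z hz => hz.2
  · exact (hsm j).comp (contDiff_snd.contMDiff (n := ∞)).contMDiffOn fun z hz => hz.2

/-- A piecewise smooth curve near a point, in a chart. -/
theorem IsPiecewiseSmooth.exists_chart (hab : a < b)
    (hγ : IsPiecewiseSmooth (𝓘(ℝ, ℝ).prod (𝓡 n)) a b γ)
    (he : e ∈ IsManifold.maximalAtlas (𝓡 n) ∞ M) {s : ℝ} (hs : s ∈ Icc a b)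
    (hse : (γ s).2 ∈ e.source) :
    ∃ α β, a ≤ α ∧ α ≤ s ∧ s ≤ β ∧ β ≤ b ∧ (a < s → α < s) ∧ (s < b → s < β) ∧ α < β ∧
      (∀ u ∈ Icc α β, (γ u).2 ∈ e.source) ∧ ContDiffOn ℝ ∞ (chartCurve e γ) (Icc α s) ∧
      ContDiffOn ℝ ∞ (chartCurve e γ) (Icc s β) := by
  obtain ⟨δ, α, β, h1, h2, h3, h4, h5, h6, h7, h8⟩ :=
    hγ.isProperVariation_const.exists_strips hab he hs hse
  have hlt : α < β := by
    rcases hs.1.eq_or_lt with h | h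
    · exact h2.trans_lt (h6 (h ▸ hab))
    · exact (h5 h).trans_le h3
  have hsing : ∀ {p q : ℝ}, p ≤ s → s ≤ q → p = s → s = q →
      ContDiffOn ℝ ∞ (chartCurve e γ) (Icc p q) := by
    rintro p q - - rfl rfl
    rw [Icc_self]
    exact (contDiffOn_const (c := chartCurve e γ p)).congr fun v hv => by rw [hv]
  have hL : α < s → IsChartStrip e (fun _ => γ) δ α s := fun h => h7 α ⟨le_rfl, h⟩
  have hR : s < β → IsChartStrip e (fun _ => γ) δ s β := fun h => h8 β ⟨h, le_rfl⟩
  refine ⟨α, β, h1, h2, h3, h4, h5, h6, hlt, fun u hu => ?_, ?_, ?_⟩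
  · rcases le_total u s with h | h
    · rcases h2.eq_or_lt with h' | h'
      · rwa [le_antisymm h (h' ▸ hu.1)]
      · exact (hL h').source 0 (hL h').zero_mem u ⟨hu.1, h⟩
    · rcases h3.eq_or_lt with h' | h'
      · rwa [le_antisymm (h' ▸ hu.2) h]
      · exact (hR h').source 0 (hR h').zero_mem u ⟨h, hu.2⟩
  · rcases h2.eq_or_lt with h' | h'
    · exact hsing h2 le_rfl h' rfl
    · exact (hL h').contDiffOn_curve (hL h').zero_mem
  · rcases h3.eq_or_lt with h' | h'
    · exact hsing le_rfl h3 rfl h'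
    · exact (hR h').contDiffOn_curve (hR h').zero_mem

open Classical in
/-- The variation of `γ` in the direction `φ(s) u`, in the chart `e`. -/
noncomputable def bumpVariation (e : OpenPartialHomeomorph M (EuclideanSpace ℝ (Fin n)))
    (γ : ℝ → ℝ × M) (α β : ℝ) (φ : ℝ → ℝ) (u : ℝ × EuclideanSpace ℝ (Fin n)) (r s : ℝ) : ℝ × M :=
  if s ∈ Ioo α β then
    ((chartCurve e γ s + (r * φ s) • u).1, e.symm (chartCurve e γ s + (r * φ s) • u).2)
  else γ s

variable {α β ε : ℝ} {φ : ℝ → ℝ} {u : ℝ × EuclideanSpace ℝ (Fin n)}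

theorem bumpVariation_of_mem {s : ℝ} (hs : s ∈ Ioo α β) (r : ℝ) :
    bumpVariation e γ α β φ u r s =
    ((chartCurve e γ s + (r * φ s) • u).1, e.symm (chartCurve e γ s + (r * φ s) • u).2) :=
  if_pos hs

/-- Covers at once the original curve, `r = 0`, and the points where `φ` vanishes. -/
theorem bumpVariation_of_eq_zero (hsrc : ∀ s ∈ Icc α β, (γ s).2 ∈ e.source) {r s : ℝ}
    (h : r * φ s = 0) : bumpVariation e γ α β φ u r s = γ s := by
  by_cases hs : s ∈ Ioo α β
  · rw [bumpVariation_of_mem hs, h]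
    simp [chartCurve, e.left_inv (hsrc s ⟨hs.1.le, hs.2.le⟩)]
  · exact if_neg hs

/-- On the support of `φ`, which lies in `(α, β)`, the chart formula holds nearby. Off the closed
support the variation is locally `γ`. The order `m` is free so that `m = 0` gives continuity on `[a,
b]` and `m = ∞` smoothness on each piece. -/
theorem contMDiffOn_bumpVariation (he : e ∈ IsManifold.maximalAtlas (𝓡 n) ∞ M)
    (hsrc : ∀ s ∈ Icc α β, (γ s).2 ∈ e.source) (hφ : ContDiff ℝ ∞ φ)
    (hφs : tsupport φ ⊆ Ioo α β)
    (htgt : ∀ r ∈ Ioo (-ε) ε, ∀ s ∈ Ioo α β, (chartCurve e γ s + (r * φ s) • u).2 ∈ e.target)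
    {m : WithTop ℕ∞} (hm : m ≤ ∞) {S : Set ℝ}
    (hγ : ContMDiffOn 𝓘(ℝ, ℝ) (𝓘(ℝ, ℝ).prod (𝓡 n)) m γ S) :
    ContMDiffOn 𝓘(ℝ, ℝ × ℝ) (𝓘(ℝ, ℝ).prod (𝓡 n)) m
      (fun z : ℝ × ℝ => bumpVariation e γ α β φ u z.1 z.2) (Ioo (-ε) ε ×ˢ S) := by
  rintro ⟨r, s⟩ ⟨hr, hs⟩
  by_cases hsφ : s ∈ tsupport φ
  · have hsI := hφs hsφ
    have h1 : ContDiffOn ℝ m (chartCurve e γ) (S ∩ Ioo α β) :=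
      contDiffOn_chart hm he (hγ.mono inter_subset_left)
        fun z hz => hsrc z ⟨hz.2.1.le, hz.2.2.le⟩
    have h2 : ContDiffOn ℝ m (fun z : ℝ × ℝ => chartCurve e γ z.2 + (z.1 * φ z.2) • u)
        (Ioo (-ε) ε ×ˢ (S ∩ Ioo α β)) :=
      (h1.comp contDiffOn_snd fun z hz => hz.2).add
        ((contDiffOn_fst.mul ((hφ.of_le hm).comp_contDiffOn contDiffOn_snd)).smul
          contDiffOn_const)
    have h3 : ContMDiffOn 𝓘(ℝ, ℝ × ℝ) (𝓘(ℝ, ℝ).prod (𝓡 n)) m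
        (fun z : ℝ × ℝ => ((chartCurve e γ z.2 + (z.1 * φ z.2) • u).1,
          e.symm (chartCurve e γ z.2 + (z.1 * φ z.2) • u).2))
        (Ioo (-ε) ε ×ˢ (S ∩ Ioo α β)) := by
      refine (h2.fst.contMDiffOn).prodMk ?_
      exact ((contMDiffOn_symm_of_mem_maximalAtlas he).of_le hm).comp h2.snd.contMDiffOn
        fun z hz => htgt z.1 hz.1 z.2 hz.2.2
    have h4 := h3 (r, s) ⟨hr, hs, hsI⟩
    have hn : (Ioo (-ε) ε ×ˢ (S ∩ Ioo α β)) ∈ 𝓝[Ioo (-ε) ε ×ˢ S] (r, s) := by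
      have : (univ : Set ℝ) ×ˢ Ioo α β ∈ 𝓝 (r, s) :=
        prod_mem_nhds univ_mem (isOpen_Ioo.mem_nhds hsI)
      filter_upwards [self_mem_nhdsWithin, mem_nhdsWithin_of_mem_nhds this] with z hz hz'
      exact ⟨hz.1, hz.2, hz'.2⟩
    refine (h4.mono_of_mem_nhdsWithin hn).congr_of_eventuallyEq ?_ (bumpVariation_of_mem hsI r)
    filter_upwards [hn] with z hz
    exact bumpVariation_of_mem hz.2.2 z.1
  · have h1 : ContMDiffOn 𝓘(ℝ, ℝ × ℝ) (𝓘(ℝ, ℝ).prod (𝓡 n)) m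
        (fun z : ℝ × ℝ => γ z.2) (Ioo (-ε) ε ×ˢ S) :=
      hγ.comp (contDiff_snd.contMDiff (n := m)).contMDiffOn fun z hz => hz.2
    refine (h1 (r, s) ⟨hr, hs⟩).congr_of_eventuallyEq ?_
      (bumpVariation_of_eq_zero hsrc (by rw [image_eq_zero_of_notMem_tsupport hsφ, mul_zero]))
    have : (univ : Set ℝ) ×ˢ (tsupport φ)ᶜ ∈ 𝓝 (r, s) :=
      prod_mem_nhds univ_mem ((isClosed_tsupport φ).isOpen_compl.mem_nhds hsφ)
    filter_upwards [mem_nhdsWithin_of_mem_nhds this] with z hz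
    exact bumpVariation_of_eq_zero hsrc
      (by rw [image_eq_zero_of_notMem_tsupport hz.2, mul_zero])

theorem exists_bumpVariation (he : e ∈ IsManifold.maximalAtlas (𝓡 n) ∞ M)
    (hγ : IsPiecewiseSmooth (𝓘(ℝ, ℝ).prod (𝓡 n)) a b γ) (haα : a ≤ α) (hβb : β ≤ b)
    (hsrc : ∀ s ∈ Icc α β, (γ s).2 ∈ e.source)
    (hφ : ContDiff ℝ ∞ φ) (hφc : HasCompactSupport φ) (hφs : tsupport φ ⊆ Ioo α β)
    (u : ℝ × EuclideanSpace ℝ (Fin n)) :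
    ∃ ε, IsProperVariation (𝓘(ℝ, ℝ).prod (𝓡 n)) a b γ ε (bumpVariation e γ α β φ u) ∧
      ∀ r ∈ Ioo (-ε) ε, ∀ s ∈ Ioo α β, (chartCurve e γ s + (r * φ s) • u).2 ∈ e.target := by
  have hyc : ContinuousOn (fun s => e (γ s).2) (Icc α β) :=
    e.continuousOn.comp (continuous_snd.comp_continuousOn
      (hγ.1.mono (Icc_subset_Icc haα hβb))) hsrc
  have hK := isCompact_Icc.image_of_continuousOn hyc
  obtain ⟨η, hη, hηt⟩ := hK.exists_cthickening_subset_open e.open_target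
    (by rintro _ ⟨s, hs, rfl⟩; exact e.map_source (hsrc s hs))
  obtain ⟨B, hB⟩ := hφc.exists_bound_of_continuous hφ.continuous
  have hB0 : 0 ≤ B := (norm_nonneg _).trans (hB 0)
  -- The compact image of the curve has a closed `η`-neighbourhood in the chart target, and the
  -- displacement is at most `ε B ‖u.2‖`. The added `1` keeps the denominator positive.
  set ε := η / (B * ‖u.2‖ + 1) with hε
  have hden : 0 < B * ‖u.2‖ + 1 := by positivity
  have hεpos : 0 < ε := by positivity
  have htgt : ∀ r ∈ Ioo (-ε) ε, ∀ s ∈ Ioo α β,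
      (chartCurve e γ s + (r * φ s) • u).2 ∈ e.target := by
    intro r hr s hs
    apply hηt
    refine Metric.mem_cthickening_of_dist_le _ (e (γ s).2) _ _
      ⟨s, ⟨hs.1.le, hs.2.le⟩, rfl⟩ ?_
    rw [dist_eq_norm]
    have h1 : (chartCurve e γ s + (r * φ s) • u).2 - e (γ s).2 = (r * φ s) • u.2 := by
      simp [chartCurve]
    rw [h1, norm_smul, norm_mul]
    have hr' : ‖r‖ ≤ ε := (abs_lt.2 hr).le
    calc ‖r‖ * ‖φ s‖ * ‖u.2‖ ≤ ε * B * ‖u.2‖ := by gcongr; exact hB s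
      _ = ε * (B * ‖u.2‖) := by ring
      _ ≤ ε * (B * ‖u.2‖ + 1) := by gcongr; linarith
      _ = η := by rw [hε]; field_simp
  obtain ⟨hc, k, t, ht, hsm⟩ := hγ
  have hφ0 : ∀ s, s ∉ Ioo α β → φ s = 0 := fun s hs =>
    image_eq_zero_of_notMem_tsupport fun h => hs (hφs h)
  refine ⟨ε, ⟨hεpos, ?_, ?_, ?_, ?_, k, t, ht, fun j => ?_⟩, htgt⟩
  · exact contMDiffOn_zero_iff.1 (contMDiffOn_bumpVariation he hsrc hφ hφs htgt (by simp)
      (contMDiffOn_zero_iff.2 hc))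
  · intro s _
    exact bumpVariation_of_eq_zero hsrc (zero_mul _)
  · intro r _
    exact bumpVariation_of_eq_zero hsrc
      (by rw [hφ0 a fun h => absurd h.1 (not_lt.2 haα), mul_zero])
  · intro r _
    exact bumpVariation_of_eq_zero hsrc
      (by rw [hφ0 b fun h => absurd h.2 (not_lt.2 hβb), mul_zero])
  · exact contMDiffOn_bumpVariation he hsrc hφ hφs htgt le_rfl (hsm j)

/-- No differentiability is needed: curves that agree near `s` also share any default value of the
derivative. -/
theorem finslerFunction_velocity_congr {γ₁ γ₂ : ℝ → ℝ × M} {S : Set ℝ} {s : ℝ}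
    (h : γ₁ =ᶠ[𝓝 s] γ₂) :
    finslerFunction F Λ (γ₁ s).2 (velocity γ₁ S s)
      = finslerFunction F Λ (γ₂ s).2 (velocity γ₂ S s) := by
  have h0 : γ₁ s = γ₂ s := h.self_of_nhds
  have h1 : (fun u => (γ₁ u).1) =ᶠ[𝓝[S] s] fun u => (γ₂ u).1 := by
    filter_upwards [mem_nhdsWithin_of_mem_nhds h] with u hu
    exact congrArg Prod.fst hu
  have h2 : (fun u => (γ₁ u).2) =ᶠ[𝓝[S] s] fun u => (γ₂ u).2 := by
    filter_upwards [mem_nhdsWithin_of_mem_nhds h] with u hu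
    exact congrArg Prod.snd hu
  have h3 := h1.derivWithin_eq (congrArg Prod.fst h0)
  obtain ⟨w₁, hw₁⟩ : ∃ w : EuclideanSpace ℝ (Fin n),
    w = mfderivWithin 𝓘(ℝ, ℝ) (𝓡 n) (fun u => (γ₁ u).2) S s (1 : ℝ) := ⟨_, rfl⟩
  obtain ⟨w₂, hw₂⟩ : ∃ w : EuclideanSpace ℝ (Fin n),
    w = mfderivWithin 𝓘(ℝ, ℝ) (𝓡 n) (fun u => (γ₂ u).2) S s (1 : ℝ) := ⟨_, rfl⟩
  have h4 : w₁ = w₂ := by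
    rw [hw₁, hw₂]
    exact congrArg (fun A : ℝ →L[ℝ] EuclideanSpace ℝ (Fin n) => A 1)
      (h2.mfderivWithin_eq (congrArg Prod.snd h0))
  have h5 : (⟨(γ₁ s).2, w₁⟩ : TangentBundle (𝓡 n) M) = ⟨(γ₂ s).2, w₂⟩ := by
    rw [h4]; exact tangentBundle_mk_congr (congrArg Prod.snd h0) w₂
  have h6 : finslerFunction F Λ (γ₁ s).2 (velocity γ₁ S s)
      = -Λ (γ₁ s).2 * derivWithin (fun u => (γ₁ u).1) S s ^ 2 + F ⟨(γ₁ s).2, w₁⟩ ^ 2 := by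
    rw [hw₁]; rfl
  have h7 : finslerFunction F Λ (γ₂ s).2 (velocity γ₂ S s)
      = -Λ (γ₂ s).2 * derivWithin (fun u => (γ₂ u).1) S s ^ 2 + F ⟨(γ₂ s).2, w₂⟩ ^ 2 := by
    rw [hw₂]; rfl
  rw [h6, h7, h3, h5, h0]

/-- The weak Euler–Lagrange equations of a geodesic in a chart. -/
theorem IsGeodesic.weak_eulerLagrange (hab : a < b) (hF : IsFinslerMetric F)
    (hΛ : ContMDiff (𝓡 n) 𝓘(ℝ, ℝ) ∞ Λ) (hγ : IsGeodesic F Λ a b γ)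
    (he : e ∈ IsManifold.maximalAtlas (𝓡 n) ∞ M) (haα : a ≤ α) (hβb : β ≤ b) (hαβ : α < β)
    (hsrc : ∀ s ∈ Icc α β, (γ s).2 ∈ e.source) {N : Set ℝ} (hN : N.Countable)
    (hd : ∀ s ∈ Ioo α β \ N, DifferentiableAt ℝ (chartCurve e γ) s)
    (hφ : ContDiff ℝ ∞ φ) (hφc : HasCompactSupport φ) (hφs : tsupport φ ⊆ Ioo α β)
    (u : ℝ × EuclideanSpace ℝ (Fin n)) :
    ∫ s in α..β, (fderiv ℝ (chartLagrangian F Λ e)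
        (chartCurve e γ s, deriv (chartCurve e γ) s) (u, 0) * φ s
      + fderiv ℝ (chartLagrangian F Λ e)
        (chartCurve e γ s, deriv (chartCurve e γ) s) (0, u) * deriv φ s) = 0 := by
  obtain ⟨ε, hψ, htgt⟩ := exists_bumpVariation he hγ.1 haα hβb hsrc hφ hφc hφs u
  set ψ := bumpVariation e γ α β φ u with hψdef
  set D : ℝ → ℝ := fun s => deriv (fun r =>
      finslerFunction F Λ (ψ r s).2 (velocity (ψ r) (Icc a b) s)) 0 with hD
  obtain ⟨hDi, hDe⟩ := hψ.hasDerivAt_energy hab hF hΛ (D := D) fun _ => rfl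
  have hD0 : ∫ s in a..b, D s = 0 := by
    have := hDe.unique (hγ.2 ε ψ hψ)
    linarith
  -- Outside the support all varied curves agree with `γ` near `s`, so the integrand is independent
  -- of `r`, even at corners.
  have hout : ∀ s, s ∉ tsupport φ → D s = 0 := by
    intro s hs
    have : (fun r => finslerFunction F Λ (ψ r s).2 (velocity (ψ r) (Icc a b) s))
        = fun _ => finslerFunction F Λ (γ s).2 (velocity γ (Icc a b) s) := by
      ext r
      apply finslerFunction_velocity_congr
      filter_upwards [(isClosed_tsupport φ).isOpen_compl.mem_nhds hs] with v hv
      exact bumpVariation_of_eq_zero hsrc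
        (by rw [image_eq_zero_of_notMem_tsupport hv, mul_zero])
    simp only [hD, this]
    simp
  have hin : ∀ s ∈ Ioo α β \ N, D s = fderiv ℝ (chartLagrangian F Λ e)
        (chartCurve e γ s, deriv (chartCurve e γ) s) (u, 0) * φ s
      + fderiv ℝ (chartLagrangian F Λ e)
        (chartCurve e γ s, deriv (chartCurve e γ) s) (0, u) * deriv φ s := by
    intro s hs
    have hφd : HasDerivAt φ (deriv φ s) s := ((hφ.differentiable (by simp)) s).hasDerivAt
    have hyd := (hd s hs).hasDerivAt
    have hI : ∀ r ∈ Ioo (-ε) ε,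
        finslerFunction F Λ (ψ r s).2 (velocity (ψ r) (Icc a b) s)
        = chartLagrangian F Λ e (chartCurve e γ s + (r * φ s) • u,
            deriv (chartCurve e γ) s + (r * deriv φ s) • u) := by
      intro r hr
      have hev : chartCurve e (ψ r) =ᶠ[𝓝 s] fun s => chartCurve e γ s + (r * φ s) • u := by
        filter_upwards [isOpen_Ioo.mem_nhds hs.1] with v hv
        rw [chartCurve, hψdef, bumpVariation_of_mem hv r]
        exact Prod.ext rfl (e.right_inv (htgt r hr v hv))
      have hd1 : HasDerivAt (chartCurve e (ψ r))
          (deriv (chartCurve e γ) s + (r * deriv φ s) • u) s :=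
        (hyd.add ((hφd.const_mul r).smul_const u)).congr_of_eventuallyEq hev
      rw [finslerFunction_velocity_interior he
        ⟨haα.trans_lt hs.1.1, hs.1.2.trans_le hβb⟩ hd1.differentiableAt ?_, hd1.deriv,
        hev.self_of_nhds]
      filter_upwards [isOpen_Ioo.mem_nhds hs.1] with v hv
      rw [hψdef, bumpVariation_of_mem hv r]
      exact e.map_target (htgt r hr v hv)
    have hev : (fun r => finslerFunction F Λ (ψ r s).2 (velocity (ψ r) (Icc a b) s)) =ᶠ[𝓝 0]
        fun r => chartLagrangian F Λ e (chartCurve e γ s + (r * φ s) • u,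
            deriv (chartCurve e γ) s + (r * deriv φ s) • u) := by
      filter_upwards [Ioo_mem_nhds (neg_lt_zero.2 hψ.pos) hψ.pos] with r hr using hI r hr
    have hc : HasDerivAt (fun r : ℝ => (chartCurve e γ s + (r * φ s) • u,
        deriv (chartCurve e γ) s + (r * deriv φ s) • u)) (φ s • u, deriv φ s • u) 0 := by
      have h1 : ∀ c : ℝ, HasDerivAt (fun r : ℝ => (r * c) • u) (c • u) 0 := fun c => by
        simpa using ((hasDerivAt_id (0 : ℝ)).mul_const c).smul_const u
      exact ((h1 _).const_add _).prodMk ((h1 _).const_add _)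
    have hx : (chartCurve e γ s).2 ∈ e.target :=
      e.map_source (hsrc s ⟨hs.1.1.le, hs.1.2.le⟩)
    have hℒ : HasFDerivAt (chartLagrangian F Λ e) (fderiv ℝ (chartLagrangian F Λ e)
        (chartCurve e γ s, deriv (chartCurve e γ) s))
        (chartCurve e γ s + ((0 : ℝ) * φ s) • u,
          deriv (chartCurve e γ) s + ((0 : ℝ) * deriv φ s) • u) := by
      simp only [zero_mul, zero_smul, add_zero]
      exact (((contDiffOn_chartLagrangian hF hΛ he).contDiffAt
        (((isOpen_univ.prod e.open_target).prod isOpen_univ).mem_nhds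
          ⟨⟨mem_univ _, hx⟩, mem_univ _⟩)).differentiableAt one_ne_zero).hasFDerivAt
    have h2 := hℒ.comp_hasDerivAt (0 : ℝ) (f := fun r : ℝ => (chartCurve e γ s + (r * φ s) • u,
        deriv (chartCurve e γ) s + (r * deriv φ s) • u)) hc
    have h3 : D s = _ := hev.deriv_eq.trans h2.deriv
    rw [h3]
    have h4 : ((φ s • u, deriv φ s • u) : (ℝ × EuclideanSpace ℝ (Fin n)) × (ℝ × _))
        = φ s • (u, 0) + deriv φ s • (0, u) := by
      simp
    rw [h4, map_add, map_smul, map_smul]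
    simp only [smul_eq_mul]
    ring
  have hαβI : IntervalIntegrable D volume α β := hDi.mono_set (by
    rw [uIcc_of_le hαβ.le, uIcc_of_le hab.le]; exact Icc_subset_Icc haα hβb)
  -- `D` is supported in `(α, β)`, so its integrals over `[α, β]` and over `[a, b]` are equal.
  have hDαβ : ∫ s in α..β, D s = 0 := by
    have hsupp : Function.support D ⊆ Ioc α β := fun s hs => by
      by_contra hn
      exact hs (hout s fun h => hn ⟨(hφs h).1, (hφs h).2.le⟩)
    have hsupp' : Function.support D ⊆ Ioc a b := hsupp.trans (Ioc_subset_Ioc haα hβb)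
    rw [intervalIntegral.integral_eq_integral_of_support_subset hsupp,
      ← intervalIntegral.integral_eq_integral_of_support_subset hsupp', hD0]
  rw [← hDαβ]
  refine intervalIntegral.integral_congr_ae ?_
  have h1 : ∀ᵐ s : ℝ, s ∉ N := hN.ae_notMem volume
  have h2 : ∀ᵐ s : ℝ, s ≠ β := (countable_singleton β).ae_notMem volume
  filter_upwards [h1, h2] with s hs1 hs2 hs
  rw [uIoc_of_le hαβ.le] at hs
  exact (hin s ⟨⟨hs.1, lt_of_le_of_ne hs.2 hs2⟩, hs1⟩).symm

end BumpVariation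

end StaticFinsler

namespace StaticFinsler

open Filter Topology MeasureTheory

/-! ### Absence of corners and the local Euler–Lagrange equation -/

section LocalSolution

set_option linter.unusedSectionVars false

theorem exists_deriv_of_pieces {X : Type*} [NormedAddCommGroup X] [NormedSpace ℝ X] {α s₀ β : ℝ}
    {y : ℝ → X} (h₁ : α ≤ s₀) (h₂ : s₀ ≤ β) (hαβ : α < β) (hy₁ : ContDiffOn ℝ 1 y (Icc α s₀))
    (hy₂ : ContDiffOn ℝ 1 y (Icc s₀ β))
    (hm : α < s₀ → s₀ < β → derivWithin y (Icc α s₀) s₀ = derivWithin y (Icc s₀ β) s₀) :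
    ∃ v : ℝ → X, ContinuousOn v (Icc α β) ∧
      ∀ s ∈ Icc α β, HasDerivWithinAt y (v s) (Icc α β) s := by
  have hone : ∀ {p q : ℝ}, p < q → ContDiffOn ℝ 1 y (Icc p q) →
      ContinuousOn (derivWithin y (Icc p q)) (Icc p q) ∧
      ∀ s ∈ Icc p q, HasDerivWithinAt y (derivWithin y (Icc p q) s) (Icc p q) s := by
    intro p q hpq h
    exact ⟨h.continuousOn_derivWithin (uniqueDiffOn_Icc hpq) le_rfl, fun s hs =>
      (h.differentiableOn one_ne_zero s hs).hasDerivWithinAt⟩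
  rcases h₁.eq_or_lt with h | h₁'
  · subst h; exact ⟨_, hone hαβ hy₂⟩
  rcases h₂.eq_or_lt with h | h₂'
  · subst h; exact ⟨_, hone hαβ hy₁⟩
  obtain ⟨c1, d1⟩ := hone h₁' hy₁
  obtain ⟨c2, d2⟩ := hone h₂' hy₂
  set v : ℝ → X := fun s => if s ≤ s₀ then derivWithin y (Icc α s₀) s
    else derivWithin y (Icc s₀ β) s with hv
  have e1 : ∀ s ∈ Icc α s₀, v s = derivWithin y (Icc α s₀) s := fun s hs => if_pos hs.2
  have e2 : ∀ s ∈ Icc s₀ β, v s = derivWithin y (Icc s₀ β) s := fun s hs => by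
    rcases hs.1.eq_or_lt with h | h
    · rw [← h, e1 s₀ ⟨h₁, le_rfl⟩]; exact hm h₁' h₂'
    · exact if_neg (not_le.2 h)
  refine ⟨v, ?_, fun s hs => ?_⟩
  · rw [← Icc_union_Icc_eq_Icc h₁ h₂]
    exact (c1.congr e1).union_of_isClosed (c2.congr e2) isClosed_Icc isClosed_Icc
  · rw [← Icc_union_Icc_eq_Icc h₁ h₂]
    refine HasDerivWithinAt.union ?_ ?_
    · by_cases h : s ∈ Icc α s₀
      · rw [e1 s h]; exact d1 s h
      · exact HasFDerivWithinAt.of_notMem_closure (by rwa [isClosed_Icc.closure_eq])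
    · by_cases h : s ∈ Icc s₀ β
      · rw [e2 s h]; exact d2 s h
      · exact HasFDerivWithinAt.of_notMem_closure (by rwa [isClosed_Icc.closure_eq])

variable {n : ℕ} {M : Type*} [TopologicalSpace M] [ChartedSpace (EuclideanSpace ℝ (Fin n)) M]
  [IsManifold (𝓡 n) ∞ M]
  {F : TangentBundle (𝓡 n) M → ℝ} {Λ : M → ℝ}
  {e : OpenPartialHomeomorph M (EuclideanSpace ℝ (Fin n))} {γ : ℝ → ℝ × M}
  {a b : ℝ}

theorem continuousOn_fderiv_chartLagrangian (hF : IsFinslerMetric F)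
    (hΛ : ContMDiff (𝓡 n) 𝓘(ℝ, ℝ) ∞ Λ) (he : e ∈ IsManifold.maximalAtlas (𝓡 n) ∞ M) {S : Set ℝ}
    {y v : ℝ → ℝ × EuclideanSpace ℝ (Fin n)} (hy : ContinuousOn y S) (hv : ContinuousOn v S)
    (hyt : ∀ s ∈ S, (y s).2 ∈ e.target)
    (w : (ℝ × EuclideanSpace ℝ (Fin n)) × (ℝ × EuclideanSpace ℝ (Fin n))) :
    ContinuousOn (fun s => fderiv ℝ (chartLagrangian F Λ e) (y s, v s) w) S := by
  have h1 := (contDiffOn_chartLagrangian hF hΛ he).continuousOn_fderiv_of_isOpen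
    ((isOpen_univ.prod e.open_target).prod isOpen_univ) le_rfl
  exact (h1.comp (hy.prodMk hv) fun s hs => ⟨⟨mem_univ _, hyt s hs⟩, mem_univ _⟩).clm_apply
    continuousOn_const

/-- The Legendre map of `L` splits. Its time part is multiplication by `-2Λ`, nonzero since `Λ > 0`,
and its space part is the Legendre map of `F²`. The indefinite sign of `L` is therefore harmless. -/
theorem chartLagrangian_legendre_injective (hF : IsFinslerMetric F)
    (hΛ : ContMDiff (𝓡 n) 𝓘(ℝ, ℝ) ∞ Λ) (hΛpos : ∀ x, 0 < Λ x)
    (he : e ∈ IsManifold.maximalAtlas (𝓡 n) ∞ M) {y w w' : ℝ × EuclideanSpace ℝ (Fin n)}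
    (hy : y.2 ∈ e.target)
    (h : ∀ u, fderiv ℝ (chartLagrangian F Λ e) (y, w) (0, u)
      = fderiv ℝ (chartLagrangian F Λ e) (y, w') (0, u)) : w = w' := by
  obtain ⟨t, x⟩ := y
  obtain ⟨τ, v⟩ := w
  obtain ⟨τ', v'⟩ := w'
  have h1 : ∀ (ρ : ℝ) (u : EuclideanSpace ℝ (Fin n)),
      -2 * Λ (e.symm x) * τ * ρ + fderiv ℝ (fun z : EuclideanSpace ℝ (Fin n) ×
        EuclideanSpace ℝ (Fin n) => coordSq F e z.1 z.2) (x, v) (0, u)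
      = -2 * Λ (e.symm x) * τ' * ρ + fderiv ℝ (fun z : EuclideanSpace ℝ (Fin n) ×
        EuclideanSpace ℝ (Fin n) => coordSq F e z.1 z.2) (x, v') (0, u) := by
    intro ρ u
    have := h (ρ, u)
    rw [← Prod.mk_zero_zero, fderiv_chartLagrangian hF hΛ he hy,
      fderiv_chartLagrangian hF hΛ he hy, map_zero] at this
    linarith
  have hv : v = v' := (coordSq_isCoordFinslerSq hF he).legendre_injective hy fun u => by
    simpa using h1 0 u
  have hτ : τ = τ' := by
    have := h1 1 0
    rw [hv] at this
    have hp := hΛpos (e.symm x)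
    have h2 : Λ (e.symm x) * (τ - τ') = 0 := by linarith
    rcases mul_eq_zero.1 h2 with h3 | h3
    · exact absurd h3 hp.ne'
    · linarith
  rw [hv, hτ]

/-- On `[α, β]`, the curve `γ` lies in the chart `e`, is `C¹` with velocity `v`, smooth except
possibly at `s₀`, and solves the Euler–Lagrange equations. -/
structure IsLocalSolution (F : TangentBundle (𝓡 n) M → ℝ) (Λ : M → ℝ)
    (e : OpenPartialHomeomorph M (EuclideanSpace ℝ (Fin n))) (γ : ℝ → ℝ × M) (α s₀ β : ℝ)
    (v : ℝ → ℝ × EuclideanSpace ℝ (Fin n)) : Prop where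
  le_left : α ≤ s₀
  le_right : s₀ ≤ β
  lt : α < β
  source : ∀ s ∈ Icc α β, (γ s).2 ∈ e.source
  smooth_left : ContDiffOn ℝ ∞ (chartCurve e γ) (Icc α s₀)
  smooth_right : ContDiffOn ℝ ∞ (chartCurve e γ) (Icc s₀ β)
  continuousOn : ContinuousOn v (Icc α β)
  hasDeriv : ∀ s ∈ Icc α β, HasDerivWithinAt (chartCurve e γ) (v s) (Icc α β) s
  eulerLagrange : ∀ u, ∀ s ∈ Icc α β, HasDerivWithinAt
    (fun s => fderiv ℝ (chartLagrangian F Λ e) (chartCurve e γ s, v s) (0, u))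
    (fderiv ℝ (chartLagrangian F Λ e) (chartCurve e γ s, v s) (u, 0)) (Icc α β) s

/-- A Weierstrass–Erdmann argument: the momentum has a continuous representative, so its one-sided
limits at `s₀` agree, and injectivity of the Legendre map rules out a corner. The integrated
equation is then differentiated. -/
theorem IsGeodesic.exists_isLocalSolution (hab : a < b) (hF : IsFinslerMetric F)
    (hΛ : ContMDiff (𝓡 n) 𝓘(ℝ, ℝ) ∞ Λ) (hΛpos : ∀ x, 0 < Λ x) (hγ : IsGeodesic F Λ a b γ)
    (he : e ∈ IsManifold.maximalAtlas (𝓡 n) ∞ M) {s₀ : ℝ} (hs₀ : s₀ ∈ Icc a b)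
    (hse : (γ s₀).2 ∈ e.source) :
    ∃ α β v, a ≤ α ∧ β ≤ b ∧ Icc α β ∈ 𝓝[Icc a b] s₀ ∧ IsLocalSolution F Λ e γ α s₀ β v := by
  obtain ⟨α, β, h1, h2, h3, h4, h5, h6, hαβ, hsrc, hyL, hyR⟩ := hγ.1.exists_chart hab he hs₀ hse
  set y := chartCurve e γ with hy
  have hyt : ∀ s ∈ Icc α β, (y s).2 ∈ e.target := fun s hs => e.map_source (hsrc s hs)
  have hsubL : Icc α s₀ ⊆ Icc α β := Icc_subset_Icc le_rfl h3
  have hsubR : Icc s₀ β ⊆ Icc α β := Icc_subset_Icc h2 le_rfl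
  have hyC : ContinuousOn y (Icc α β) := by
    rw [← Icc_union_Icc_eq_Icc h2 h3]
    exact hyL.continuousOn.union_of_isClosed hyR.continuousOn isClosed_Icc isClosed_Icc
  have hdA : ∀ s ∈ Ioo α β \ {s₀}, ContDiffAt ℝ ∞ y s := by
    rintro s ⟨hs, hne⟩
    rcases lt_or_gt_of_ne hne with h | h
    · exact hyL.contDiffAt (Icc_mem_nhds hs.1 h)
    · exact hyR.contDiffAt (Icc_mem_nhds h hs.2)
  set f : ℝ × EuclideanSpace ℝ (Fin n) → ℝ → ℝ := fun u s =>
    fderiv ℝ (chartLagrangian F Λ e) (y s, deriv y s) (u, 0) with hf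
  set P : ℝ × EuclideanSpace ℝ (Fin n) → ℝ → ℝ := fun u s =>
    fderiv ℝ (chartLagrangian F Λ e) (y s, deriv y s) (0, u) with hP
  have hvC : ∀ {p q : ℝ}, p < q → ContDiffOn ℝ ∞ y (Icc p q) →
      ContinuousOn (derivWithin y (Icc p q)) (Icc p q) := fun hpq h =>
    h.continuousOn_derivWithin (uniqueDiffOn_Icc hpq) (by simp)
  have hpiece : ∀ {p q : ℝ}, p < q → Icc p q ⊆ Icc α β → ContDiffOn ℝ ∞ y (Icc p q) →
      ∀ w, ContinuousOn (fun s => fderiv ℝ (chartLagrangian F Λ e)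
        (y s, derivWithin y (Icc p q) s) w) (Icc p q) := fun hpq hsub h w =>
    continuousOn_fderiv_chartLagrangian hF hΛ he (hyC.mono hsub) (hvC hpq h)
      (fun s hs => hyt s (hsub hs)) w
  have hint1 : ∀ {p q : ℝ}, p ≤ q → Icc p q ⊆ Icc α β → ContDiffOn ℝ ∞ y (Icc p q) →
      ∀ w, IntervalIntegrable (fun s => fderiv ℝ (chartLagrangian F Λ e)
        (y s, deriv y s) w) volume p q := by
    intro p q hpq hsub h w
    rcases hpq.eq_or_lt with h' | hlt
    · rw [h']
    refine ((hpiece hlt hsub h w).intervalIntegrable_of_Icc hpq).congr_uIoo fun s hs => ?_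
    rw [uIoo_of_le hpq] at hs
    simp only
    rw [derivWithin_of_mem_nhds (Icc_mem_nhds hs.1 hs.2)]
  have hint : ∀ w, IntervalIntegrable (fun s => fderiv ℝ (chartLagrangian F Λ e)
        (y s, deriv y s) w) volume α β := fun w =>
    (hint1 h2 hsubL hyL w).trans (hint1 h3 hsubR hyR w)
  have hDBR : ∀ u, ∃ k, ∀ᵐ s, s ∈ Ioo α β → P u s = k + ∫ t in α..s, f u t := by
    intro u
    refine du_bois_reymond hαβ (countable_singleton s₀) isClosed_singleton (hint _) (hint _)
      ?_ fun φ hφ hφc hφs => ?_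
    · refine continuousOn_fderiv_chartLagrangian hF hΛ he (hyC.mono fun s hs =>
        ⟨hs.1.1.le, hs.1.2.le⟩) (fun s hs => ?_) (fun s hs => hyt s ⟨hs.1.1.le, hs.1.2.le⟩) _
      have h1 : ContinuousAt (fderiv ℝ y) s :=
        ((hdA s hs).fderiv_right (m := 0) (by simp)).continuousAt
      have h2 : deriv y = fun s => fderiv ℝ y s 1 := by ext1 s; exact fderiv_apply_one_eq_deriv.symm
      rw [h2]
      exact (h1.clm_apply continuousAt_const).continuousWithinAt
    · exact hγ.weak_eulerLagrange hab hF hΛ he h1 h4 hαβ hsrc (countable_singleton s₀)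
        (fun s hs => (hdA s hs).differentiableAt (by simp)) hφ hφc hφs u
  choose k hk using hDBR
  have hprim : ∀ u, ContinuousOn (fun s => k u + ∫ t in α..s, f u t) (Icc α β) := fun u => by
    have := intervalIntegral.continuousOn_primitive_interval' (hint (u, 0)) left_mem_uIcc
    rw [uIcc_of_le hαβ.le] at this
    exact continuousOn_const.add this
  -- Continuous functions that agree almost everywhere on a nondegenerate interval agree on it, end
  -- points included. The end point `s₀` is the one needed.
  have hext : ∀ {p q : ℝ}, p < q → Icc p q ⊆ Icc α β → ∀ (u) (Q : ℝ → ℝ),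
      ContinuousOn Q (Icc p q) → (∀ s ∈ Ioo p q, P u s = Q s) →
      EqOn Q (fun s => k u + ∫ t in α..s, f u t) (Icc p q) := by
    intro p q hpq hsub u Q hQ hPQ
    refine Measure.eqOn_of_ae_eq (μ := volume) ?_ hQ ((hprim u).mono hsub)
      (by rw [closure_interior_Icc hpq.ne])
    have hIoo : Ioo p q ⊆ Ioo α β := by
      have := interior_mono hsub
      rwa [interior_Icc, interior_Icc] at this
    rw [EventuallyEq, ae_restrict_iff' measurableSet_Icc]
    filter_upwards [hk u, (countable_singleton p).ae_notMem volume,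
      (countable_singleton q).ae_notMem volume] with s hs hp hq hm
    have hm' : s ∈ Ioo p q := ⟨lt_of_le_of_ne hm.1 (Ne.symm hp), lt_of_le_of_ne hm.2 hq⟩
    rw [← hPQ s hm']
    exact hs (hIoo hm')
  have hPpiece : ∀ {p q : ℝ}, p < q → Icc p q ⊆ Icc α β → ContDiffOn ℝ ∞ y (Icc p q) →
      ∀ u, EqOn (fun s => fderiv ℝ (chartLagrangian F Λ e) (y s, derivWithin y (Icc p q) s) (0, u))
        (fun s => k u + ∫ t in α..s, f u t) (Icc p q) := fun hpq hsub h u =>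
    hext hpq hsub u _ (hpiece hpq hsub h _) fun s hs => by
      simp only [hP]
      rw [derivWithin_of_mem_nhds (Icc_mem_nhds hs.1 hs.2)]
  -- Both one-sided momenta at `s₀` equal the value there of the same continuous primitive.
  have hmatch : α < s₀ → s₀ < β →
      derivWithin y (Icc α s₀) s₀ = derivWithin y (Icc s₀ β) s₀ := by
    intro hl hr
    refine chartLagrangian_legendre_injective hF hΛ hΛpos he (hyt s₀ ⟨h2, h3⟩) fun u => ?_
    have e1 := hPpiece hl hsubL hyL u (right_mem_Icc.2 h2)
    have e2 := hPpiece hr hsubR hyR u (left_mem_Icc.2 h3)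
    exact e1.trans e2.symm
  obtain ⟨v, hvc, hvd⟩ := exists_deriv_of_pieces h2 h3 hαβ (hyL.of_le (by simp))
    (hyR.of_le (by simp)) hmatch
  refine ⟨α, β, v, h1, h4, Icc_mem_nhdsWithin_Icc h1 h2 h3 h4 h5 h6, h2, h3, hαβ, hsrc, hyL, hyR,
    hvc, hvd, fun u s hs => ?_⟩
  have hvy : ∀ s ∈ Ioo α β, deriv y s = v s := fun s hs =>
    ((hvd s ⟨hs.1.le, hs.2.le⟩).hasDerivAt (Icc_mem_nhds hs.1 hs.2)).deriv
  have hQ : EqOn (fun s => fderiv ℝ (chartLagrangian F Λ e) (y s, v s) (0, u))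
      (fun s => k u + ∫ t in α..s, f u t) (Icc α β) :=
    hext hαβ subset_rfl u _ (continuousOn_fderiv_chartLagrangian hF hΛ he hyC hvc hyt _)
      fun s hs => by simp only [hP]; rw [hvy s hs]
  set g : ℝ → ℝ := fun s => fderiv ℝ (chartLagrangian F Λ e) (y s, v s) (u, 0) with hg
  have hgc : ContinuousOn g (Icc α β) :=
    continuousOn_fderiv_chartLagrangian hF hΛ he hyC hvc hyt _
  have hfg : ∀ s ∈ Icc α β, ∫ t in α..s, f u t = ∫ t in α..s, g t := fun s hs =>
    intervalIntegral.integral_congr_uIoo fun t ht => by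
      rw [uIoo_of_le hs.1] at ht
      simp only [hf, hg]
      rw [hvy t ⟨ht.1, ht.2.trans_le hs.2⟩]
  have hQ' : ∀ s ∈ Icc α β, fderiv ℝ (chartLagrangian F Λ e) (y s, v s) (0, u)
      = k u + ∫ t in α..s, g t := fun s hs => by
    rw [← hfg s hs]; exact hQ hs
  -- Instance used by the fundamental theorem of calculus within a closed interval, which covers the
  -- end points.
  have : Fact (s ∈ Icc α β) := ⟨hs⟩
  have hder : HasDerivWithinAt (fun s => ∫ t in α..s, g t) (g s) (Icc α β) s := by
    refine intervalIntegral.integral_hasDerivWithinAt_right ?_ ?_ (hgc s hs)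
    · exact (hgc.mono (Icc_subset_Icc le_rfl hs.2)).intervalIntegrable_of_Icc hs.1
    · exact hgc.stronglyMeasurableAtFilter_nhdsWithin measurableSet_Icc s
  exact (hder.const_add (k u)).congr hQ' (hQ' s hs)

end LocalSolution

end StaticFinsler

namespace StaticFinsler

open Filter Topology MeasureTheory

/-! ### From the chart Lagrangian to the geodesic equations and back -/

section Equations

set_option linter.unusedSectionVars false

/-- The product rule for a covector known only componentwise to be differentiable, proved by
expanding in a finite basis. It serves to differentiate the momentum paired with a variation field
or with the velocity. -/
theorem hasDerivWithinAt_apply_of_forall {X : Type*} [NormedAddCommGroup X] [NormedSpace ℝ X]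
    [FiniteDimensional ℝ X] {A : ℝ → X →L[ℝ] ℝ} {A' : X →L[ℝ] ℝ} {w : ℝ → X} {w' : X} {S : Set ℝ}
    {s : ℝ} (hA : ∀ u, HasDerivWithinAt (fun s => A s u) (A' u) S s)
    (hw : HasDerivWithinAt w w' S s) :
    HasDerivWithinAt (fun s => A s (w s)) (A' (w s) + A s w') S s := by
  set b := Module.finBasis ℝ X
  set c : ∀ i, X →L[ℝ] ℝ := fun i => (b.coord i).toContinuousLinearMap with hc
  have hsum : ∀ (L : X →L[ℝ] ℝ) (v : X), L v = ∑ i, c i v * L (b i) := fun L v => by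
    conv_lhs => rw [← b.sum_repr v, map_sum]
    simp only [map_smul, smul_eq_mul]
    rfl
  have h1 : HasDerivWithinAt (fun s => ∑ i, c i (w s) * A s (b i))
      (∑ i, (c i w' * A s (b i) + c i (w s) * A' (b i))) S s :=
    HasDerivWithinAt.fun_sum fun i _ =>
      ((c i).hasFDerivAt.comp_hasDerivWithinAt s hw).mul (hA (b i))
  rw [Finset.sum_add_distrib, ← hsum, ← hsum, add_comm] at h1
  exact h1.congr (fun s _ => hsum _ _) (hsum _ _)

variable {n : ℕ} {M : Type*} [TopologicalSpace M] [ChartedSpace (EuclideanSpace ℝ (Fin n)) M]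
  [IsManifold (𝓡 n) ∞ M]
  {F : TangentBundle (𝓡 n) M → ℝ} {Λ : M → ℝ}
  {e : OpenPartialHomeomorph M (EuclideanSpace ℝ (Fin n))} {γ : ℝ → ℝ × M}
  {a b α s₀ β : ℝ} {v : ℝ → ℝ × EuclideanSpace ℝ (Fin n)}

theorem partialDeriv_coordSq_right (hF : IsFinslerMetric F)
    (he : e ∈ IsManifold.maximalAtlas (𝓡 n) ∞ M) {x : EuclideanSpace ℝ (Fin n)}
    (hx : x ∈ e.target) (v : EuclideanSpace ℝ (Fin n)) (i : Fin n) :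
    partialDeriv i (fun q => coordSq F e x q) v
      = fderiv ℝ (fun z : EuclideanSpace ℝ (Fin n) × EuclideanSpace ℝ (Fin n) =>
        coordSq F e z.1 z.2) (x, v) (0, EuclideanSpace.single i 1) := by
  have h1 := ((coordSq_isCoordFinslerSq hF he).differentiableAt hx v).hasFDerivAt
  have h2 := h1.comp v (f := fun q => (x, q)) ((hasFDerivAt_const x v).prodMk (hasFDerivAt_id v))
  have h3 : fderiv ℝ (fun q => coordSq F e x q) v = _ := h2.fderiv
  rw [partialDeriv, h3]
  simp

theorem partialDeriv_coordSq_left (hF : IsFinslerMetric F)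
    (he : e ∈ IsManifold.maximalAtlas (𝓡 n) ∞ M) {x : EuclideanSpace ℝ (Fin n)}
    (hx : x ∈ e.target) (v : EuclideanSpace ℝ (Fin n)) (i : Fin n) :
    partialDeriv i (fun y => coordSq F e y v) x
      = fderiv ℝ (fun z : EuclideanSpace ℝ (Fin n) × EuclideanSpace ℝ (Fin n) =>
        coordSq F e z.1 z.2) (x, v) (EuclideanSpace.single i 1, 0) := by
  have h1 := ((coordSq_isCoordFinslerSq hF he).differentiableAt hx v).hasFDerivAt
  have h2 := h1.comp x (f := fun q => (q, v)) ((hasFDerivAt_id x).prodMk (hasFDerivAt_const v x))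
  have h3 : fderiv ℝ (fun q => coordSq F e q v) x = _ := h2.fderiv
  rw [partialDeriv, h3]
  simp

/-- `γ` is differentiable on `[a, b]`, and in each chart it solves the Euler–Lagrange equations. -/
structure SolvesEulerLagrange (F : TangentBundle (𝓡 n) M → ℝ) (Λ : M → ℝ) (a b : ℝ)
    (γ : ℝ → ℝ × M) : Prop where
  differentiable_fst : DifferentiableOn ℝ (fun s => (γ s).1) (Icc a b)
  differentiable_snd : MDifferentiableOn 𝓘(ℝ, ℝ) (𝓡 n) (fun s => (γ s).2) (Icc a b)
  continuous : ContinuousOn γ (Icc a b)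
  equation : ∀ e ∈ IsManifold.maximalAtlas (𝓡 n) ∞ M, ∀ s ∈ Icc a b, (γ s).2 ∈ e.source →
    ∀ u, HasDerivWithinAt
    (fun s => fderiv ℝ (chartLagrangian F Λ e)
      (chartCurve e γ s, derivWithin (chartCurve e γ) (Icc a b) s) (0, u))
    (fderiv ℝ (chartLagrangian F Λ e)
      (chartCurve e γ s, derivWithin (chartCurve e γ) (Icc a b) s) (u, 0)) (Icc a b) s

theorem hasDerivWithinAt_chartCurve (hd₁ : DifferentiableOn ℝ (fun s => (γ s).1) (Icc a b))
    (hd₂ : MDifferentiableOn 𝓘(ℝ, ℝ) (𝓡 n) (fun s => (γ s).2) (Icc a b))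
    (he : e ∈ IsManifold.maximalAtlas (𝓡 n) ∞ M) {s : ℝ}
    (hs : s ∈ Icc a b) (hse : (γ s).2 ∈ e.source) :
    HasDerivWithinAt (chartCurve e γ) (derivWithin (chartCurve e γ) (Icc a b) s) (Icc a b) s := by
  have h1 := (hd₁ s hs).prodMk
    (hasDerivWithinAt_chart he (hd₂ s hs) hse).differentiableWithinAt
  exact DifferentiableWithinAt.hasDerivWithinAt h1

theorem derivWithin_chartCurve (hab : a < b)
    (hd₁ : DifferentiableOn ℝ (fun s => (γ s).1) (Icc a b))
    (hd₂ : MDifferentiableOn 𝓘(ℝ, ℝ) (𝓡 n) (fun s => (γ s).2) (Icc a b))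
    (he : e ∈ IsManifold.maximalAtlas (𝓡 n) ∞ M) {s : ℝ}
    (hs : s ∈ Icc a b) (hse : (γ s).2 ∈ e.source) :
    derivWithin (chartCurve e γ) (Icc a b) s = (derivWithin (fun u => (γ u).1) (Icc a b) s,
      derivWithin (fun u => e (γ u).2) (Icc a b) s) := by
  have h1 := (hd₁ s hs).hasDerivWithinAt.prodMk
    (hasDerivWithinAt_chart he (hd₂ s hs) hse).differentiableWithinAt.hasDerivWithinAt
  exact HasDerivWithinAt.derivWithin h1 (uniqueDiffOn_Icc hab s hs)

theorem eventually_source (hc : ContinuousOn γ (Icc a b)) {s : ℝ} (hs : s ∈ Icc a b)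
    (hse : (γ s).2 ∈ e.source) : ∀ᶠ u in 𝓝[Icc a b] s, u ∈ Icc a b ∧ (γ u).2 ∈ e.source := by
  have h1 : ContinuousWithinAt (fun u => (γ u).2) (Icc a b) s :=
    continuous_snd.continuousAt.comp_continuousWithinAt (hc s hs)
  filter_upwards [self_mem_nhdsWithin, h1 (e.open_source.mem_nhds hse)] with u h2 h3
  exact ⟨h2, h3⟩

/-- The time momentum is `-2Λθ' = -2c`, with derivative zero, and the space components are combined
linearly over the standard basis. Continuity of `γ` keeps it in the chart near `s`. -/
theorem SolvesGeodesicEquations.solvesEulerLagrange (hab : a < b) (hF : IsFinslerMetric F)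
    (hΛ : ContMDiff (𝓡 n) 𝓘(ℝ, ℝ) ∞ Λ) (hc : ContinuousOn γ (Icc a b))
    (h : SolvesGeodesicEquations F Λ a b γ) : SolvesEulerLagrange F Λ a b γ := by
  refine ⟨h.differentiable_fst, h.differentiable_snd, hc, fun e he s hs hse u => ?_⟩
  obtain ⟨ρ, u⟩ := u
  obtain ⟨c, hct⟩ := h.time
  have hu : u = ∑ i, u i • EuclideanSpace.single i (1 : ℝ) := by
    ext j; simp [Finset.sum_apply, Pi.single_apply]
  have hval : ∀ u' ∈ Icc a b, (γ u').2 ∈ e.source → fderiv ℝ (chartLagrangian F Λ e)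
      (chartCurve e γ u', derivWithin (chartCurve e γ) (Icc a b) u') (0, (ρ, u))
      = -2 * c * ρ + ∑ i, u i * partialDeriv i (fun q => coordSq F e (e (γ u').2) q)
        (derivWithin (fun u => e (γ u).2) (Icc a b) u') := by
    intro t ht hte
    rw [derivWithin_chartCurve hab h.differentiable_fst h.differentiable_snd he ht hte,
      ← Prod.mk_zero_zero, chartCurve, fderiv_chartLagrangian hF hΛ he (e.map_source hte),
      map_zero, e.left_inv hte]
    simp only [partialDeriv_coordSq_right hF he (e.map_source hte)]
    have h1 : ((0, u) : EuclideanSpace ℝ (Fin n) × EuclideanSpace ℝ (Fin n))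
        = ∑ i, u i • ((0 : EuclideanSpace ℝ (Fin n)), EuclideanSpace.single i (1 : ℝ)) := by
      conv_lhs => rw [hu]
      simp [Prod.ext_iff, Prod.fst_sum, Prod.snd_sum]
    rw [h1, map_sum]
    simp only [map_smul, smul_eq_mul]
    rw [← hct t ht]
    ring
  have hder : HasDerivWithinAt (fun u' => -2 * c * ρ + ∑ i, u i * partialDeriv i
      (fun q => coordSq F e (e (γ u').2) q) (derivWithin (fun u => e (γ u).2) (Icc a b) u'))
      (∑ i, u i * (-partialDeriv i (fun y => Λ (e.symm y)) (e (γ s).2)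
          * derivWithin (fun u => (γ u).1) (Icc a b) s ^ 2
        + partialDeriv i (fun y => coordSq F e y
          (derivWithin (fun u => e (γ u).2) (Icc a b) s)) (e (γ s).2))) (Icc a b) s :=
    (HasDerivWithinAt.fun_sum fun i _ => (h.space e he s hs hse i).const_mul (u i)).const_add _
  have hev : (fun s => fderiv ℝ (chartLagrangian F Λ e)
      (chartCurve e γ s, derivWithin (chartCurve e γ) (Icc a b) s) (0, (ρ, u)))
      =ᶠ[𝓝[Icc a b] s] fun u' => -2 * c * ρ + ∑ i, u i * partialDeriv i
      (fun q => coordSq F e (e (γ u').2) q) (derivWithin (fun u => e (γ u).2) (Icc a b) u') := by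
    filter_upwards [eventually_source hc hs hse] with t ht using hval t ht.1 ht.2
  refine (hder.congr_of_eventuallyEq hev (hval s hs hse)).congr_deriv ?_
  rw [derivWithin_chartCurve hab h.differentiable_fst h.differentiable_snd he hs hse,
    ← Prod.mk_zero_zero, chartCurve, fderiv_chartLagrangian hF hΛ he (e.map_source hse)]
  simp only [partialDeriv_coordSq_left hF he (e.map_source hse)]
  have h1 : ((u, 0) : EuclideanSpace ℝ (Fin n) × EuclideanSpace ℝ (Fin n))
      = ∑ i, u i • (EuclideanSpace.single i (1 : ℝ), (0 : EuclideanSpace ℝ (Fin n))) := by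
    conv_lhs => rw [hu]
    simp [Prod.ext_iff, Prod.fst_sum, Prod.snd_sum]
  have h2 : fderiv ℝ (fun y => Λ (e.symm y)) (e (γ s).2) u
      = ∑ i, u i * partialDeriv i (fun y => Λ (e.symm y)) (e (γ s).2) := by
    conv_lhs => rw [hu]
    simp [partialDeriv]
  rw [h1, map_sum, h2]
  simp only [map_smul, smul_eq_mul, mul_add, Finset.sum_add_distrib]
  rw [mul_zero, sub_zero, ← Finset.sum_neg_distrib, Finset.sum_mul]
  congr 1
  exact Finset.sum_congr rfl fun i _ => by ring

/-- `L` does not depend on `t`, so the momentum conjugate to `t`, which is `-2Λθ'`, is conserved. -/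
theorem SolvesEulerLagrange.hasDerivWithinAt_time (hab : a < b) (hF : IsFinslerMetric F)
    (hΛ : ContMDiff (𝓡 n) 𝓘(ℝ, ℝ) ∞ Λ) (h : SolvesEulerLagrange F Λ a b γ) {s : ℝ}
    (hs : s ∈ Icc a b) :
    HasDerivWithinAt (fun s => Λ (γ s).2 * derivWithin (fun u => (γ u).1) (Icc a b) s) 0
      (Icc a b) s := by
  set e := chartAt (EuclideanSpace ℝ (Fin n)) (γ s).2
  have he : e ∈ IsManifold.maximalAtlas (𝓡 n) ∞ M := IsManifold.chart_mem_maximalAtlas _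
  have hse : (γ s).2 ∈ e.source := mem_chart_source _ _
  have h1 := (h.equation e he s hs hse (1, 0)).const_mul (-1 / 2)
  have hval : ∀ t ∈ Icc a b, (γ t).2 ∈ e.source →
      Λ (γ t).2 * derivWithin (fun u => (γ u).1) (Icc a b) t
      = (-1 / 2) * fderiv ℝ (chartLagrangian F Λ e)
        (chartCurve e γ t, derivWithin (chartCurve e γ) (Icc a b) t) (0, (1, 0)) := by
    intro t ht hte
    rw [derivWithin_chartCurve hab h.differentiable_fst h.differentiable_snd he ht hte,
      ← Prod.mk_zero_zero, chartCurve, fderiv_chartLagrangian hF hΛ he (e.map_source hte),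
      map_zero, e.left_inv hte, Prod.mk_zero_zero, map_zero]
    ring
  have hev : (fun s => Λ (γ s).2 * derivWithin (fun u => (γ u).1) (Icc a b) s)
      =ᶠ[𝓝[Icc a b] s] fun t => (-1 / 2) * fderiv ℝ (chartLagrangian F Λ e)
        (chartCurve e γ t, derivWithin (chartCurve e γ) (Icc a b) t) (0, (1, 0)) := by
    filter_upwards [eventually_source h.continuous hs hse] with t ht using hval t ht.1 ht.2
  refine (h1.congr_of_eventuallyEq hev (hval s hs hse)).congr_deriv ?_
  rw [derivWithin_chartCurve hab h.differentiable_fst h.differentiable_snd he hs hse,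
    ← Prod.mk_zero_zero, chartCurve, fderiv_chartLagrangian hF hΛ he (e.map_source hse),
    map_zero, Prod.mk_zero_zero, map_zero]
  ring

theorem SolvesEulerLagrange.solvesGeodesicEquations (hab : a < b) (hF : IsFinslerMetric F)
    (hΛ : ContMDiff (𝓡 n) 𝓘(ℝ, ℝ) ∞ Λ) (h : SolvesEulerLagrange F Λ a b γ) :
    SolvesGeodesicEquations F Λ a b γ := by
  refine ⟨h.differentiable_fst, h.differentiable_snd, fun e he s hs hse i => ?_, ?_⟩
  · have h1 := h.equation e he s hs hse (0, EuclideanSpace.single i 1)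
    have hval : ∀ t ∈ Icc a b, (γ t).2 ∈ e.source →
        partialDeriv i (fun q => coordSq F e (e (γ t).2) q)
          (derivWithin (fun u => e (γ u).2) (Icc a b) t)
        = fderiv ℝ (chartLagrangian F Λ e) (chartCurve e γ t,
          derivWithin (chartCurve e γ) (Icc a b) t) (0, (0, EuclideanSpace.single i 1)) := by
      intro t ht hte
      rw [derivWithin_chartCurve hab h.differentiable_fst h.differentiable_snd he ht hte,
        ← Prod.mk_zero_zero, chartCurve, fderiv_chartLagrangian hF hΛ he (e.map_source hte),
        map_zero, partialDeriv_coordSq_right hF he (e.map_source hte)]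
      ring
    refine (h1.congr_of_eventuallyEq ?_ (hval s hs hse)).congr_deriv ?_
    · filter_upwards [eventually_source h.continuous hs hse] with t ht using hval t ht.1 ht.2
    · rw [derivWithin_chartCurve hab h.differentiable_fst h.differentiable_snd he hs hse,
        ← Prod.mk_zero_zero, chartCurve, fderiv_chartLagrangian hF hΛ he (e.map_source hse),
        partialDeriv_coordSq_left hF he (e.map_source hse), partialDeriv]
      ring
  · refine ⟨_, fun s hs => constant_of_derivWithin_zero (fun s hs =>
      (h.hasDerivWithinAt_time hab hF hΛ hs).differentiableWithinAt) (fun s hs => ?_) s hs⟩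
    exact (h.hasDerivWithinAt_time hab hF hΛ ⟨hs.1, hs.2.le⟩).derivWithin
      (uniqueDiffOn_Icc hab s ⟨hs.1, hs.2.le⟩)

theorem IsLocalSolution.mono_of_mem (h : IsLocalSolution F Λ e γ α s₀ β v) {s : ℝ}
    (hn : Icc α β ∈ 𝓝[Icc a b] s) (hs : s ∈ Icc α β) :
    HasDerivWithinAt (chartCurve e γ) (v s) (Icc a b) s :=
  (h.hasDeriv s hs).mono_of_mem_nhdsWithin hn

theorem IsGeodesic.solvesEulerLagrange (hab : a < b) (hF : IsFinslerMetric F)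
    (hΛ : ContMDiff (𝓡 n) 𝓘(ℝ, ℝ) ∞ Λ) (hΛpos : ∀ x, 0 < Λ x) (hγ : IsGeodesic F Λ a b γ) :
    SolvesEulerLagrange F Λ a b γ := by
  have hloc : ∀ e ∈ IsManifold.maximalAtlas (𝓡 n) ∞ M, ∀ s ∈ Icc a b, (γ s).2 ∈ e.source →
      ∃ v : ℝ → ℝ × EuclideanSpace ℝ (Fin n),
        (∀ᶠ t in 𝓝[Icc a b] s, HasDerivWithinAt (chartCurve e γ) (v t) (Icc a b) t) ∧
        HasDerivWithinAt (chartCurve e γ) (v s) (Icc a b) s ∧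
        ∀ u, HasDerivWithinAt
          (fun s => fderiv ℝ (chartLagrangian F Λ e) (chartCurve e γ s, v s) (0, u))
          (fderiv ℝ (chartLagrangian F Λ e) (chartCurve e γ s, v s) (u, 0)) (Icc a b) s := by
    intro e he s hs hse
    obtain ⟨α, β, v, h1, h2, hn, h⟩ :=
      hγ.exists_isLocalSolution hab hF hΛ hΛpos he hs hse
    refine ⟨v, ?_, h.mono_of_mem hn ⟨h.le_left, h.le_right⟩, fun u =>
      (h.eulerLagrange u s ⟨h.le_left, h.le_right⟩).mono_of_mem_nhdsWithin hn⟩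
    -- To differentiate the momentum at `s`, the velocity must be identified at all points near `s`.
    have hn' : ∀ᶠ t in 𝓝[Icc a b] s, Icc α β ∈ 𝓝[Icc a b] t :=
      eventually_eventually_nhdsWithin.2 hn
    filter_upwards [hn', hn] with t ht ht' using h.mono_of_mem ht ht'
  have hch : ∀ x : M, chartAt (EuclideanSpace ℝ (Fin n)) x ∈ IsManifold.maximalAtlas (𝓡 n) ∞ M :=
    fun x => IsManifold.chart_mem_maximalAtlas x
  refine ⟨fun s hs => ?_, fun s hs => ?_, hγ.1.1, fun e he s hs hse u => ?_⟩
  · obtain ⟨v, -, h, -⟩ := hloc _ (hch (γ s).2) s hs (mem_chart_source _ _)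
    exact h.differentiableWithinAt.fst
  · obtain ⟨v, -, h, -⟩ := hloc _ (hch (γ s).2) s hs (mem_chart_source _ _)
    refine mdifferentiableWithinAt_of_chart (hch (γ s).2)
      h.differentiableWithinAt.snd ?_ (mem_chart_source _ _)
    filter_upwards [eventually_source hγ.1.1 hs (mem_chart_source (EuclideanSpace ℝ (Fin n)) _)] with t ht using ht.2
  · obtain ⟨v, hv, hvs, h⟩ := hloc e he s hs hse
    have hU := uniqueDiffOn_Icc hab
    rw [hvs.derivWithin (hU s hs)]
    refine (h u).congr_of_eventuallyEq ?_ (by rw [hvs.derivWithin (hU s hs)])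
    filter_upwards [hv, self_mem_nhdsWithin] with t ht ht'
    rw [ht.derivWithin (hU t ht')]

end Equations

end StaticFinsler

namespace StaticFinsler

open Filter Topology MeasureTheory

/-! ### Solutions of the equations are critical points -/

section Sufficiency

set_option linter.unusedSectionVars false

variable {n : ℕ} {M : Type*} [TopologicalSpace M] [ChartedSpace (EuclideanSpace ℝ (Fin n)) M]
  [IsManifold (𝓡 n) ∞ M]
  {F : TangentBundle (𝓡 n) M → ℝ} {Λ : M → ℝ}
  {e : OpenPartialHomeomorph M (EuclideanSpace ℝ (Fin n))} {γ : ℝ → ℝ × M} {ψ : ℝ → ℝ → ℝ × M}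
  {a b ε : ℝ}

/-- One tangent vector represents the derivative in all charts at once. It is placed over `p` rather
than `c r`, so that it can be added to velocities of `γ`. -/
theorem exists_tangentVector {c : ℝ → M} {r : ℝ} {p : M}
    (hc : MDifferentiableAt 𝓘(ℝ, ℝ) (𝓡 n) c r) (hp : c r = p) :
    ∃ z : TangentSpace (𝓡 n) p, ∀ e ∈ IsManifold.maximalAtlas (𝓡 n) ∞ M, p ∈ e.source →
      HasDerivAt (fun u => e (c u)) (mfderiv (𝓡 n) (𝓡 n) e p z : EuclideanSpace ℝ (Fin n)) r := by
  subst hp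
  refine ⟨mfderivWithin 𝓘(ℝ, ℝ) (𝓡 n) c univ r (1 : ℝ), fun e he hs => ?_⟩
  exact hasDerivWithinAt_univ.1 (hasDerivWithinAt_chart he hc.mdifferentiableWithinAt hs)

/-- The fiber derivative of `L` does not depend on the chart. -/
theorem fderiv_chartLagrangian_fiber (hF : IsFinslerMetric F)
    (hΛ : ContMDiff (𝓡 n) 𝓘(ℝ, ℝ) ∞ Λ) (he : e ∈ IsManifold.maximalAtlas (𝓡 n) ∞ M) {p : M}
    (hp : p ∈ e.source) (t τ ρ : ℝ) (w z : TangentSpace (𝓡 n) p)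
    {w' z' : EuclideanSpace ℝ (Fin n)} (hw : w' = mfderiv (𝓡 n) (𝓡 n) e p w)
    (hz : z' = mfderiv (𝓡 n) (𝓡 n) e p z) :
    fderiv ℝ (chartLagrangian F Λ e) ((t, e p), (τ, w')) (0, (ρ, z'))
      = deriv (fun q : ℝ => finslerFunction F Λ p (τ + q * ρ, w + q • z)) 0 := by
  have h1 : ∀ q : ℝ, finslerFunction F Λ p (τ + q * ρ, w + q • z)
      = chartLagrangian F Λ e ((t, e p), (τ + q * ρ, w' + q • z')) := by
    intro q
    have h2 : w' + q • z' = mfderiv (𝓡 n) (𝓡 n) e p (w + q • z) := by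
      rw [hw, hz]
      exact ((mfderiv (𝓡 n) (𝓡 n) e p).map_add _ _ |>.trans
        (congrArg₂ _ rfl ((mfderiv (𝓡 n) (𝓡 n) e p).map_smul _ _))).symm
    have h3 := coordSq_mfderiv (F := F) he hp (w + q • z)
    simp only [chartLagrangian, finslerFunction, e.left_inv hp, h2]
    rw [← h3]
  simp only [h1]
  have hℒ : HasFDerivAt (chartLagrangian F Λ e) (fderiv ℝ (chartLagrangian F Λ e)
      ((t, e p), (τ, w'))) ((t, e p), (τ + (0 : ℝ) * ρ, w' + (0 : ℝ) • z')) := by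
    simp only [zero_mul, zero_smul, add_zero]
    exact (((contDiffOn_chartLagrangian hF hΛ he).contDiffAt
      (((isOpen_univ.prod e.open_target).prod isOpen_univ).mem_nhds
        ⟨⟨mem_univ _, e.map_source hp⟩, mem_univ _⟩)).differentiableAt one_ne_zero).hasFDerivAt
  have hc : HasDerivAt (fun q : ℝ => ((t, e p), (τ + q * ρ, w' + q • z')))
      (((0 : ℝ), (0 : EuclideanSpace ℝ (Fin n))), (ρ, z')) 0 := by
    have h1 : HasDerivAt (fun q : ℝ => τ + q * ρ) ρ 0 := by
      simpa using ((hasDerivAt_id (0 : ℝ)).mul_const ρ).const_add τ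
    have h2 : HasDerivAt (fun q : ℝ => w' + q • z') z' 0 := by
      simpa using ((hasDerivAt_id (0 : ℝ)).smul_const z').const_add w'
    exact (hasDerivAt_const 0 (t, e p)).prodMk (h1.prodMk h2)
  have h4 := hℒ.comp_hasDerivAt (0 : ℝ)
    (f := fun q : ℝ => ((t, e p), (τ + q * ρ, w' + q • z'))) hc
  exact h4.deriv.symm

theorem IsProperVariation.hasDerivAt_chartCurve (hab : a < b)
    (hψ : IsProperVariation (𝓘(ℝ, ℝ).prod (𝓡 n)) a b γ ε ψ)
    (he : e ∈ IsManifold.maximalAtlas (𝓡 n) ∞ M) {s : ℝ} (hs : s ∈ Icc a b)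
    (hse : (γ s).2 ∈ e.source) :
    DifferentiableAt ℝ (fun r => chartCurve e (ψ r) s) 0 ∧
      ∀ᶠ r in 𝓝 (0 : ℝ), (ψ r s).2 ∈ e.source := by
  obtain ⟨δ, α, β, h1, h2, h3, h4, h5, h6, h7, h8⟩ := hψ.exists_strips hab he hs hse
  have key : ∀ p q, IsChartStrip e ψ δ p q → s ∈ Icc p q →
      DifferentiableAt ℝ (fun r => chartCurve e (ψ r) s) 0 ∧
      ∀ᶠ r in 𝓝 (0 : ℝ), (ψ r s).2 ∈ e.source := fun p q h hm => by
    refine ⟨(h.hasDerivAt_fst hm).differentiableAt, ?_⟩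
    filter_upwards [Ioo_mem_nhds h.zero_mem.1 h.zero_mem.2] with r hr using h.source r hr s hm
  rcases hs.1.eq_or_lt with h | h
  · exact key s β (h8 β ⟨h6 (h ▸ hab), le_rfl⟩) ⟨le_rfl, h3⟩
  · exact key α s (h7 α ⟨le_rfl, h5 h⟩) ⟨h2, le_rfl⟩

/-- The boundary term of the first variation, as a function on `[a, b]`. -/
theorem IsProperVariation.exists_boundaryTerm (hab : a < b) (hF : IsFinslerMetric F)
    (hΛ : ContMDiff (𝓡 n) 𝓘(ℝ, ℝ) ∞ Λ) (hγ : SolvesEulerLagrange F Λ a b γ)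
    (hψ : IsProperVariation (𝓘(ℝ, ℝ).prod (𝓡 n)) a b γ ε ψ) :
    ∃ B : ℝ → ℝ, ∀ s ∈ Icc a b, ∀ e ∈ IsManifold.maximalAtlas (𝓡 n) ∞ M, (γ s).2 ∈ e.source →
      B s = fderiv ℝ (chartLagrangian F Λ e)
        (chartCurve e γ s, derivWithin (chartCurve e γ) (Icc a b) s)
        (0, deriv (fun r => chartCurve e (ψ r) s) 0) := by
  have hpt : ∀ s, ∃ B : ℝ, s ∈ Icc a b → ∀ e ∈ IsManifold.maximalAtlas (𝓡 n) ∞ M,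
      (γ s).2 ∈ e.source → B = fderiv ℝ (chartLagrangian F Λ e)
        (chartCurve e γ s, derivWithin (chartCurve e γ) (Icc a b) s)
        (0, deriv (fun r => chartCurve e (ψ r) s) 0) := by
    intro s
    by_cases hs : s ∈ Icc a b
    swap
    · exact ⟨0, fun h => absurd h hs⟩
    have he₀ : chartAt (EuclideanSpace ℝ (Fin n)) (γ s).2 ∈ IsManifold.maximalAtlas (𝓡 n) ∞ M :=
      IsManifold.chart_mem_maximalAtlas _
    have hse₀ := mem_chart_source (EuclideanSpace ℝ (Fin n)) (γ s).2
    obtain ⟨hd, hev⟩ := hψ.hasDerivAt_chartCurve hab he₀ hs hse₀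
    have hψ0 : (ψ 0 s).2 = (γ s).2 := congrArg Prod.snd (hψ.zero s hs)
    have hmd : MDifferentiableAt 𝓘(ℝ, ℝ) (𝓡 n) (fun r => (ψ r s).2) 0 := by
      rw [← mdifferentiableWithinAt_univ]
      exact mdifferentiableWithinAt_of_chart he₀ hd.snd.differentiableWithinAt
        (mem_nhdsWithin_of_mem_nhds hev) (by rw [hψ0]; exact hse₀)
    obtain ⟨z, hz⟩ := exists_tangentVector hmd hψ0
    -- The fibre derivative of `L` at the velocity, in the direction of the variation vector,
    -- written without a chart.
    refine ⟨deriv (fun q : ℝ => finslerFunction F Λ (γ s).2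
      (derivWithin (fun u => (γ u).1) (Icc a b) s + q * deriv (fun r => (ψ r s).1) 0,
        mfderivWithin 𝓘(ℝ, ℝ) (𝓡 n) (fun u => (γ u).2) (Icc a b) s (1 : ℝ) + q • z)) 0,
      fun _ e he hse => ?_⟩
    have h1 := hasDerivWithinAt_chart he (hγ.differentiable_snd s hs) hse
    have h2 : HasDerivAt (fun r => chartCurve e (ψ r) s) _ 0 :=
      (show HasDerivAt (fun r => (ψ r s).1) _ 0 from hd.fst.hasDerivAt).prodMk (hz e he hse)
    rw [derivWithin_chartCurve hab hγ.differentiable_fst hγ.differentiable_snd he hs hse,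
      h1.derivWithin (uniqueDiffOn_Icc hab s hs), h2.deriv]
    exact (fderiv_chartLagrangian_fiber hF hΛ he hse _ _ _ _ z rfl rfl).symm
  choose B hB using hpt
  exact ⟨B, hB⟩

/-- On each chart strip the integrand of the first variation is the derivative of the boundary term
`B`. Since `B` is the same function in all charts, the differences telescope over `[a, b]`, and
corners of the variation cause no trouble. -/
theorem SolvesEulerLagrange.isGeodesic (hab : a < b) (hF : IsFinslerMetric F)
    (hΛ : ContMDiff (𝓡 n) 𝓘(ℝ, ℝ) ∞ Λ)
    (hps : IsPiecewiseSmooth (𝓘(ℝ, ℝ).prod (𝓡 n)) a b γ) (hγ : SolvesEulerLagrange F Λ a b γ) :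
    IsGeodesic F Λ a b γ := by
  refine ⟨hps, fun ε ψ hψ => ?_⟩
  obtain ⟨B, hB⟩ := hψ.exists_boundaryTerm hab hF hΛ hγ
  set D : ℝ → ℝ := fun s => deriv (fun r =>
      finslerFunction F Λ (ψ r s).2 (velocity (ψ r) (Icc a b) s)) 0 with hD
  obtain ⟨hDi, hDe⟩ := hψ.hasDerivAt_energy hab hF hΛ (D := D) fun _ => rfl
  have hend : ∀ s ∈ Icc a b, (∀ r ∈ Ioo (-ε) ε, ψ r s = γ s) → B s = 0 := by
    intro s hs hc
    have he : chartAt (EuclideanSpace ℝ (Fin n)) (γ s).2 ∈ IsManifold.maximalAtlas (𝓡 n) ∞ M :=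
      IsManifold.chart_mem_maximalAtlas _
    have hev : (fun r => chartCurve (chartAt (EuclideanSpace ℝ (Fin n)) (γ s).2) (ψ r) s)
        =ᶠ[𝓝 0] fun _ => chartCurve (chartAt (EuclideanSpace ℝ (Fin n)) (γ s).2) γ s := by
      filter_upwards [Ioo_mem_nhds (neg_lt_zero.2 hψ.pos) hψ.pos] with r hr
      simp only [chartCurve, hc r hr]
    rw [hB s hs _ he (mem_chart_source _ _), hev.deriv_eq, deriv_const, Prod.mk_zero_zero,
      map_zero]
  have key : IntervalIntegrable D volume a b ∧ ∫ s in a..b, D s = B b - B a := by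
    refine hψ.induction hab (P := fun c d => IntervalIntegrable D volume c d ∧
      ∫ s in c..d, D s = B d - B c) (fun c => ⟨IntervalIntegrable.refl, by simp⟩) ?_ ?_
    · rintro c d f ⟨h1, h2⟩ ⟨h3, h4⟩
      refine ⟨h1.trans h3, ?_⟩
      rw [← intervalIntegral.integral_add_adjacent_intervals h1 h3, h2, h4]
      ring
    · intro e he δ p q hst hsub
      obtain ⟨D₀, hD₀, -, -, hval⟩ := hst.variation hsub hF hΛ he
      have hi : IntervalIntegrable D volume p q :=
        (hD₀.intervalIntegrable_of_Icc hst.lt.le).congr_uIoo fun s hs => by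
          rw [uIoo_of_le hst.lt.le] at hs
          exact ((hval s hs).1).symm
      refine ⟨hi, ?_⟩
      have hψγ : ∀ s ∈ Icc p q, chartCurve e (ψ 0) s = chartCurve e γ s := fun s hs => by
        simp only [chartCurve, hψ.zero s (hsub hs)]
      have hsrc : ∀ s ∈ Icc p q, (γ s).2 ∈ e.source := fun s hs => by
        rw [← hψ.zero s (hsub hs)]; exact hst.source 0 hst.zero_mem s hs
      set W : ℝ → ℝ × EuclideanSpace ℝ (Fin n) := fun s =>
        deriv (fun r => chartCurve e (ψ r) s) 0 with hW
      set y := chartCurve e γ with hy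
      set y' := derivWithin y (Icc a b) with hy'
      -- The Euler–Lagrange equation differentiates the momentum, the strip differentiates the field
      -- `W`, and the product rule yields `L_x W + L_v W'`.
      have hder : ∀ s ∈ Icc p q, HasDerivWithinAt B (fderiv ℝ (chartLagrangian F Λ e) (y s, y' s)
          (W s, derivWithin W (Icc p q) s)) (Icc p q) s := by
        intro s hs
        have hWd := (hst.contDiffOn_field.differentiableOn one_ne_zero s hs).hasDerivWithinAt
        have h1 := hasDerivWithinAt_apply_of_forall
          (A := fun s => (fderiv ℝ (chartLagrangian F Λ e) (y s, y' s)).comp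
            (ContinuousLinearMap.inr ℝ _ _))
          (A' := (fderiv ℝ (chartLagrangian F Λ e) (y s, y' s)).comp
            (ContinuousLinearMap.inl ℝ _ _))
          (fun u => by
            simpa using (hγ.equation e he s (hsub hs) (hsrc s hs) u).mono hsub) hWd
        refine (h1.congr (fun t ht => ?_) ?_).congr_deriv ?_
        · exact hB t (hsub ht) e he (hsrc t ht)
        · exact hB s (hsub hs) e he (hsrc s hs)
        · simp only [ContinuousLinearMap.comp_apply, ContinuousLinearMap.inl_apply,
            ContinuousLinearMap.inr_apply]
          rw [← map_add]
          simp [hW]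
      refine intervalIntegral.integral_eq_sub_of_hasDerivAt_of_le hst.lt.le
        (fun s hs => (hder s hs).continuousWithinAt) (fun s hs => ?_) hi
      have hs' : s ∈ Icc p q := ⟨hs.1.le, hs.2.le⟩
      have hn : Icc p q ∈ 𝓝 s := Icc_mem_nhds hs.1 hs.2
      have h1 := (hder s hs').hasDerivAt hn
      have hev : chartCurve e (ψ 0) =ᶠ[𝓝 s] y := by
        filter_upwards [hn] with t ht using hψγ t ht
      have h2 : deriv y s = y' s := (derivWithin_of_mem_nhds (mem_of_superset hn hsub)).symm
      have h3 := hval s hs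
      rw [hψγ s hs', hev.deriv_eq, h2] at h3
      rw [derivWithin_of_mem_nhds hn] at h1
      show HasDerivAt B (deriv (fun r =>
        finslerFunction F Λ (ψ r s).2 (velocity (ψ r) (Icc a b) s)) 0) s
      rw [h3.1, h3.2]
      exact h1
  have h0 : ∫ s in a..b, D s = 0 := by
    rw [key.2, hend a ⟨le_rfl, hab.le⟩ hψ.left, hend b ⟨hab.le, le_rfl⟩ hψ.right, sub_zero]
  rw [h0, mul_zero] at hDe
  exact hDe

end Sufficiency

end StaticFinsler

namespace StaticFinsler

open Filter Topology MeasureTheory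

/-! ### Conservation of the Lagrangian and regularity of geodesics -/

section Regularity

set_option linter.unusedSectionVars false

theorem differentiableOn_of_hasDerivWithinAt_Icc {X : Type*} [NormedAddCommGroup X]
    [NormedSpace ℝ X] {y v : ℝ → X} {p q : ℝ} (hy : ContDiffOn ℝ ∞ y (Icc p q))
    (hv : ∀ s ∈ Icc p q, HasDerivWithinAt y (v s) (Icc p q) s) :
    DifferentiableOn ℝ v (Icc p q) := by
  rcases lt_or_ge p q with h | h
  · have hU := uniqueDiffOn_Icc h
    have h1 : ContDiffOn ℝ ∞ (derivWithin y (Icc p q)) (Icc p q) := hy.derivWithin hU (by simp)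
    exact (h1.differentiableOn (by simp)).congr fun s hs => ((hv s hs).derivWithin (hU s hs)).symm
  · exact (subsingleton_Icc_of_ge h).differentiableOn

variable {n : ℕ} {M : Type*} [TopologicalSpace M] [ChartedSpace (EuclideanSpace ℝ (Fin n)) M]
  [IsManifold (𝓡 n) ∞ M]
  {F : TangentBundle (𝓡 n) M → ℝ} {Λ : M → ℝ}
  {e : OpenPartialHomeomorph M (EuclideanSpace ℝ (Fin n))} {γ : ℝ → ℝ × M}
  {a b α s₀ β : ℝ} {v : ℝ → ℝ × EuclideanSpace ℝ (Fin n)}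

theorem contMDiffWithinAt_of_chart {m : WithTop ℕ∞} (hm : m ≤ ∞)
    (he : e ∈ IsManifold.maximalAtlas (𝓡 n) ∞ M) {c : ℝ → M}
    {S : Set ℝ} {s : ℝ} (hc : ContDiffWithinAt ℝ m (fun u => e (c u)) S s)
    (hsrc : ∀ᶠ u in 𝓝[S] s, c u ∈ e.source) (hs : c s ∈ e.source) :
    ContMDiffWithinAt 𝓘(ℝ, ℝ) (𝓡 n) m c S s := by
  have h1 : ContMDiffAt (𝓡 n) (𝓡 n) m e.symm (e (c s)) :=
    ((contMDiffOn_symm_of_mem_maximalAtlas he).contMDiffAt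
      (e.open_target.mem_nhds (e.map_source hs))).of_le hm
  have h2 := h1.comp_contMDiffWithinAt s hc.contMDiffWithinAt
  refine h2.congr_of_eventuallyEq ?_ (by simp [e.left_inv hs])
  filter_upwards [hsrc] with u hu
  simp [e.left_inv hu]

theorem IsLocalSolution.derivWithin_eq (h : IsLocalSolution F Λ e γ α s₀ β v)
    (hγ : SolvesEulerLagrange F Λ a b γ) (he : e ∈ IsManifold.maximalAtlas (𝓡 n) ∞ M)
    (hα : a ≤ α) (hβ : β ≤ b) {s : ℝ} (hs : s ∈ Icc α β) :
    derivWithin (chartCurve e γ) (Icc a b) s = v s :=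
  (uniqueDiffOn_Icc h.lt s hs).eq_deriv _
    ((hasDerivWithinAt_chartCurve hγ.differentiable_fst hγ.differentiable_snd he
      ⟨hα.trans hs.1, hs.2.trans hβ⟩ (h.source s hs)).mono (Icc_subset_Icc hα hβ))
    (h.hasDeriv s hs)

theorem IsLocalSolution.differentiableOn_left (h : IsLocalSolution F Λ e γ α s₀ β v) :
    DifferentiableOn ℝ v (Icc α s₀) :=
  differentiableOn_of_hasDerivWithinAt_Icc h.smooth_left fun s hs =>
    (h.hasDeriv s ⟨hs.1, hs.2.trans h.le_right⟩).mono (Icc_subset_Icc le_rfl h.le_right)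

theorem IsLocalSolution.differentiableOn_right (h : IsLocalSolution F Λ e γ α s₀ β v) :
    DifferentiableOn ℝ v (Icc s₀ β) :=
  differentiableOn_of_hasDerivWithinAt_Icc h.smooth_right fun s hs =>
    (h.hasDeriv s ⟨h.le_left.trans hs.1, hs.2⟩).mono (Icc_subset_Icc h.le_left le_rfl)

theorem fderiv_chartLagrangian_euler (hF : IsFinslerMetric F)
    (hΛ : ContMDiff (𝓡 n) 𝓘(ℝ, ℝ) ∞ Λ) (he : e ∈ IsManifold.maximalAtlas (𝓡 n) ∞ M)
    {y w : ℝ × EuclideanSpace ℝ (Fin n)} (hy : y.2 ∈ e.target) :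
    fderiv ℝ (chartLagrangian F Λ e) (y, w) (0, w) = 2 * chartLagrangian F Λ e (y, w) := by
  obtain ⟨t, x⟩ := y
  obtain ⟨τ, u⟩ := w
  rw [← Prod.mk_zero_zero, fderiv_chartLagrangian hF hΛ he hy, map_zero,
    (coordSq_isCoordFinslerSq hF he).fderiv_euler hy, chartLagrangian]
  ring

/-- The Lagrangian is conserved along solutions of its Euler–Lagrange equations. -/
theorem IsLocalSolution.hasDerivWithinAt_chartLagrangian (hF : IsFinslerMetric F)
    (hΛ : ContMDiff (𝓡 n) 𝓘(ℝ, ℝ) ∞ Λ) (he : e ∈ IsManifold.maximalAtlas (𝓡 n) ∞ M)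
    (h : IsLocalSolution F Λ e γ α s₀ β v) :
    HasDerivWithinAt (fun s => chartLagrangian F Λ e (chartCurve e γ s, v s)) 0 (Icc α β) s₀ := by
  have hs₀ : s₀ ∈ Icc α β := ⟨h.le_left, h.le_right⟩
  have hyt : ∀ s ∈ Icc α β, (chartCurve e γ s).2 ∈ e.target := fun s hs =>
    e.map_source (h.source s hs)
  have key : ∀ S ⊆ Icc α β, s₀ ∈ S → DifferentiableOn ℝ v S →
      HasDerivWithinAt (fun s => chartLagrangian F Λ e (chartCurve e γ s, v s)) 0 S s₀ := by
    intro S hS hm hd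
    have hv := (hd s₀ hm).hasDerivWithinAt
    have hy := (h.hasDeriv s₀ hs₀).mono hS
    have hℒ : DifferentiableAt ℝ (chartLagrangian F Λ e) (chartCurve e γ s₀, v s₀) :=
      ((contDiffOn_chartLagrangian hF hΛ he).contDiffAt
        (((isOpen_univ.prod e.open_target).prod isOpen_univ).mem_nhds
          ⟨⟨mem_univ _, hyt s₀ hs₀⟩, mem_univ _⟩)).differentiableAt one_ne_zero
    have h1 := hℒ.hasFDerivAt.comp_hasDerivWithinAt s₀ (f := fun s => (chartCurve e γ s, v s))
      (hy.prodMk hv)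
    have h2 := hasDerivWithinAt_apply_of_forall
      (A := fun s => (fderiv ℝ (chartLagrangian F Λ e) (chartCurve e γ s, v s)).comp
        (ContinuousLinearMap.inr ℝ _ _))
      (A' := (fderiv ℝ (chartLagrangian F Λ e) (chartCurve e γ s₀, v s₀)).comp
        (ContinuousLinearMap.inl ℝ _ _))
      (fun u => by simpa using (h.eulerLagrange u s₀ hs₀).mono hS) hv
    -- With `p = ∂L/∂v`, Euler's identity `p(v) = 2L` gives `L = p(v) - L`. Both terms on the right
    -- have derivative `L_x(v) + L_v(v')`, the first by the Euler–Lagrange equation and the second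
    -- by the chain rule.
    have hval : ∀ s ∈ S, chartLagrangian F Λ e (chartCurve e γ s, v s)
        = ((fderiv ℝ (chartLagrangian F Λ e) (chartCurve e γ s, v s)).comp
          (ContinuousLinearMap.inr ℝ _ _)) (v s)
          - chartLagrangian F Λ e (chartCurve e γ s, v s) := fun s hs => by
      simp only [ContinuousLinearMap.comp_apply, ContinuousLinearMap.inr_apply]
      rw [fderiv_chartLagrangian_euler hF hΛ he (hyt s (hS hs))]
      ring
    refine ((h2.sub h1).congr hval (hval s₀ hm)).congr_deriv ?_
    simp only [ContinuousLinearMap.comp_apply, ContinuousLinearMap.inr_apply,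
      ContinuousLinearMap.inl_apply]
    rw [← map_add]
    simp
  rw [← Icc_union_Icc_eq_Icc h.le_left h.le_right]
  exact (key _ (Icc_subset_Icc le_rfl h.le_right) ⟨h.le_left, le_rfl⟩ h.differentiableOn_left).union
    (key _ (Icc_subset_Icc h.le_left le_rfl) ⟨le_rfl, h.le_right⟩ h.differentiableOn_right)

theorem IsGeodesic.finslerFunction_velocity_eq (hab : a < b) (hF : IsFinslerMetric F)
    (hΛ : ContMDiff (𝓡 n) 𝓘(ℝ, ℝ) ∞ Λ) (hΛpos : ∀ x, 0 < Λ x) (hγ : IsGeodesic F Λ a b γ) :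
    ∃ C : ℝ, ∀ s ∈ Icc a b,
      finslerFunction F Λ (γ s).2 (velocity γ (Icc a b) s) = C := by
  have hEL := hγ.solvesEulerLagrange hab hF hΛ hΛpos
  have hU := uniqueDiffOn_Icc hab
  have hd : ∀ s ∈ Icc a b, HasDerivWithinAt
      (fun s => finslerFunction F Λ (γ s).2 (velocity γ (Icc a b) s)) 0 (Icc a b) s := by
    intro s hs
    have he : chartAt (EuclideanSpace ℝ (Fin n)) (γ s).2 ∈ IsManifold.maximalAtlas (𝓡 n) ∞ M :=
      IsManifold.chart_mem_maximalAtlas _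
    obtain ⟨α, β, v, hα, hβ, hn, h⟩ := hγ.exists_isLocalSolution hab hF hΛ hΛpos he hs
      (mem_chart_source _ _)
    have hsub : Icc α β ⊆ Icc a b := Icc_subset_Icc hα hβ
    have hval : ∀ t ∈ Icc α β, finslerFunction F Λ (γ t).2 (velocity γ (Icc a b) t)
        = chartLagrangian F Λ (chartAt (EuclideanSpace ℝ (Fin n)) (γ s).2)
          (chartCurve (chartAt (EuclideanSpace ℝ (Fin n)) (γ s).2) γ t, v t) := fun t ht => by
      rw [finslerFunction_velocity he (hEL.differentiable_fst t (hsub ht))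
        (hEL.differentiable_snd t (hsub ht)) (h.source t ht) (hU t (hsub ht)),
        h.derivWithin_eq hEL he hα hβ ht]
    exact ((h.hasDerivWithinAt_chartLagrangian hF hΛ he).congr hval
      (hval s ⟨h.le_left, h.le_right⟩)).mono_of_mem_nhdsWithin hn
  refine ⟨_, constant_of_derivWithin_zero (fun s hs => (hd s hs).differentiableWithinAt)
    fun s hs => (hd s ⟨hs.1, hs.2.le⟩).derivWithin (hU s ⟨hs.1, hs.2.le⟩)⟩

theorem IsGeodesic.contMDiffOn_one (hab : a < b) (hF : IsFinslerMetric F)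
    (hΛ : ContMDiff (𝓡 n) 𝓘(ℝ, ℝ) ∞ Λ) (hΛpos : ∀ x, 0 < Λ x) (hγ : IsGeodesic F Λ a b γ) :
    ContMDiffOn 𝓘(ℝ, ℝ) (𝓡 n) 1 (fun s => (γ s).2) (Icc a b) := by
  intro s hs
  have he : chartAt (EuclideanSpace ℝ (Fin n)) (γ s).2 ∈ IsManifold.maximalAtlas (𝓡 n) ∞ M :=
    IsManifold.chart_mem_maximalAtlas _
  obtain ⟨α, β, v, hα, hβ, hn, h⟩ := hγ.exists_isLocalSolution hab hF hΛ hΛpos he hs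
    (mem_chart_source _ _)
  have hU := uniqueDiffOn_Icc h.lt
  have hy : ContDiffOn ℝ 1 (chartCurve (chartAt (EuclideanSpace ℝ (Fin n)) (γ s).2) γ)
      (Icc α β) := by
    rw [contDiffOn_one_iff_derivWithin hU]
    exact ⟨fun t ht => (h.hasDeriv t ht).differentiableWithinAt,
      h.continuousOn.congr fun t ht => (h.hasDeriv t ht).derivWithin (hU t ht)⟩
  have hx : ContDiffWithinAt ℝ 1
      (fun u => chartAt (EuclideanSpace ℝ (Fin n)) (γ s).2 (γ u).2) (Icc a b) s :=
    (hy.snd s ⟨h.le_left, h.le_right⟩).mono_of_mem_nhdsWithin hn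
  exact contMDiffWithinAt_of_chart (by norm_cast) he hx
    ((eventually_source hγ.1.1 hs (mem_chart_source _ _)).mono fun t ht => ht.2)
    (mem_chart_source _ _)

/-- `θ' = c / Λ(σ)` is as regular as `σ`, so `θ` gains one derivative over `σ`. -/
theorem contDiffOn_derivWithin_time {m : WithTop ℕ∞} (hm : m ≤ ∞)
    (hΛ : ContMDiff (𝓡 n) 𝓘(ℝ, ℝ) ∞ Λ) (hΛpos : ∀ x, 0 < Λ x)
    (hσ : ContMDiffOn 𝓘(ℝ, ℝ) (𝓡 n) m (fun s => (γ s).2) (Icc a b)) {c : ℝ}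
    (hc : ∀ s ∈ Icc a b, Λ (γ s).2 * derivWithin (fun u => (γ u).1) (Icc a b) s = c) :
    ContDiffOn ℝ m (derivWithin (fun u => (γ u).1) (Icc a b)) (Icc a b) := by
  have h1 : ContDiffOn ℝ m (fun s => Λ (γ s).2) (Icc a b) :=
    contMDiffOn_iff_contDiffOn.1 ((hΛ.of_le hm).comp_contMDiffOn hσ)
  refine ((contDiffOn_const (c := c)).div h1 fun s _ => (hΛpos _).ne').congr fun s hs => ?_
  refine eq_div_of_mul_eq (hΛpos _).ne' ?_
  rw [mul_comm]
  exact hc s hs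

theorem IsGeodesic.contDiffOn_time (hab : a < b) (hF : IsFinslerMetric F)
    (hΛ : ContMDiff (𝓡 n) 𝓘(ℝ, ℝ) ∞ Λ) (hΛpos : ∀ x, 0 < Λ x) (hγ : IsGeodesic F Λ a b γ) :
    ContDiffOn ℝ 2 (fun s => (γ s).1) (Icc a b) := by
  have hEL := hγ.solvesEulerLagrange hab hF hΛ hΛpos
  obtain ⟨c, hc⟩ := (hEL.solvesGeodesicEquations hab hF hΛ).time
  rw [show (2 : WithTop ℕ∞) = 1 + 1 by norm_num,
    contDiffOn_succ_iff_derivWithin (uniqueDiffOn_Icc hab)]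
  exact ⟨hEL.differentiable_fst, by simp, contDiffOn_derivWithin_time (by norm_cast) hΛ hΛpos
    (hγ.contMDiffOn_one hab hF hΛ hΛpos) hc⟩

end Regularity

end StaticFinsler

namespace StaticFinsler

open Filter Topology MeasureTheory

/-! ### Causal character, constant curves and critical points of the potential -/

section Character

set_option linter.unusedSectionVars false

/-- Only the ray through `w` enters: along it `f` is the quadratic `(1 + r + q)² f(w)`, so no
smoothness of `f` is needed. -/
theorem verticalHessian_of_homogeneous {V : Type*} [AddCommGroup V] [Module ℝ V] {f : V → ℝ}
    {w : V} (hf : ∀ c : ℝ, 0 < c → f (c • w) = c ^ 2 * f w) : verticalHessian f w w w = f w := by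
  have h0 : ∀ r q : ℝ, w + r • w + q • w = (1 + r + q) • w := fun r q => by
    rw [add_smul, add_smul, one_smul]
  have h1 : ∀ᶠ r in 𝓝 (0 : ℝ),
      deriv (fun q : ℝ => f (w + r • w + q • w)) 0 = 2 * (1 + r) * f w := by
    filter_upwards [Ioi_mem_nhds (show (-1 : ℝ) < 0 by norm_num)] with r hr
    have h2 : (fun q : ℝ => f (w + r • w + q • w)) =ᶠ[𝓝 0] fun q => (1 + r + q) ^ 2 * f w := by
      filter_upwards [Ioi_mem_nhds (show (-1 - r : ℝ) < 0 by linarith [mem_Ioi.1 hr])] with q hq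
      rw [h0, hf _ (by linarith [mem_Ioi.1 hq])]
    rw [h2.deriv_eq]
    have h3 : HasDerivAt (fun q : ℝ => (1 + r + q) ^ 2 * f w) (2 * (1 + r) * f w) 0 := by
      simpa using (((hasDerivAt_id (0 : ℝ)).const_add (1 + r)).pow 2).mul_const (f w)
    exact h3.deriv
  have h4 : HasDerivAt (fun r : ℝ => 2 * (1 + r) * f w) (2 * f w) 0 := by
    simpa using ((((hasDerivAt_id (0 : ℝ)).const_add 1).const_mul 2).mul_const (f w))
  rw [verticalHessian, EventuallyEq.deriv_eq h1, h4.deriv]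
  ring

variable {n : ℕ} {M : Type*} [TopologicalSpace M] [ChartedSpace (EuclideanSpace ℝ (Fin n)) M]
  [IsManifold (𝓡 n) ∞ M]
  {F : TangentBundle (𝓡 n) M → ℝ} {Λ : M → ℝ}
  {e : OpenPartialHomeomorph M (EuclideanSpace ℝ (Fin n))} {γ : ℝ → ℝ × M}
  {a b : ℝ}

theorem IsFinslerMetric.apply_zero (hF : IsFinslerMetric F) (x : M) : F ⟨x, 0⟩ = 0 := by
  have := hF.homogeneous x 0 2 two_pos
  rw [smul_zero] at this
  linarith

theorem verticalHessian_finslerFunction (hF : IsFinslerMetric F) (x : M)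
    (w : ℝ × TangentSpace (𝓡 n) x) :
    verticalHessian (finslerFunction F Λ x) w w w = finslerFunction F Λ x w :=
  verticalHessian_of_homogeneous fun c hc => by
    simp only [finslerFunction, Prod.smul_fst, Prod.smul_snd, hF.homogeneous x _ c hc, smul_eq_mul]
    ring

/-- For a differentiable curve the left and right velocities agree with the velocity within `[a,
b]`. -/
theorem allVelocities_iff (hab : a < b) (hd₁ : DifferentiableOn ℝ (fun s => (γ s).1) (Icc a b))
    (hd₂ : MDifferentiableOn 𝓘(ℝ, ℝ) (𝓡 n) (fun s => (γ s).2) (Icc a b))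
    (P : (x : M) → ℝ × TangentSpace (𝓡 n) x → Prop) :
    AllVelocities P a b γ ↔ ∀ s ∈ Icc a b, P (γ s).2 (velocity γ (Icc a b) s) := by
  have key : ∀ p q s : ℝ, a ≤ p → q ≤ b → p < q → s ∈ Icc p q →
      velocity (n := n) γ (Icc p q) s = velocity γ (Icc a b) s := by
    intro p q s hp hq hpq hs
    have hsub : Icc p q ⊆ Icc a b := Icc_subset_Icc hp hq
    have hU := uniqueDiffOn_Icc hpq s hs
    have h1 := derivWithin_subset hsub hU (hd₁ s (hsub hs))
    have h2 := mfderivWithin_subset hsub hU.uniqueMDiffWithinAt (hd₂ s (hsub hs))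
    rw [velocity, velocity, h1, h2]
  constructor
  · rintro ⟨h1, h2⟩ s hs
    rcases hs.2.eq_or_lt with h | h
    · rw [← key a s s le_rfl hs.2 (h ▸ hab) ⟨hs.1, le_rfl⟩]
      exact h2 s ⟨h ▸ hab, hs.2⟩
    · rw [← key s b s hs.1 le_rfl h ⟨le_rfl, hs.2⟩]
      exact h1 s ⟨hs.1, h⟩
  · intro h
    refine ⟨fun s hs => ?_, fun s hs => ?_⟩
    · rw [key s b s hs.1 le_rfl hs.2 ⟨le_rfl, hs.2.le⟩]
      exact h s ⟨hs.1, hs.2.le⟩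
    · rw [key a s s le_rfl hs.2 hs.1 ⟨hs.1.le, le_rfl⟩]
      exact h s ⟨hs.1.le, hs.2⟩

theorem hasDerivWithinAt_chart_zero_iff {c : ℝ → M} {S : Set ℝ} {s : ℝ}
    (hS : UniqueDiffWithinAt ℝ S s) (hc : MDifferentiableWithinAt 𝓘(ℝ, ℝ) (𝓡 n) c S s)
    (he : e ∈ IsManifold.maximalAtlas (𝓡 n) ∞ M) (hse : c s ∈ e.source) :
    HasDerivWithinAt (fun u => e (c u)) 0 S s ↔
      mfderivWithin 𝓘(ℝ, ℝ) (𝓡 n) c S s (1 : ℝ) = 0 := by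
  have h1 := hasDerivWithinAt_chart he hc hse
  constructor
  · intro h
    have h2 := hS.eq_deriv _ h1 h
    have h3 := mfderiv_symm_mfderiv he hse (mfderivWithin 𝓘(ℝ, ℝ) (𝓡 n) c S s (1 : ℝ))
    exact h3.symm.trans ((congrArg (fun w : EuclideanSpace ℝ (Fin n) =>
      (mfderiv (𝓡 n) (𝓡 n) e.symm (e (c s)) w : EuclideanSpace ℝ (Fin n))) h2).trans
      (map_zero (mfderiv (𝓡 n) (𝓡 n) e.symm (e (c s)))))
  · intro h
    refine h1.congr_deriv ?_
    exact (congrArg (fun w => (mfderiv (𝓡 n) (𝓡 n) e (c s) w : EuclideanSpace ℝ (Fin n))) h).trans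
      (map_zero (mfderiv (𝓡 n) (𝓡 n) e (c s)))

/-- A curve in a manifold with vanishing velocity is constant. -/
theorem eqOn_of_mfderivWithin_eq_zero {c : ℝ → M} (hab : a < b)
    (hc : MDifferentiableOn 𝓘(ℝ, ℝ) (𝓡 n) c (Icc a b))
    (h0 : ∀ s ∈ Icc a b, mfderivWithin 𝓘(ℝ, ℝ) (𝓡 n) c (Icc a b) s (1 : ℝ) = 0) :
    ∀ s ∈ Icc a b, c s = c a := by
  refine interval_induction (P := fun p q => ∀ u ∈ Icc p q, c u = c p) hab.le
    (fun u hu => by rw [le_antisymm hu.2 hu.1]) ?_ ?_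
  · intro p q r _ hpq _ _ h1 h2 u hu
    rcases le_total u q with h | h
    · exact h1 u ⟨hu.1, h⟩
    · rw [h2 u ⟨h, hu.2⟩, h1 q ⟨hpq, le_rfl⟩]
  · intro s hs
    set e := chartAt (EuclideanSpace ℝ (Fin n)) (c s)
    have he : e ∈ IsManifold.maximalAtlas (𝓡 n) ∞ M := IsManifold.chart_mem_maximalAtlas _
    have hse : c s ∈ e.source := mem_chart_source _ _
    have hev : ∀ᶠ u in 𝓝[Icc a b] s, u ∈ Icc a b ∧ c u ∈ e.source := by
      filter_upwards [self_mem_nhdsWithin,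
        (hc s hs).continuousWithinAt (e.open_source.mem_nhds hse)] with u h1 h2 using ⟨h1, h2⟩
    obtain ⟨δ, hδ, hsub⟩ := Metric.mem_nhdsWithin_iff.1 hev
    set α := max a (s - δ / 2) with hα
    set β := min b (s + δ / 2) with hβ
    have hαs : α ≤ s := max_le hs.1 (by linarith)
    have hsβ : s ≤ β := le_min hs.2 (by linarith)
    have hball : ∀ u ∈ Icc α β, u ∈ Icc a b ∧ c u ∈ e.source := fun u hu => by
      have h1 : s - δ / 2 ≤ u := (le_max_right _ _).trans hu.1
      have h2 : u ≤ s + δ / 2 := hu.2.trans (min_le_right _ _)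
      refine hsub ⟨?_, (le_max_left _ _).trans hu.1, hu.2.trans (min_le_left _ _)⟩
      rw [Metric.mem_ball, Real.dist_eq, abs_lt]
      constructor <;> linarith
    have hd : ∀ u ∈ Icc α β, HasDerivWithinAt (fun t => e (c t)) 0 (Icc α β) u := fun u hu =>
      ((hasDerivWithinAt_chart_zero_iff (uniqueDiffOn_Icc hab u (hball u hu).1)
        (hc u (hball u hu).1) he (hball u hu).2).2 (h0 u (hball u hu).1)).mono
        fun t ht => (hball t ht).1
    have hconst : ∀ u ∈ Icc α β, e (c u) = e (c α) :=
      constant_of_derivWithin_zero (fun u hu => (hd u hu).differentiableWithinAt) fun u hu =>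
        (hd u ⟨hu.1, hu.2.le⟩).derivWithin
          (uniqueDiffOn_Icc (hu.1.trans_lt hu.2) u ⟨hu.1, hu.2.le⟩)
    have heq : ∀ u ∈ Icc α β, ∀ t ∈ Icc α β, c u = c t := fun u hu t ht =>
      e.injOn (hball u hu).2 (hball t ht).2 ((hconst u hu).trans (hconst t ht).symm)
    refine ⟨α, β, Icc_mem_nhdsWithin_Icc (le_max_left _ _) hαs hsβ (min_le_left _ _)
      (fun h => max_lt h (by linarith)) fun h => lt_min h (by linarith),
      fun p hp _ u hu => ?_, fun q hq _ u hu => ?_⟩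
    · exact heq _ ⟨hp.1.trans hu.1, hu.2.trans hsβ⟩ _ ⟨hp.1, hp.2.trans hsβ⟩
    · exact heq _ ⟨hαs.trans hu.1, hu.2.trans hq.2⟩ _ ⟨hαs, hsβ⟩

theorem constant_of_velocity_eq_zero (hab : a < b)
    (hd₁ : DifferentiableOn ℝ (fun s => (γ s).1) (Icc a b))
    (hd₂ : MDifferentiableOn 𝓘(ℝ, ℝ) (𝓡 n) (fun s => (γ s).2) (Icc a b))
    (h₁ : ∀ s ∈ Icc a b, (velocity (n := n) γ (Icc a b) s).1 = 0)
    (h₂ : ∀ s ∈ Icc a b, (velocity (n := n) γ (Icc a b) s).2 = 0) :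
    ∃ p : ℝ × M, ∀ s ∈ Icc a b, γ s = p :=
  ⟨γ a, fun s hs => Prod.ext
    (constant_of_derivWithin_zero hd₁ (fun u hu => h₁ u ⟨hu.1, hu.2.le⟩) s hs)
    (eqOn_of_mfderivWithin_eq_zero hab hd₂ h₂ s hs)⟩

/-- The chain rule, once through the inverse chart and once through the chart. -/
theorem mfderiv_eq_zero_iff_fderiv_chart (hΛ : ContMDiff (𝓡 n) 𝓘(ℝ, ℝ) ∞ Λ)
    (he : e ∈ IsManifold.maximalAtlas (𝓡 n) ∞ M) {p : M} (hp : p ∈ e.source) :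
    mfderiv (𝓡 n) 𝓘(ℝ, ℝ) Λ p = 0 ↔ fderiv ℝ (fun x => Λ (e.symm x)) (e p) = 0 := by
  have h1 := (chart_mdifferentiable he).mdifferentiableAt hp
  have h2 := (chart_mdifferentiable he).mdifferentiableAt_symm (e.map_source hp)
  have hΛd : MDifferentiable (𝓡 n) 𝓘(ℝ, ℝ) Λ := hΛ.mdifferentiable (by simp)
  have h3 : MDifferentiableAt (𝓡 n) 𝓘(ℝ, ℝ) (fun x => Λ (e.symm x)) (e p) :=
    (hΛd _).comp (e p) h2
  rw [← mfderiv_eq_fderiv]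
  constructor
  · intro h
    have h4 := mfderiv_comp (e p) (hΛd (e.symm (e p))) h2
    rw [e.left_inv hp, h] at h4
    exact h4.trans (ContinuousLinearMap.zero_comp _)
  · intro h
    have hev : Λ =ᶠ[𝓝 p] (fun x => Λ (e.symm x)) ∘ e := by
      filter_upwards [e.open_source.mem_nhds hp] with q hq
      simp [e.left_inv hq]
    have h4 := mfderiv_comp p h3 h1
    rw [h] at h4
    exact hev.mfderiv_eq.trans (h4.trans (ContinuousLinearMap.zero_comp _))

end Character

end StaticFinsler

namespace StaticFinsler

open Filter Topology MeasureTheory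

/-! ### Classification of nonconstant geodesics -/

section Geodesics

set_option linter.unusedSectionVars false

variable {n : ℕ} {M : Type*} [TopologicalSpace M] [ChartedSpace (EuclideanSpace ℝ (Fin n)) M]
  [IsManifold (𝓡 n) ∞ M]
  {F : TangentBundle (𝓡 n) M → ℝ} {Λ : M → ℝ}
  {e : OpenPartialHomeomorph M (EuclideanSpace ℝ (Fin n))} {γ : ℝ → ℝ × M}
  {a b C : ℝ}

/-- As `Λθ'` is constant and `Λ > 0`, a single zero of `θ'` makes it vanish identically, and `h₂`
then removes the space velocity everywhere. -/
theorem IsGeodesic.constant_of_time_velocity_eq_zero (hab : a < b) (hF : IsFinslerMetric F)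
    (hΛ : ContMDiff (𝓡 n) 𝓘(ℝ, ℝ) ∞ Λ) (hΛpos : ∀ x, 0 < Λ x) (hγ : IsGeodesic F Λ a b γ)
    {s : ℝ} (hs : s ∈ Icc a b) (h₁ : (velocity (n := n) γ (Icc a b) s).1 = 0)
    (h₂ : ∀ s ∈ Icc a b, (velocity (n := n) γ (Icc a b) s).1 = 0 →
      (velocity (n := n) γ (Icc a b) s).2 = 0) :
    ∃ p : ℝ × M, ∀ s ∈ Icc a b, γ s = p := by
  have hEL := hγ.solvesEulerLagrange hab hF hΛ hΛpos
  obtain ⟨c, hc⟩ := (hEL.solvesGeodesicEquations hab hF hΛ).time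
  have hc0 : c = 0 := by
    rw [← hc s hs]
    exact mul_eq_zero_of_right _ h₁
  have h3 : ∀ s ∈ Icc a b, (velocity (n := n) γ (Icc a b) s).1 = 0 := fun u hu =>
    (mul_eq_zero.1 ((hc u hu).trans hc0)).resolve_left (hΛpos _).ne'
  exact constant_of_velocity_eq_zero hab hEL.differentiable_fst hEL.differentiable_snd h3
    fun u hu => h₂ u hu (h3 u hu)

/-- A zero of `σ'` gives `C = -Λθ'² ≤ 0`, hence `C = 0` and `θ' = 0` at that instant. Then wherever
`θ' = 0`, conservation leaves `F²(σ') = 0`, and the curve is constant. -/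
theorem IsGeodesic.velocity_snd_ne_zero (hab : a < b) (hF : IsFinslerMetric F)
    (hΛ : ContMDiff (𝓡 n) 𝓘(ℝ, ℝ) ∞ Λ) (hΛpos : ∀ x, 0 < Λ x) (hγ : IsGeodesic F Λ a b γ)
    (hnc : ¬ ∃ p : ℝ × M, ∀ s ∈ Icc a b, γ s = p)
    (hC : ∀ s ∈ Icc a b, finslerFunction F Λ (γ s).2 (velocity γ (Icc a b) s) = C)
    (hC0 : 0 ≤ C) : ∀ s ∈ Icc a b, (velocity (n := n) γ (Icc a b) s).2 ≠ 0 := by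
  intro s hs h2
  have hCs := hC s hs
  rw [finslerFunction, h2, hF.apply_zero] at hCs
  have hp := hΛpos (γ s).2
  have h1 : (velocity (n := n) γ (Icc a b) s).1 = 0 := by
    by_contra h
    have := mul_pos hp (pow_pos (abs_pos.2 h) 2)
    rw [sq_abs] at this
    linarith
  have hC1 : C = 0 := by rw [← hCs, h1]; ring
  refine hnc (hγ.constant_of_time_velocity_eq_zero hab hF hΛ hΛpos hs h1 fun u hu hu1 => ?_)
  by_contra hne
  have h3 := hC u hu
  rw [finslerFunction, hu1, hC1] at h3
  have := pow_pos (hF.pos _ _ hne) 2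
  linarith

theorem IsGeodesic.contMDiffOn (hab : a < b) (hF : IsFinslerMetric F)
    (hΛ : ContMDiff (𝓡 n) 𝓘(ℝ, ℝ) ∞ Λ) (hΛpos : ∀ x, 0 < Λ x) (hγ : IsGeodesic F Λ a b γ)
    (hne : ∀ s ∈ Icc a b, (velocity (n := n) γ (Icc a b) s).2 ≠ 0) :
    ContMDiffOn 𝓘(ℝ, ℝ) (𝓘(ℝ, ℝ).prod (𝓡 n)) ∞ γ (Icc a b) := by
  have hEL := hγ.solvesEulerLagrange hab hF hΛ hΛpos
  obtain ⟨c, hc⟩ := (hEL.solvesGeodesicEquations hab hF hΛ).time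
  have hU := uniqueDiffOn_Icc hab
  have hσ : ContMDiffOn 𝓘(ℝ, ℝ) (𝓡 n) ∞ (fun s => (γ s).2) (Icc a b) := by
    intro s hs
    set e := chartAt (EuclideanSpace ℝ (Fin n)) (γ s).2
    have he : e ∈ IsManifold.maximalAtlas (𝓡 n) ∞ M := IsManifold.chart_mem_maximalAtlas _
    have hse : (γ s).2 ∈ e.source := mem_chart_source _ _
    obtain ⟨α, β, v, hα, hβ, hn, h⟩ := hγ.exists_isLocalSolution hab hF hΛ hΛpos he hs hse
    have hsub : Icc α β ⊆ Icc a b := Icc_subset_Icc hα hβ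
    set y := chartCurve e γ with hy
    have hyt : ∀ t ∈ Icc α β, (y t).2 ∈ e.target := fun t ht => e.map_source (h.source t ht)
    have hv : ∀ t ∈ Icc α β, v t = (derivWithin (fun u => (γ u).1) (Icc a b) t,
        derivWithin (fun u => e (γ u).2) (Icc a b) t) := fun t ht => by
      rw [← h.derivWithin_eq hEL he hα hβ ht]
      exact derivWithin_chartCurve hab hEL.differentiable_fst hEL.differentiable_snd he (hsub ht)
        (h.source t ht)
    have hv1 : ∀ t ∈ Icc α β, (v t).1 = c / Λ (e.symm (y t).2) := fun t ht => by
      rw [hv t ht]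
      refine eq_div_of_mul_eq (hΛpos _).ne' ?_
      rw [mul_comm, hy, chartCurve, e.left_inv (h.source t ht)]
      exact hc t (hsub ht)
    have hv2 : ∀ t ∈ Icc α β, (v t).2 ≠ 0 := fun t ht h0 => by
      rw [hv t ht] at h0
      have h1 := (hasDerivWithinAt_chart he (hEL.differentiable_snd t (hsub ht))
        (h.source t ht)).differentiableWithinAt.hasDerivWithinAt
      rw [show derivWithin (fun u => e (γ u).2) (Icc a b) t = 0 from h0] at h1
      exact hne t (hsub ht) ((hasDerivWithinAt_chart_zero_iff (hU t (hsub ht))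
        (hEL.differentiable_snd t (hsub ht)) he (h.source t ht)).1 h1)
    have hpot := contDiffOn_chart_potential hΛ he
    -- Eliminating `θ' = c/Λ` turns the force `-θ'² dΛ` into a smooth covector field in `x` alone,
    -- so the space equation decouples from time.
    have hg : ContDiffOn ℝ ∞ (fun x => (-(c / Λ (e.symm x)) ^ 2) •
        fderiv ℝ (fun z => Λ (e.symm z)) x) e.target :=
      ((contDiffOn_const.div hpot fun x _ => (hΛpos _).ne').pow 2).neg.smul
        (hpot.fderiv_of_isOpen e.open_target (by simp))
    have hx : ContDiffOn ℝ ∞ (fun t => (y t).2) (Icc α β) := by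
      refine (coordSq_isCoordFinslerSq hF he).contDiffOn_of_eulerLagrange (v := fun t => (v t).2)
        hg h.le_left h.le_right hyt hv2
        (fun t ht => (h.hasDeriv t ht).snd) h.differentiableOn_left.snd
        h.differentiableOn_right.snd fun t ht u => ?_
      have hval : ∀ t ∈ Icc α β, fderiv ℝ (fun z : EuclideanSpace ℝ (Fin n) ×
          EuclideanSpace ℝ (Fin n) => coordSq F e z.1 z.2) ((y t).2, (v t).2) (0, u)
          = fderiv ℝ (chartLagrangian F Λ e) (y t, v t) (0, (0, u)) := fun t ht => by
        have := fderiv_chartLagrangian hF hΛ he (t := (y t).1) (τ := (v t).1) (ρ := 0) (ρ' := 0)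
          (v := (v t).2) (u := 0) (u' := u) (hyt t ht)
        rw [Prod.mk_zero_zero, map_zero] at this
        rw [this]
        ring
      refine ((h.eulerLagrange (0, u) t ht).congr hval (hval t ht)).congr_deriv ?_
      have := fderiv_chartLagrangian hF hΛ he (t := (y t).1) (τ := (v t).1) (ρ := 0) (ρ' := 0)
          (v := (v t).2) (u := u) (u' := 0) (hyt t ht)
      rw [Prod.mk_zero_zero] at this
      refine this.trans ?_
      rw [hv1 t ht]
      simp only [smul_apply, smul_eq_mul]
      ring
    exact contMDiffWithinAt_of_chart le_rfl he
      ((hx s ⟨h.le_left, h.le_right⟩).mono_of_mem_nhdsWithin hn)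
      ((eventually_source hγ.1.1 hs hse).mono fun t ht => ht.2) hse
  have hθ : ContDiffOn ℝ ∞ (fun s => (γ s).1) (Icc a b) := by
    rw [contDiffOn_infty_iff_derivWithin hU]
    exact ⟨hEL.differentiable_fst, contDiffOn_derivWithin_time le_rfl hΛ hΛpos hσ hc⟩
  exact hθ.contMDiffOn.prodMk hσ

/-- By homogeneity `g_w(w, w) = L(w)`, so the sign of `C` decides at every instant, once `σ'` is
known not to vanish for `C ≥ 0`. -/
theorem IsGeodesic.spacelike_or_lightlike_iff (hab : a < b) (hF : IsFinslerMetric F)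
    (hΛ : ContMDiff (𝓡 n) 𝓘(ℝ, ℝ) ∞ Λ) (hΛpos : ∀ x, 0 < Λ x) (hγ : IsGeodesic F Λ a b γ)
    (hnc : ¬ ∃ p : ℝ × M, ∀ s ∈ Icc a b, γ s = p)
    (hC : ∀ s ∈ Icc a b, finslerFunction F Λ (γ s).2 (velocity γ (Icc a b) s) = C) :
    IsSpacelike F Λ a b γ ∨ IsLightlike F Λ a b γ ↔ 0 ≤ C := by
  have hEL := hγ.solvesEulerLagrange hab hF hΛ hΛpos
  rw [IsSpacelike, IsLightlike, allVelocities_iff hab hEL.differentiable_fst hEL.differentiable_snd,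
    allVelocities_iff hab hEL.differentiable_fst hEL.differentiable_snd]
  have ha : a ∈ Icc a b := ⟨le_rfl, hab.le⟩
  constructor
  · rintro (h | h)
    · rw [← hC a ha]
      rcases h a ha with h | ⟨-, h⟩
      · rw [h, finslerFunction, Prod.fst_zero, Prod.snd_zero, hF.apply_zero]
        norm_num
      · rw [verticalHessian_finslerFunction hF] at h
        exact h.le
    · have := (h a ha).2
      rw [verticalHessian_finslerFunction hF, hC a ha] at this
      exact this.ge
  · intro h
    have hne := hγ.velocity_snd_ne_zero hab hF hΛ hΛpos hnc hC h
    rcases h.eq_or_lt with h0 | h0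
    · right
      intro s hs
      exact ⟨hne s hs, by rw [verticalHessian_finslerFunction hF, hC s hs, h0]⟩
    · left
      intro s hs
      exact Or.inr ⟨hne s hs, by rw [verticalHessian_finslerFunction hF, hC s hs]; exact h0⟩

/-- The differential of `F²` vanishes at zero velocity, so the space equation reads `dΛ θ'² = 0`.
Here `θ' ≠ 0`, since otherwise the curve would be constant. -/
theorem IsGeodesic.vertical (hab : a < b) (hF : IsFinslerMetric F)
    (hΛ : ContMDiff (𝓡 n) 𝓘(ℝ, ℝ) ∞ Λ) (hΛpos : ∀ x, 0 < Λ x) (hγ : IsGeodesic F Λ a b γ)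
    (hnc : ¬ ∃ p : ℝ × M, ∀ s ∈ Icc a b, γ s = p)
    (hC : ∀ s ∈ Icc a b, finslerFunction F Λ (γ s).2 (velocity γ (Icc a b) s) = C)
    {x₀ : M} (hx₀ : ∀ s ∈ Icc a b, (γ s).2 = x₀) :
    C < 0 ∧ mfderiv (𝓡 n) 𝓘(ℝ, ℝ) Λ x₀ = 0 ∧
      ∃ m : ℝ, m ≠ 0 ∧ ∀ s ∈ Icc a b, derivWithin (fun u => (γ u).1) (Icc a b) s = m := by
  have hEL := hγ.solvesEulerLagrange hab hF hΛ hΛpos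
  obtain ⟨c, hc⟩ := (hEL.solvesGeodesicEquations hab hF hΛ).time
  have hU := uniqueDiffOn_Icc hab
  have ha : a ∈ Icc a b := ⟨le_rfl, hab.le⟩
  set e := chartAt (EuclideanSpace ℝ (Fin n)) x₀
  have he : e ∈ IsManifold.maximalAtlas (𝓡 n) ∞ M := IsManifold.chart_mem_maximalAtlas _
  have hx₀e : x₀ ∈ e.source := mem_chart_source _ _
  have hse : ∀ s ∈ Icc a b, (γ s).2 ∈ e.source := fun s hs => by rw [hx₀ s hs]; exact hx₀e
  have hd0 : ∀ s ∈ Icc a b, HasDerivWithinAt (fun u => e (γ u).2) 0 (Icc a b) s := fun s hs =>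
    (hasDerivWithinAt_const s (Icc a b) (e x₀)).congr (fun u hu => by rw [hx₀ u hu])
      (by rw [hx₀ s hs])
  have h2 : ∀ s ∈ Icc a b, (velocity (n := n) γ (Icc a b) s).2 = 0 := fun s hs =>
    (hasDerivWithinAt_chart_zero_iff (hU s hs) (hEL.differentiable_snd s hs) he (hse s hs)).1
      (hd0 s hs)
  have h1 : ∀ s ∈ Icc a b, (velocity (n := n) γ (Icc a b) s).1 ≠ 0 := fun s hs h0 =>
    hnc (hγ.constant_of_time_velocity_eq_zero hab hF hΛ hΛpos hs h0 fun u hu _ => h2 u hu)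
  refine ⟨?_, ?_, c / Λ x₀, ?_, fun s hs => ?_⟩
  · rw [← hC a ha, finslerFunction, h2 a ha, hF.apply_zero]
    have := mul_pos (hΛpos (γ a).2) (pow_pos (abs_pos.2 (h1 a ha)) 2)
    rw [sq_abs] at this
    linarith
  · rw [mfderiv_eq_zero_iff_fderiv_chart hΛ he hx₀e]
    ext1 u
    have hy : ∀ s ∈ Icc a b, derivWithin (chartCurve e γ) (Icc a b) s
        = ((velocity (n := n) γ (Icc a b) s).1, 0) := fun s hs => by
      rw [derivWithin_chartCurve hab hEL.differentiable_fst hEL.differentiable_snd he hs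
        (hse s hs), (hd0 s hs).derivWithin (hU s hs)]
      rfl
    have h3 := hEL.equation e he a ha (hse a ha) (0, u)
    have hval : ∀ s ∈ Icc a b, (0 : ℝ) = fderiv ℝ (chartLagrangian F Λ e)
        (chartCurve e γ s, derivWithin (chartCurve e γ) (Icc a b) s) (0, (0, u)) := fun s hs => by
      rw [hy s hs, ← Prod.mk_zero_zero, chartCurve,
        fderiv_chartLagrangian hF hΛ he (e.map_source (hse s hs)), map_zero,
        (coordSq_isCoordFinslerSq hF he).fderiv_zero (e.map_source (hse s hs))]
      simp
    have h4 := (hU a ha).eq_deriv _ (h3.congr hval (hval a ha))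
      (hasDerivWithinAt_const a (Icc a b) (0 : ℝ))
    rw [hy a ha, ← Prod.mk_zero_zero, chartCurve,
      fderiv_chartLagrangian hF hΛ he (e.map_source (hse a ha)),
      (coordSq_isCoordFinslerSq hF he).fderiv_zero (e.map_source (hse a ha)), hx₀ a ha] at h4
    simp only [mul_zero, sub_zero, zero_apply, add_zero, neg_mul,
      neg_eq_zero, mul_eq_zero] at h4
    exact h4.resolve_right (pow_ne_zero 2 (h1 a ha))
  · refine div_ne_zero (fun h0 => h1 a ha ?_) (hΛpos _).ne'
    exact (mul_eq_zero.1 ((hc a ha).trans h0)).resolve_left (hΛpos _).ne'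
  · refine eq_div_of_mul_eq (hΛpos _).ne' ?_
    rw [mul_comm, ← hc s hs, hx₀ s hs]

/-- Along the line the momentum is the constant covector `(-2Λ(x₀)m, 0)`, and the force vanishes
because `dΛ(x₀) = 0` and `F²` has zero differential at zero velocity. -/
theorem isGeodesic_and_isTimelike_vertical (hab : a < b) (hF : IsFinslerMetric F)
    (hΛ : ContMDiff (𝓡 n) 𝓘(ℝ, ℝ) ∞ Λ) {x₀ : M} (hx₀ : mfderiv (𝓡 n) 𝓘(ℝ, ℝ) Λ x₀ = 0)
    (θ₀ : ℝ) {m : ℝ} (hm : m ≠ 0) :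
    IsGeodesic F Λ a b (fun s => (θ₀ + m * (s - a), x₀)) ∧
      IsTimelike F Λ a b (fun s => (θ₀ + m * (s - a), x₀)) := by
  set γ : ℝ → ℝ × M := fun s => (θ₀ + m * (s - a), x₀) with hγ
  have hU := uniqueDiffOn_Icc hab
  have hθ : ∀ s ∈ Icc a b, HasDerivWithinAt (fun s => (γ s).1) m (Icc a b) s := fun s _ =>
    ((((hasDerivAt_id s).sub_const a).const_mul m).const_add θ₀).hasDerivWithinAt.congr_deriv
      (mul_one m)
  have hd₁ : DifferentiableOn ℝ (fun s => (γ s).1) (Icc a b) := fun s hs =>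
    (hθ s hs).differentiableWithinAt
  have hd₂ : MDifferentiableOn 𝓘(ℝ, ℝ) (𝓡 n) (fun s => (γ s).2) (Icc a b) :=
    mdifferentiableOn_const
  have hsm : ContMDiff 𝓘(ℝ, ℝ) (𝓘(ℝ, ℝ).prod (𝓡 n)) ∞ γ := by
    have h1 : ContDiff ℝ ∞ fun s : ℝ => θ₀ + m * (s - a) := by fun_prop
    exact h1.contMDiff.prodMk contMDiff_const
  have hps : IsPiecewiseSmooth (𝓘(ℝ, ℝ).prod (𝓡 n)) a b γ := by
    refine ⟨hsm.continuous.continuousOn, 1, ![a, b], ⟨?_, rfl, rfl⟩, fun j => hsm.contMDiffOn⟩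
    rw [Fin.strictMono_iff_lt_succ]
    intro i
    fin_cases i
    exact hab
  have hd0 : ∀ (e : OpenPartialHomeomorph M (EuclideanSpace ℝ (Fin n))), ∀ s ∈ Icc a b,
      HasDerivWithinAt (fun u => e (γ u).2) 0 (Icc a b) s := fun e s _ =>
    hasDerivWithinAt_const s (Icc a b) (e x₀)
  refine ⟨SolvesEulerLagrange.isGeodesic hab hF hΛ hps ⟨hd₁, hd₂, hps.1, fun e he s hs hse u => ?_⟩,
    (allVelocities_iff hab hd₁ hd₂ _).2 fun s hs => Or.inl ⟨?_, ?_⟩⟩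
  · obtain ⟨ρ, u⟩ := u
    have hse' : x₀ ∈ e.source := hse
    have hy : ∀ s ∈ Icc a b, derivWithin (chartCurve e γ) (Icc a b) s = (m, 0) := fun s hs => by
      rw [derivWithin_chartCurve hab hd₁ hd₂ he hs hse', (hd0 e s hs).derivWithin (hU s hs),
        (hθ s hs).derivWithin (hU s hs)]
    have hval : ∀ s ∈ Icc a b, fderiv ℝ (chartLagrangian F Λ e)
        (chartCurve e γ s, derivWithin (chartCurve e γ) (Icc a b) s) (0, (ρ, u))
        = -2 * Λ x₀ * m * ρ := fun s hs => by
      rw [hy s hs, ← Prod.mk_zero_zero, chartCurve,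
        fderiv_chartLagrangian hF hΛ he (e.map_source hse'), map_zero, e.left_inv hse',
        (coordSq_isCoordFinslerSq hF he).fderiv_zero (e.map_source hse'),
        zero_apply]
      ring
    refine ((hasDerivWithinAt_const s (Icc a b) (-2 * Λ x₀ * m * ρ)).congr hval
      (hval s hs)).congr_deriv ?_
    rw [hy s hs, ← Prod.mk_zero_zero, chartCurve,
        fderiv_chartLagrangian hF hΛ he (e.map_source hse'),
        (mfderiv_eq_zero_iff_fderiv_chart hΛ he hse').1 hx₀,
        (coordSq_isCoordFinslerSq hF he).fderiv_zero (e.map_source hse')]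
    simp
  · have he : chartAt (EuclideanSpace ℝ (Fin n)) x₀ ∈ IsManifold.maximalAtlas (𝓡 n) ∞ M :=
      IsManifold.chart_mem_maximalAtlas _
    exact (hasDerivWithinAt_chart_zero_iff (hU s hs) (hd₂ s hs) he
      (mem_chart_source (EuclideanSpace ℝ (Fin n)) x₀)).1 (hd0 _ s hs)
  · exact ((hθ s hs).derivWithin (hU s hs)).trans_ne hm

end Geodesics

end StaticFinsler

theorem mainTheorem5 {n : ℕ} {M : Type*} [TopologicalSpace M]
    [ChartedSpace (EuclideanSpace ℝ (Fin n)) M] [IsManifold (𝓡 n) ∞ M]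
    [T2Space M] [ParacompactSpace M] [ConnectedSpace M]
    (F : TangentBundle (𝓡 n) M → ℝ) (hF : StaticFinsler.IsFinslerMetric F)
    (Λ : M → ℝ) (hΛ : ContMDiff (𝓡 n) 𝓘(ℝ, ℝ) ∞ Λ) (hΛpos : ∀ x, 0 < Λ x)
    (a b : ℝ) (hab : a < b) :
    -- characterization of the geodesics among the continuous piecewise smooth curves
    (∀ γ : ℝ → ℝ × M, StaticFinsler.IsPiecewiseSmooth (𝓘(ℝ, ℝ).prod (𝓡 n)) a b γ →
      (StaticFinsler.IsGeodesic F Λ a b γ ↔ StaticFinsler.SolvesGeodesicEquations F Λ a b γ)) ∧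
    -- regularity and conservation of `L`
    (∀ γ : ℝ → ℝ × M, StaticFinsler.IsGeodesic F Λ a b γ →
      ContMDiffOn 𝓘(ℝ, ℝ) (𝓡 n) 1 (fun s => (γ s).2) (Icc a b) ∧
      ContDiffOn ℝ 2 (fun s => (γ s).1) (Icc a b) ∧
      ∃ C : ℝ, ∀ s ∈ Icc a b, StaticFinsler.finslerFunction F Λ (γ s).2
        (StaticFinsler.velocity γ (Icc a b) s) = C) ∧
    -- nonconstant geodesics, with `L` constantly equal to `C`
    (∀ (γ : ℝ → ℝ × M) (C : ℝ), StaticFinsler.IsGeodesic F Λ a b γ →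
      (¬ ∃ p : ℝ × M, ∀ s ∈ Icc a b, γ s = p) →
      (∀ s ∈ Icc a b, StaticFinsler.finslerFunction F Λ (γ s).2
        (StaticFinsler.velocity γ (Icc a b) s) = C) →
      ((StaticFinsler.IsSpacelike F Λ a b γ ∨ StaticFinsler.IsLightlike F Λ a b γ) ↔ 0 ≤ C) ∧
      (0 ≤ C →
        (∀ s ∈ Icc a b, (StaticFinsler.velocity (n := n) γ (Icc a b) s).2 ≠ 0) ∧
        ContMDiffOn 𝓘(ℝ, ℝ) (𝓘(ℝ, ℝ).prod (𝓡 n)) ∞ γ (Icc a b)) ∧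
      (∀ x₀ : M, (∀ s ∈ Icc a b, (γ s).2 = x₀) →
        C < 0 ∧ mfderiv (𝓡 n) 𝓘(ℝ, ℝ) Λ x₀ = 0 ∧
        ∃ m : ℝ, m ≠ 0 ∧ ∀ s ∈ Icc a b, derivWithin (fun u => (γ u).1) (Icc a b) s = m)) ∧
    -- timelike lines at critical points of `Λ`
    (∀ x₀ : M, mfderiv (𝓡 n) 𝓘(ℝ, ℝ) Λ x₀ = 0 → ∀ θ₀ m : ℝ, m ≠ 0 →
      StaticFinsler.IsGeodesic F Λ a b (fun s => (θ₀ + m * (s - a), x₀)) ∧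
      StaticFinsler.IsTimelike F Λ a b (fun s => (θ₀ + m * (s - a), x₀))) := by
  refine ⟨fun γ hps => ⟨fun h => ?_, fun h => ?_⟩, fun γ h => ?_, fun γ C h hnc hC => ?_,
    fun x₀ hx₀ θ₀ m hm => StaticFinsler.isGeodesic_and_isTimelike_vertical hab hF hΛ hx₀ θ₀ hm⟩
  · exact (h.solvesEulerLagrange hab hF hΛ hΛpos).solvesGeodesicEquations hab hF hΛ
  · exact (h.solvesEulerLagrange hab hF hΛ hps.1).isGeodesic hab hF hΛ hps
  · exact ⟨h.contMDiffOn_one hab hF hΛ hΛpos, h.contDiffOn_time hab hF hΛ hΛpos,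
      h.finslerFunction_velocity_eq hab hF hΛ hΛpos⟩
  · refine ⟨h.spacelike_or_lightlike_iff hab hF hΛ hΛpos hnc hC, fun hC0 => ?_,
      fun x₀ hx₀ => h.vertical hab hF hΛ hΛpos hnc hC hx₀⟩
    have hne := h.velocity_snd_ne_zero hab hF hΛ hΛpos hnc hC hC0
    exact ⟨hne, h.contMDiffOn hab hF hΛ hΛpos hne⟩
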